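/- **Setting.** Let $\Gamma$ be a finite simple graph with vertices $1,\dots,n+1$; write $i\sim j$ for adjacent vertices. For every finite field $\mathbb F_q$ with $q\equiv 1 \bmod 4$ let a weight $H(f_1,\dots,f_{n+1})\in\mathbb C$ be given for all monic $f_1,\dots,f_{n+1}\in\mathbb F_q[t]$, and for $a=(a_1,\dots,a_{n+1})\in\mathbb Z_{\ge 0}^{n+1}$ put $$c_{a}(q)=\sum_{\substack{f_j\ \text{monic}\\ \deg f_j=a_j}}H(f_1,\dots,f_{n+1}),\qquad Z(\mathbf x)=\sum_{a}c_a(q)\,x_1^{a_1}\cdots x_{n+1}^{a_{n+1}},\qquad Z_p(\mathbf x)=\sum_a H(p^{a_1},\dots,p^{a_{n+1}})\,x_1^{a_1\deg p}\cdots x_{n+1}^{a_{n+1}\deg p}$$ for $p$ prime, i.e. monic irreducible. Let $\left(\frac{f}{g}\right)$ be the quadratic residue symbol. Assume the four axioms: 1. (Twisted multiplicativity) If $f_1\cdots f_{n+1}$ and $g_1\cdots g_{n+1}$ are relatively prime, then $H(f_1g_1,\dots,f_{n+1}g_{n+1})=H(f_1,\dots,f_{n+1})\,H(g_1,\dots,g_{n+1})\prod_{i\sim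 j}\left(\frac{f_i}{g_j}\right)$, the product being over ordered pairs $(i,j)$ of adjacent vertices. 2. (Local to global) For each $a$, $c_a(q)$ and $H(p^{a_1},\dots,p^{a_{n+1}})$ are given, for all $q$ and $p$, by polynomials in $q$ and in $q^{\deg p}$ respectively, of degree at most $a_1+\cdots+a_{n+1}$, and $q^{(a_1+\cdots+a_{n+1})\deg p}\,c_a(q^{-\deg p})=H(p^{a_1},\dots,p^{a_{n+1}})$. 3. (Dominance) Unless $a$ is $0$ or a standard basis vector, the polynomial giving $H(p^{a_1},\dots,p^{a_{n+1}})$ has degree less than $(a_1+\cdots+a_{n+1}-1)/2$. 4. (Initial conditions) $H(1,\dots,1,f_i,1,\dots,1)=1$ for every $i$ and every monic $f_i$. **Proposition.** Fix $q$, a prime $p\in\mathbb F_q[t]$, a vertex $i$ and $a_j\ge 0$ for $j\ne i$; put $A=\sum_{j\sim i}a_j$ and $$\lambda(x_i)=\sum_{a_i\ge 0}c_{a_1,\dots,a_i,\dots,a_{n+1}}(q)\,x_i^{a_i},\qquad \lambda_p(x_i^{\deg p})=\sum_{a_i\ge 0}H(p^{a_1},\dots,p^{a_i},\dots,p^{a_{n+1}})\,x_i^{a_i\deg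 p}.$$ *Odd case.* If $A$ is odd, then $\lambda(x)$ and $\lambda_p(y)$ are polynomials, in $x$ and in $y$, of degree at most $A-1$, and $$(q^{1/2}x_i)^{A-1}\lambda(q^{-1}x_i^{-1})=\lambda(x_i),\qquad (q^{1/2}x_i)^{(A-1)\deg p}\lambda_p\big((q^{-1}x_i^{-1})^{\deg p}\big)=\lambda_p(x_i^{\deg p}).$$ *Even case.* If $A$ is even, then $\lambda(x)$ and $\lambda_p(y)$ are rational functions with denominators $1-qx$ and $1-y$ respectively and numerators of degree at most $A$, and $$(q^{1/2}x_i)^{A}(1-x_i^{-1})\lambda(q^{-1}x_i^{-1})=(1-qx_i)\lambda(x_i),$$ $$(q^{1/2}x_i)^{A\deg p}(1-q^{-\deg p}x_i^{-\deg p})\lambda_p\big((q^{-1}x_i^{-1})^{\deg p}\big)=(1-x_i^{\deg p})\lambda_p(x_i^{\deg p}).$$ *Recurrences.* Write $c_k$ and $h_k$ for the coefficients of $\lambda(x)$ and $\lambda_p(y)$, with $c_k=h_k=0$ for $k<0$, and $T=q^{\deg p}$. For all $k\in\mathbb Z$: if $A$ is odd, then $c_k=q^{k-(A-1)/2}c_{A-1-k}$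 and $h_k=T^{k-(A-1)/2}h_{A-1-k}$; if $A$ is even, then $c_k-qc_{k-1}=q^{k-A/2}(c_{A-k}-qc_{A-k-1})$ and $h_k-h_{k-1}=T^{k-A/2}(h_{A-k}-h_{A-k-1})$. *Functional equations of $Z$.* Let $(\sigma_i(\mathbf x))_i=q^{-1}x_i^{-1}$, $(\sigma_i(\mathbf x))_j=q^{1/2}x_ix_j$ for $j\sim i$, and $(\sigma_i(\mathbf x))_j=x_j$ otherwise. Let the subscripts odd and even denote the restriction of $Z$ and $Z_p$ to the terms with $\sum_{j\sim i}a_j$ odd or even. Then, as identities of formal series (in integer powers of the variables), $$Z_{\mathrm{odd}}(\sigma_i(\mathbf x))=q^{1/2}x_iZ_{\mathrm{odd}}(\mathbf x),\qquad (1-x_i^{-1})Z_{\mathrm{even}}(\sigma_i(\mathbf x))=(1-qx_i)Z_{\mathrm{even}}(\mathbf x),$$ $$Z_{p,\mathrm{odd}}(\sigma_i(\mathbf x))=q^{\deg p/2}x_i^{\deg p}Z_{p,\mathrm{odd}}(\mathbf x),\qquad (1-q^{-\deg p}x_i^{-\deg p})Z_{p,\mathrm{even}}(\sigma_i(\mathbf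 x))=(1-x_i^{\deg p})Z_{p,\mathrm{even}}(\mathbf x).$$ -/

import Mathlib

open scoped Polynomial PowerSeries

noncomputable section

namespace WeylMDS

open Classical in
/-- The quadratic character modulo a prime `p` of `F[t]`: `0` if `p ∣ g`, and otherwise `1` or `-1`
according to whether `g` is a square modulo `p` or not. -/
def quadChar {F : Type} [Field F] (p g : F[X]) : ℤ :=
  if p ∣ g then 0 else if ∃ h : F[X], p ∣ g - h ^ 2 then 1 else -1

open Classical in
/-- The quadratic residue symbol `χ_f(g)` for monic `f`: the product of the quadratic characters
modulo the prime factors of `f`, taken with multiplicity. -/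
def residueSymbol {F : Type} [Field F] (f g : F[X]) : ℤ :=
  ((UniqueFactorizationMonoid.normalizedFactors f).map fun p => quadChar p g).prod

/-- The tuples of monic polynomials with prescribed degrees `a`. -/
def monicTuples {V : Type*} (F : Type) [Field F] (a : V → ℕ) : Set (V → F[X]) :=
  {f | ∀ j, (f j).Monic ∧ (f j).natDegree = a j}

/-- Over a finite field there are finitely many such tuples, so that sums over them are honest. -/
theorem monicTuples_finite {V : Type*} [Finite V] (F : Type) [Field F] [Finite F] (a : V → ℕ) :
    (monicTuples F a).Finite := by
  have h : ∀ n : ℕ, {g : F[X] | g.Monic ∧ g.natDegree = n}.Finite := by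
    intro n
    have hinj : Set.InjOn (fun (g : F[X]) (k : Fin (n + 1)) => g.coeff k)
        {g : F[X] | g.Monic ∧ g.natDegree = n} := by
      rintro g ⟨-, hg⟩ g' ⟨-, hg'⟩ hgg
      ext k
      by_cases hk : k < n + 1
      · exact congrFun hgg ⟨k, hk⟩
      · rw [Polynomial.coeff_eq_zero_of_natDegree_lt (by omega),
          Polynomial.coeff_eq_zero_of_natDegree_lt (by omega)]
    exact Set.Finite.of_finite_image (Set.toFinite _) hinj
  have h2 : monicTuples F a = Set.univ.pi fun j => {g : F[X] | g.Monic ∧ g.natDegree = a j} := by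
    ext f
    simp [monicTuples]
  rw [h2]
  exact Set.Finite.pi' (fun j => h (a j)) |>.subset (fun f hf j => hf j (Set.mem_univ j))

/-- A choice of weights: one weight function on tuples of polynomials for each finite field. Only
its values on tuples of monic polynomials over fields with `q ≡ 1 mod 4` are ever used. -/
abbrev Weights (V : Type*) : Type _ :=
  ∀ (F : Type) [Field F] [Finite F], (V → F[X]) → ℂ

/-- The coefficient `c_a(q)`: the sum of the weights over all tuples of monic polynomials of
degrees `a`. -/
def globalCoeff {V : Type*} (H : Weights V) (F : Type) [Field F] [Finite F] (a : V → ℕ) : ℂ :=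
  ∑ᶠ (f : V → F[X]) (_ : f ∈ monicTuples F a), H F f

/-- The local weight `H(p^{a_1}, …, p^{a_{n+1}})`. -/
def localWeight {V : Type*} (H : Weights V) (F : Type) [Field F] [Finite F] (p : F[X])
    (a : V → ℕ) : ℂ :=
  H F (fun j => p ^ a j)

/-- The four axioms for weights `H` on the graph `Γ`. The polynomials `C a` and `P a` are the
ones which give `c_a(q)` and `H(p^a)` as polynomials in `q` and in `q ^ deg p`. -/
structure FourAxioms {V : Type*} [Fintype V] [DecidableEq V] (Γ : SimpleGraph V)
    [DecidableRel Γ.Adj] (H : Weights V) (C P : (V → ℕ) → ℂ[X]) : Prop where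
  /-- Twisted multiplicativity. The product is over ordered pairs of adjacent vertices. -/
  twisted_mul : ∀ (F : Type) [Field F] [Finite F], Nat.card F % 4 = 1 →
    ∀ f g : V → F[X], (∀ j, (f j).Monic) → (∀ j, (g j).Monic) →
      IsCoprime (∏ j, f j) (∏ j, g j) →
      H F (fun j => f j * g j) =
        H F f * H F g * ∏ i, ∏ j ∈ Γ.neighborFinset i, (residueSymbol (f i) (g j) : ℂ)
  /-- Local to global: `c_a(q)` is a polynomial in `q`, -/
  global_poly : ∀ (F : Type) [Field F] [Finite F], Nat.card F % 4 = 1 →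
    ∀ a : V → ℕ, globalCoeff H F a = (C a).eval (Nat.card F : ℂ)
  /-- `H(p^a)` is a polynomial in `q ^ deg p`, -/
  local_poly : ∀ (F : Type) [Field F] [Finite F], Nat.card F % 4 = 1 →
    ∀ p : F[X], p.Monic → Irreducible p →
      ∀ a : V → ℕ, localWeight H F p a = (P a).eval ((Nat.card F : ℂ) ^ p.natDegree)
  /-- both of degree at most `∑ a_j`, -/
  natDegree_global : ∀ a : V → ℕ, (C a).natDegree ≤ ∑ j, a j
  natDegree_local : ∀ a : V → ℕ, (P a).natDegree ≤ ∑ j, a j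
  /-- and they determine each other. -/
  local_global : ∀ (F : Type) [Field F] [Finite F], Nat.card F % 4 = 1 →
    ∀ p : F[X], p.Monic → Irreducible p → ∀ a : V → ℕ,
      (Nat.card F : ℂ) ^ ((∑ j, a j) * p.natDegree) *
          (C a).eval (((Nat.card F : ℂ) ^ p.natDegree)⁻¹) =
        localWeight H F p a
  /-- Dominance: the degree of `P a` is less than `(∑ a_j - 1) / 2`, except when `a` is zero or a
  standard basis vector. -/
  dominance : ∀ a : V → ℕ, a ≠ 0 → (∀ i, a ≠ Pi.single i 1) →
    2 * (P a).natDegree + 1 < ∑ j, a j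
  /-- Initial conditions. -/
  initial : ∀ (F : Type) [Field F] [Finite F], Nat.card F % 4 = 1 →
    ∀ (i : V) (f : F[X]), f.Monic → H F (Function.update (fun _ => 1) i f) = 1

/-- `∑_{j ∼ i} a_j`. -/
def nbrSum {V : Type*} {M : Type*} [AddCommMonoid M] (Γ : SimpleGraph V) [Fintype V]
    [DecidableRel Γ.Adj] (i : V) (a : V → M) : M :=
  ∑ j ∈ Γ.neighborFinset i, a j

/-- The one-variable series `∑_k u(a_1, …, k, …, a_{n+1}) X^k` with `k` in position `i`
(the value `a i` is not used). -/
def slice {V : Type*} [DecidableEq V] (u : (V → ℕ) → ℂ) (i : V) (a : V → ℕ) : ℂ⟦X⟧ :=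
  PowerSeries.mk fun k => u (Function.update a i k)

/-- The coefficient of a one-variable power series at an integer index, zero at negative ones. -/
def coeffZ (s : ℂ⟦X⟧) (k : ℤ) : ℂ :=
  if k < 0 then 0 else PowerSeries.coeff k.toNat s

/-- Formal bilateral series `∑_{b ∈ ℤ^V} S_b x^b` in the variables `x_j`, `j ∈ V`. -/
abbrev BiSeries (V : Type*) : Type _ := (V → ℤ) → ℂ

open Classical in
/-- The series `∑_{a ∈ ℕ^V} u(a) ∏_j x_j^{d a_j}`, for `d ≥ 1`. -/
def toBiSeries {V : Type*} (d : ℕ) (u : (V → ℕ) → ℂ) : BiSeries V :=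
  fun b => if ∀ j, 0 ≤ b j ∧ (d : ℤ) ∣ b j then u (fun j => (b j / d).toNat) else 0

/-- The product `z x_i^m S(x)`. -/
def monomialMul {V : Type*} [DecidableEq V] (z : ℂ) (i : V) (m : ℤ) (S : BiSeries V) :
    BiSeries V :=
  fun b => z * S (Function.update b i (b i - m))

/-- The transformation `σ_i` of the variables: `x_i ↦ q⁻¹ x_i⁻¹`, and `x_j ↦ q^{1/2} x_i x_j` for
`j ∼ i`, and `x_j ↦ x_j` otherwise. -/
def sigma {V : Type*} [DecidableEq V] (Γ : SimpleGraph V) [DecidableRel Γ.Adj] (q : ℕ) (i : V)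
    (x : V → ℂ) : V → ℂ :=
  fun j => if j = i then (q : ℂ)⁻¹ * (x i)⁻¹
    else if Γ.Adj i j then ((√(q : ℝ) : ℝ) : ℂ) * x i * x j else x j

/-- The action of `σ_i` on exponents: `b_i ↦ ∑_{j ∼ i} b_j - b_i`, the other `b_j` unchanged. It is
an involution. -/
def reflectExp {V : Type*} [DecidableEq V] [Fintype V] (Γ : SimpleGraph V) [DecidableRel Γ.Adj]
    (i : V) (b : V → ℤ) : V → ℤ :=
  Function.update b i (nbrSum Γ i b - b i)

theorem nbrSum_reflectExp {V : Type*} [DecidableEq V] [Fintype V] (Γ : SimpleGraph V)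
    [DecidableRel Γ.Adj] (i : V) (b : V → ℤ) :
    nbrSum Γ i (reflectExp Γ i b) = nbrSum Γ i b := by
  unfold nbrSum reflectExp
  refine Finset.sum_congr rfl fun j hj => ?_
  rw [Function.update_of_ne]
  rintro rfl
  simp at hj

theorem reflectExp_reflectExp {V : Type*} [DecidableEq V] [Fintype V] (Γ : SimpleGraph V)
    [DecidableRel Γ.Adj] (i : V) (b : V → ℤ) :
    reflectExp Γ i (reflectExp Γ i b) = b := by
  rw [reflectExp, nbrSum_reflectExp]
  simp [reflectExp]

/-- The monomial `x^b` evaluated at `σ_i(x)` is `q^{(∑_{j ∼ i} b_j) / 2 - b_i}` times the monomial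
with the reflected exponent. -/
theorem prod_sigma_zpow {V : Type*} [DecidableEq V] [Fintype V] (Γ : SimpleGraph V)
    [DecidableRel Γ.Adj] (q : ℕ) (hq : q ≠ 0) (i : V) (x : V → ℂ) (hx : ∀ j, x j ≠ 0)
    (b : V → ℤ) :
    ∏ j, sigma Γ q i x j ^ b j =
      ((√(q : ℝ) : ℝ) : ℂ) ^ (nbrSum Γ i b - 2 * b i) * ∏ j, x j ^ reflectExp Γ i b j := by
  have hs : ((√(q : ℝ) : ℝ) : ℂ) ≠ 0 := by
    have : (0 : ℝ) < q := by positivity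
    exact_mod_cast (Real.sqrt_pos.2 this).ne'
  have hs2 : ((√(q : ℝ) : ℝ) : ℂ) ^ (2 : ℤ) = q := by
    have : (√(q : ℝ)) ^ 2 = q := Real.sq_sqrt (by positivity)
    exact_mod_cast this
  set s := ((√(q : ℝ) : ℝ) : ℂ) with hsdef
  rw [← Finset.mul_prod_erase Finset.univ _ (Finset.mem_univ i),
    ← Finset.mul_prod_erase Finset.univ (fun j => x j ^ reflectExp Γ i b j) (Finset.mem_univ i)]
  have h1 : ∀ j ∈ Finset.univ.erase i, sigma Γ q i x j ^ b j =
      (if j ∈ Γ.neighborFinset i then (s * x i) ^ b j else 1) * x j ^ reflectExp Γ i b j := by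
    intro j hj
    have hji : j ≠ i := Finset.ne_of_mem_erase hj
    by_cases ha : Γ.Adj i j
    · simp [sigma, reflectExp, hji, ha, mul_zpow, hsdef]
    · simp [sigma, reflectExp, hji, ha]
  rw [Finset.prod_congr rfl h1, Finset.prod_mul_distrib]
  have h2 : ∏ j ∈ Finset.univ.erase i, (if j ∈ Γ.neighborFinset i then (s * x i) ^ b j else 1) =
      (s * x i) ^ nbrSum Γ i b := by
    have hsx : s * x i ≠ 0 := mul_ne_zero hs (hx i)
    have h3 : ∀ t : Finset V, ∏ j ∈ t, (s * x i) ^ b j = (s * x i) ^ ∑ j ∈ t, b j := by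
      intro t
      induction t using Finset.induction_on with
      | empty => simp
      | insert j t hj ih => rw [Finset.prod_insert hj, Finset.sum_insert hj, zpow_add₀ hsx, ih]
    rw [nbrSum, ← h3, ← Finset.prod_filter]
    refine Finset.prod_congr ?_ fun _ _ => rfl
    ext j
    simp only [Finset.mem_filter, Finset.mem_erase, Finset.mem_univ, and_true,
      SimpleGraph.mem_neighborFinset]
    exact ⟨fun h => h.2, fun h => ⟨h.ne', h⟩⟩
  rw [h2]
  have h4 : sigma Γ q i x i = s ^ (-2 : ℤ) * (x i)⁻¹ := by
    simp only [sigma, if_true, zpow_neg, hs2]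
  have h5 : reflectExp Γ i b i = nbrSum Γ i b - b i := by simp [reflectExp]
  rw [h4, h5, mul_zpow, mul_zpow, ← zpow_mul, inv_zpow', sub_eq_add_neg, zpow_add₀ hs,
    sub_eq_add_neg, zpow_add₀ (hx i), neg_mul]
  ring

/-- The formal substitution `S(σ_i(x))`: each monomial `x^a` of `S` is replaced by
`q^{(∑_{j ∼ i} a_j) / 2 - a_i}` times the monomial with exponent `reflectExp Γ i a`. As the
reflection is an involution, the coefficient at `b` comes from `a = reflectExp Γ i b`. -/
def substSigma {V : Type*} [DecidableEq V] [Fintype V] (Γ : SimpleGraph V) [DecidableRel Γ.Adj]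
    (q : ℕ) (i : V) (S : BiSeries V) : BiSeries V :=
  fun b => ((√(q : ℝ) : ℝ) : ℂ) ^ (nbrSum Γ i (reflectExp Γ i b) - 2 * reflectExp Γ i b i) *
    S (reflectExp Γ i b)

/-- The restriction of a coefficient family to the terms with `∑_{j ∼ i} a_j` odd. -/
def oddPart {V : Type*} [Fintype V] (Γ : SimpleGraph V) [DecidableRel Γ.Adj] (i : V)
    (u : (V → ℕ) → ℂ) : (V → ℕ) → ℂ :=
  fun a => if Odd (nbrSum Γ i a) then u a else 0

/-- The restriction of a coefficient family to the terms with `∑_{j ∼ i} a_j` even. -/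
def evenPart {V : Type*} [Fintype V] (Γ : SimpleGraph V) [DecidableRel Γ.Adj] (i : V)
    (u : (V → ℕ) → ℂ) : (V → ℕ) → ℂ :=
  fun a => if Even (nbrSum Γ i a) then u a else 0

/-- The power series `s` is a polynomial `N` of degree at most `A - 1`, and in the variable `x`
with `y = x ^ d` it satisfies `(q^{1/2} x)^{(A - 1) d} s((q⁻¹ x⁻¹)^d) = s(x^d)`. -/
def OddFunctionalEquation (q d A : ℕ) (s : ℂ⟦X⟧) : Prop :=
  ∃ N : ℂ[X], s = (N : ℂ⟦X⟧) ∧ N.natDegree ≤ A - 1 ∧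
    ∀ x : ℂ, x ≠ 0 →
      (((√(q : ℝ) : ℝ) : ℂ) * x) ^ ((A - 1) * d) * N.eval (((q : ℂ)⁻¹ * x⁻¹) ^ d) =
        N.eval (x ^ d)

/-- The value at `y` of the rational function `N(y) / (1 - w y)`, meaningful for `w y ≠ 1`. -/
def fracEval (N : ℂ[X]) (w y : ℂ) : ℂ :=
  N.eval y / (1 - w * y)

/-- The power series `s` is a rational function `r(y) = N(y) / (1 - w y)` with `N` of degree at
most `A`, and in the variable `x` with `y = x ^ d` it satisfies
`(q^{1/2} x)^{A d} (1 - w (q⁻¹ x⁻¹)^d) r((q⁻¹ x⁻¹)^d) = (1 - w x^d) r(x^d)`, away from `x = 0` and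
the zeros of the denominators. -/
def EvenFunctionalEquation (q d A : ℕ) (w : ℂ) (s : ℂ⟦X⟧) : Prop :=
  ∃ N : ℂ[X], (1 - PowerSeries.C w * PowerSeries.X) * s = (N : ℂ⟦X⟧) ∧ N.natDegree ≤ A ∧
    ∀ x : ℂ, x ≠ 0 → w * x ^ d ≠ 1 → w * ((q : ℂ)⁻¹ * x⁻¹) ^ d ≠ 1 →
      (((√(q : ℝ) : ℝ) : ℂ) * x) ^ (A * d) * (1 - w * ((q : ℂ)⁻¹ * x⁻¹) ^ d) *
          fracEval N w (((q : ℂ)⁻¹ * x⁻¹) ^ d) =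
        (1 - w * x ^ d) * fracEval N w (x ^ d)

end WeylMDS

end

/-!
The functional equations are those of quadratic Dirichlet `L`-functions over `F[t]`, carried over to
the weights by twisted multiplicativity.

Fix the polynomials `f_j` at the vertices `j ≠ i`. By `weight_primePart`, the powers of a prime `p`
can be split off from `f` and from the polynomial `g` at `i`. In the sum over `g` this gives the
local series at `p`, with exponents `b`, dilated by `x ↦ ± x^{deg p}`, times the sum for the
`p`-free part of `f`. If `∑_{j ∼ i} b_j` is odd, the latter is twisted by the quadratic character
modulo `p`; if it is even, `p` leaves only the Euler factor `1 - y`, which completes the local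
series (`twistedSeries_primePart`). When all primes of `f` are removed, what is left is the
`L`-function of a squarefree modulus. A product of self-dual series is self-dual, so the sum over
`g` has the functional equation as soon as all the local series have it (`selfDual_twistedSeries`).

The `L`-function of a squarefree modulus has a functional equation without a sign depending on the
modulus (`selfDual_symbolLSeries`), because `q ≡ 1 mod 4`. This rests on `∑_β e(β² / m)`, summed
over residues modulo `m`: polynomials of degree less than `deg m / 2` form an isotropic subspace,
whence the sum is a power of the Gauss sum of `F` (`squareSum_C`, `squareSum_one`). As the square
sum is also multiplicative up to residue symbols (`squareSum_mul`), this gives the values of the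
symbol at constants, quadratic reciprocity and the Gauss sums of the symbol modulo `m`
(`symbolGaussSum_eq`), and then Poisson summation gives the functional equation.

The local functional equations are proved by induction on `∑ b_j` (`localSelfDual`). Among the
tuples of degrees `b` only the `q` tuples of powers of one linear prime involve the exponents `b`
themselves, and they contribute the local series. So the global series minus `q` times the local one
is self-dual by induction. Its coefficients are polynomials in `q`. By dominance, and since global
and local polynomials are reversals of one another, the global part has only large degrees in `q`
and the local part only small ones; the symmetry preserves the ranges, so that both parts have it
(`X_pow_mul_eq_of_separated`). Now all local series are self-dual, and a sum over `f` gives the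
global functional equation (`selfDual_global`).
-/

noncomputable section

namespace WeylMDS

/-! ### Sums over polynomials of bounded degree and the residue at infinity -/

section Finsets

variable (F : Type) [Field F] [Finite F]

theorem finite_degree_lt (n : ℕ) : {f : F[X] | f.degree < n}.Finite := by
  have h : Finite (Polynomial.degreeLT F n) :=
    Finite.of_equiv _ (Polynomial.degreeLTEquiv F n).toEquiv.symm
  exact (Set.toFinite (Polynomial.degreeLT F n : Set F[X])).subset
    fun f hf => Polynomial.mem_degreeLT.2 hf

/-- The finite set of polynomials of degree less than `n`, including `0`. -/
def low (n : ℕ) : Finset F[X] := (finite_degree_lt F n).toFinset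

variable {F} in
@[simp]
theorem mem_low {n : ℕ} {f : F[X]} : f ∈ low F n ↔ f.degree < n := by
  simp [low]

/-- The finite set of monic polynomials of degree `n`. -/
def monics (n : ℕ) : Finset F[X] :=
  Set.Finite.toFinset (s := {f : F[X] | f.Monic ∧ f.natDegree = n})
    ((finite_degree_lt F (n + 1)).subset fun f hf => by
      have : f.degree ≤ n := by rw [← hf.2]; exact Polynomial.degree_le_natDegree
      exact lt_of_le_of_lt this (by exact_mod_cast Nat.lt_succ_self n))

variable {F} in
@[simp]
theorem mem_monics {n : ℕ} {f : F[X]} : f ∈ monics F n ↔ f.Monic ∧ f.natDegree = n := by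
  simp [monics]

theorem card_low (n : ℕ) : (low F n).card = Nat.card F ^ n := by
  have h : (low F n : Set F[X]) = (Polynomial.degreeLT F n : Set F[X]) := by
    ext f; simp [Polynomial.mem_degreeLT]
  rw [← Set.ncard_coe_finset, h]
  have := Nat.card_congr (Polynomial.degreeLTEquiv F n).toEquiv
  rw [Nat.card_fun, Nat.card_fin] at this
  exact this

theorem low_zero : low F 0 = {0} := by
  ext f
  simp [Polynomial.degree_eq_bot]

variable {F}

theorem add_mem_low {n : ℕ} {f g : F[X]} (hf : f ∈ low F n) (hg : g ∈ low F n) :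
    f + g ∈ low F n := by
  rw [mem_low] at *
  exact lt_of_le_of_lt (Polynomial.degree_add_le f g) (max_lt hf hg)

theorem C_mul_mem_low {n : ℕ} {f : F[X]} (c : F) (hf : f ∈ low F n) :
    Polynomial.C c * f ∈ low F n := by
  rw [mem_low] at *
  rw [← Polynomial.smul_eq_C_mul]
  exact lt_of_le_of_lt (Polynomial.degree_smul_le c f) hf

theorem neg_mem_low {n : ℕ} {f : F[X]} (hf : f ∈ low F n) : -f ∈ low F n := by
  rw [mem_low] at *
  rwa [Polynomial.degree_neg]

theorem low_mono {m n : ℕ} (h : m ≤ n) : low F m ⊆ low F n := by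
  intro f hf
  rw [mem_low] at *
  exact lt_of_lt_of_le hf (by exact_mod_cast h)

theorem coeff_eq_zero_of_mem_low {n k : ℕ} {f : F[X]} (hf : f ∈ low F n) (h : n ≤ k) :
    f.coeff k = 0 :=
  Polynomial.coeff_eq_zero_of_degree_lt
    (lt_of_lt_of_le (mem_low.1 hf) (by exact_mod_cast h))

theorem natDegree_lt_of_mem_low {n : ℕ} {f : F[X]} (hf : f ∈ low F n) (h0 : f ≠ 0) :
    f.natDegree < n :=
  (Polynomial.natDegree_lt_iff_degree_lt h0).2 (mem_low.1 hf)

theorem mem_low_of_natDegree_lt {n : ℕ} {f : F[X]} (hf : f.natDegree < n) : f ∈ low F n :=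
  mem_low.2 (lt_of_le_of_lt Polynomial.degree_le_natDegree (by exact_mod_cast hf))

/-- A translate of a sum over polynomials of degree less than `n`. -/
theorem sum_low_add {M : Type*} [AddCommMonoid M] {n : ℕ} {w : F[X]} (hw : w ∈ low F n)
    (G : F[X] → M) : ∑ u ∈ low F n, G (u + w) = ∑ u ∈ low F n, G u := by
  refine Finset.sum_nbij' (fun u => u + w) (fun u => u + -w) ?_ ?_ ?_ ?_ ?_
  · intro u hu; exact add_mem_low hu hw
  · intro u hu; exact add_mem_low hu (neg_mem_low hw)
  · intro u _; simp
  · intro u _; simp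
  · intro u _; rfl

theorem sum_monics {M : Type*} [AddCommMonoid M] (n : ℕ) (G : F[X] → M) :
    ∑ f ∈ monics F n, G f = ∑ u ∈ low F n, G (Polynomial.X ^ n + u) := by
  refine Finset.sum_nbij' (fun f => f - Polynomial.X ^ n) (fun u => Polynomial.X ^ n + u)
    ?_ ?_ ?_ ?_ ?_
  · intro f hf
    obtain ⟨hm, hd⟩ := mem_monics.1 hf
    rw [mem_low]
    have hdeg : f.degree = n := by rw [Polynomial.degree_eq_natDegree hm.ne_zero, hd]
    have := Polynomial.degree_sub_lt_left (p := f) (q := Polynomial.X ^ n)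
      (by rw [hdeg, Polynomial.degree_X_pow]) hm.ne_zero
      (by rw [hm.leadingCoeff, (Polynomial.monic_X_pow n).leadingCoeff])
    rwa [hdeg] at this
  · intro u hu
    exact mem_monics.2 ⟨Polynomial.monic_X_pow_add (mem_low.1 hu),
      Polynomial.natDegree_eq_of_degree_eq_some (by
        rw [Polynomial.degree_add_eq_left_of_degree_lt] <;> rw [Polynomial.degree_X_pow]
        exact mem_low.1 hu)⟩
  · intro f _; simp
  · intro u _; simp
  · intro f _; simp

theorem card_monics (n : ℕ) : (monics F n).card = Nat.card F ^ n := by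
  rw [← card_low, Finset.card_eq_sum_ones, sum_monics, ← Finset.card_eq_sum_ones]

theorem monics_zero : monics F 0 = {1} := by
  ext f
  simp only [mem_monics, Finset.mem_singleton]
  exact ⟨fun h => h.1.natDegree_eq_zero.1 h.2, by rintro rfl; simp⟩

theorem sum_low_succ_eq_sum_coeff {M : Type*} [AddCommMonoid M] [Fintype F] (n : ℕ)
    (G : F[X] → M) :
    ∑ a ∈ low F (n + 1), G a =
      ∑ c : F, ∑ u ∈ low F n, G (Polynomial.C c * (Polynomial.X ^ n) + u) := by
  rw [← Finset.sum_product']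
  refine Finset.sum_nbij' (fun a => (a.coeff n, a - Polynomial.C (a.coeff n) * Polynomial.X ^ n))
    (fun x => Polynomial.C x.1 * (Polynomial.X ^ n) + x.2) ?_ ?_ ?_ ?_ ?_
  · intro a ha
    simp only [Finset.mem_product, Finset.mem_univ, true_and, mem_low]
    rw [Polynomial.degree_lt_iff_coeff_zero]
    intro k hk
    rcases hk.eq_or_lt with rfl | hk
    · simp
    · rw [Polynomial.coeff_sub, coeff_eq_zero_of_mem_low ha hk,
        Polynomial.coeff_C_mul_X_pow, if_neg hk.ne', sub_zero]
  · rintro ⟨c, u⟩ hu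
    simp only [Finset.mem_product, Finset.mem_univ, true_and] at hu
    refine add_mem_low (C_mul_mem_low c ?_) (low_mono (Nat.le_succ n) hu)
    exact mem_low_of_natDegree_lt (by simp)
  · intro a _; simp
  · rintro ⟨c, u⟩ hu
    simp only [Finset.mem_product, Finset.mem_univ, true_and] at hu
    simp [coeff_eq_zero_of_mem_low hu le_rfl]
  · intro a _; simp

/-- Polynomials of degree less than `n + 1`, sorted by their coefficient at `n`. -/
theorem sum_low_succ {M : Type*} [AddCommMonoid M] [Fintype F] [DecidableEq F] (n : ℕ)
    (G : F[X] → M) :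
    ∑ a ∈ low F (n + 1), G a =
      ∑ a ∈ low F n, G a +
        ∑ c ∈ Finset.univ.erase (0 : F), ∑ f ∈ monics F n, G (Polynomial.C c * f) := by
  rw [sum_low_succ_eq_sum_coeff, ← Finset.add_sum_erase _ _ (Finset.mem_univ (0 : F))]
  congr 1
  · simp
  · refine Finset.sum_congr rfl fun c hc => ?_
    have hc0 : c ≠ 0 := Finset.ne_of_mem_erase hc
    rw [sum_monics]
    refine Finset.sum_nbij' (fun u => Polynomial.C c⁻¹ * u) (fun u => Polynomial.C c * u)
      ?_ ?_ ?_ ?_ ?_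
    · intro u hu; exact C_mul_mem_low _ hu
    · intro u hu; exact C_mul_mem_low _ hu
    · intro u _; rw [← mul_assoc, ← Polynomial.C_mul, mul_inv_cancel₀ hc0]; simp
    · intro u _; rw [← mul_assoc, ← Polynomial.C_mul, inv_mul_cancel₀ hc0]; simp
    · intro u _
      rw [mul_add, ← mul_assoc, ← Polynomial.C_mul, mul_inv_cancel₀ hc0]; simp

end Finsets

section Functional

variable {F : Type} [Field F]

/-- The linear functional on `F[t]` which sends `a` to the coefficient of `t⁻¹` in the expansion
of `a / m` at infinity, for monic `m`. -/
def residueAtInfinity (m : F[X]) : F[X] →ₗ[F] F :=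
  (Polynomial.lcoeff F (m.natDegree - 1)).comp (Polynomial.modByMonicHom m)

theorem residueAtInfinity_apply (m a : F[X]) :
    residueAtInfinity m a = (a %ₘ m).coeff (m.natDegree - 1) := rfl

theorem residueAtInfinity_of_degree_lt {m a : F[X]} (hm : m.Monic) (ha : a.degree < m.natDegree) :
    residueAtInfinity m a = a.coeff (m.natDegree - 1) := by
  rw [residueAtInfinity_apply, (Polynomial.modByMonic_eq_self_iff hm).2]
  rwa [Polynomial.degree_eq_natDegree hm.ne_zero]

theorem residueAtInfinity_eq_zero_of_dvd {m a : F[X]} (hm : m.Monic) (h : m ∣ a) :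
    residueAtInfinity m a = 0 := by
  rw [residueAtInfinity_apply, (Polynomial.modByMonic_eq_zero_iff_dvd hm).2 h,
    Polynomial.coeff_zero]

theorem residueAtInfinity_congr {m a b : F[X]} (hm : m.Monic) (h : m ∣ a - b) :
    residueAtInfinity m a = residueAtInfinity m b := by
  rw [← sub_eq_zero, ← map_sub, residueAtInfinity_eq_zero_of_dvd hm h]

theorem residueAtInfinity_mul_left {m m' : F[X]} (hm : m.Monic) (hm' : m'.Monic) (a : F[X]) :
    residueAtInfinity (m * m') (m' * a) = residueAtInfinity m a := by
  have h1 : (m' * a) %ₘ (m * m') = m' * (a %ₘ m) := by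
    rw [mul_comm m m']
    have := Polynomial.div_modByMonic_unique (f := m' * a) (g := m' * m) (a /ₘ m) (m' * (a %ₘ m))
      (hm'.mul hm) ⟨?_, ?_⟩
    · exact this.2
    · conv_rhs => rw [← Polynomial.modByMonic_add_div a m]
      ring
    · rw [Polynomial.degree_mul, Polynomial.degree_mul]
      exact WithBot.add_lt_add_left (by simpa using hm'.ne_zero)
        (Polynomial.degree_modByMonic_lt a hm)
  rw [residueAtInfinity_apply, residueAtInfinity_apply, h1, hm.natDegree_mul hm']
  rcases Nat.eq_zero_or_pos m.natDegree with h0 | h0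
  · have : m = 1 := hm.natDegree_eq_zero.1 h0
    subst this
    simp
  · have h2 : m.natDegree + m'.natDegree - 1 = m'.natDegree + (m.natDegree - 1) := by omega
    rw [h2, Polynomial.coeff_mul_add_eq_of_natDegree_le le_rfl, hm'.coeff_natDegree, one_mul]
    have := Polynomial.natDegree_modByMonic_lt a hm (by rintro rfl; simp at h0)
    omega

/-- The pairing `(a, u) ↦ residueAtInfinity m (a * u)` on residues modulo `m`: the polynomials
orthogonal to those of degree less than `n` are those of degree less than `deg m - n`. -/
theorem residueAtInfinity_mul_eq_zero_iff [Finite F] {m a : F[X]} (hm : m.Monic)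
    (ha : a ∈ low F m.natDegree) (n : ℕ) :
    (∀ u ∈ low F n, residueAtInfinity m (a * u) = 0) ↔ a ∈ low F (m.natDegree - n) := by
  constructor
  · intro h
    by_cases h0 : a = 0
    · simp [h0]
    by_contra hlow
    have h1 : m.natDegree - n ≤ a.natDegree := by
      by_contra! h2
      exact hlow (mem_low_of_natDegree_lt h2)
    have h3 := natDegree_lt_of_mem_low ha h0
    have h4 := h (Polynomial.X ^ (m.natDegree - 1 - a.natDegree))
      (mem_low_of_natDegree_lt (by rw [Polynomial.natDegree_X_pow]; omega))
    rw [residueAtInfinity_of_degree_lt hm] at h4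
    · have h5 : m.natDegree - 1 = a.natDegree + (m.natDegree - 1 - a.natDegree) := by omega
      nth_rewrite 2 [h5] at h4
      rw [Polynomial.coeff_mul_X_pow, Polynomial.coeff_natDegree] at h4
      exact h0 (Polynomial.leadingCoeff_eq_zero.1 h4)
    · refine mem_low.1 (mem_low_of_natDegree_lt ?_)
      rw [Polynomial.natDegree_mul_X_pow _ h0]
      omega
  · intro h u hu
    by_cases h0 : a * u = 0
    · simp [h0]
    have ha0 := left_ne_zero_of_mul h0
    have hu0 := right_ne_zero_of_mul h0
    have h1 := natDegree_lt_of_mem_low h ha0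
    have h2 := natDegree_lt_of_mem_low hu hu0
    have h3 : (a * u).natDegree < m.natDegree - 1 := by
      rw [Polynomial.natDegree_mul ha0 hu0]; omega
    rw [residueAtInfinity_of_degree_lt hm, Polynomial.coeff_eq_zero_of_natDegree_lt h3]
    exact mem_low.1 (mem_low_of_natDegree_lt (by omega))

end Functional

section Orthogonality

variable {F : Type} [Field F] [Finite F] {ψ : AddChar F ℂ}

theorem sum_low_addChar (hψ : ψ ≠ 1) (l : F[X] →ₗ[F] F) (n : ℕ)
    [Decidable (∀ u ∈ low F n, l u = 0)] :
    ∑ u ∈ low F n, ψ (l u) = if ∀ u ∈ low F n, l u = 0 then (Nat.card F : ℂ) ^ n else 0 := by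
  split_ifs with h
  · rw [Finset.sum_congr rfl fun u hu => by rw [h u hu, AddChar.map_zero_eq_one]]
    simp [card_low]
  · push Not at h
    obtain ⟨u, hu, hne⟩ := h
    obtain ⟨x, hx⟩ := AddChar.ne_one_iff.1 hψ
    set w := Polynomial.C (x * (l u)⁻¹) * u with hwdef
    have hw : w ∈ low F n := C_mul_mem_low _ hu
    have hlw : l w = x := by
      rw [hwdef, ← Polynomial.smul_eq_C_mul, map_smul, smul_eq_mul, mul_assoc,
        inv_mul_cancel₀ hne, mul_one]
    have h1 := sum_low_add hw (fun u => ψ (l u))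
    simp only [map_add, AddChar.map_add_eq_mul, hlw, ← Finset.sum_mul] at h1
    have h2 : (∑ u ∈ low F n, ψ (l u)) * (ψ x - 1) = 0 := by rw [mul_sub, h1]; ring
    exact (mul_eq_zero.1 h2).resolve_right (sub_ne_zero.2 hx)

open Classical in
theorem sum_low_addChar_residue (hψ : ψ ≠ 1) {m a : F[X]} (hm : m.Monic)
    (ha : a ∈ low F m.natDegree) (n : ℕ) :
    ∑ u ∈ low F n, ψ (residueAtInfinity m (a * u)) =
      if a ∈ low F (m.natDegree - n) then (Nat.card F : ℂ) ^ n else 0 := by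
  have := sum_low_addChar hψ ((residueAtInfinity m).comp (LinearMap.mulLeft F a)) n
  simp only [LinearMap.comp_apply, LinearMap.mulLeft_apply] at this
  rw [this]
  exact if_congr (residueAtInfinity_mul_eq_zero_iff hm ha n) rfl rfl

end Orthogonality

/-! ### The quadratic residue symbol and sums over residues -/

section Symbols

variable {F : Type} [Field F]

theorem monic_induction {Q : (m : F[X]) → m.Monic → Prop} (h1 : Q 1 Polynomial.monic_one)
    (hmul : ∀ (p m : F[X]) (hpm : p.Monic) (_ : Irreducible p) (hm : m.Monic),
      Q m hm → Q (p * m) (hpm.mul hm)) (m : F[X]) (hm : m.Monic) : Q m hm := by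
  induction hn : m.natDegree using Nat.strong_induction_on generalizing m with
  | _ n ih =>
    by_cases hm1 : m = 1
    · subst hm1
      exact h1
    obtain ⟨p, hpm, hp, m', rfl⟩ := Polynomial.exists_monic_irreducible_factor m
      (fun hu => hm1 (hm.eq_one_of_isUnit hu))
    have hm' : m'.Monic := hpm.of_mul_monic_left hm
    refine hmul p m' hpm hp hm' (ih m'.natDegree ?_ m' hm' rfl)
    rw [← hn, hpm.natDegree_mul hm']
    have := hp.natDegree_pos
    omega

theorem quadChar_congr {p a b : F[X]} (h : p ∣ a - b) : quadChar p a = quadChar p b := by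
  have h1 : p ∣ a ↔ p ∣ b := by
    rw [← dvd_iff_dvd_of_dvd_sub h]
  have h2 : (∃ x, p ∣ a - x ^ 2) ↔ ∃ x, p ∣ b - x ^ 2 := by
    refine exists_congr fun x => dvd_iff_dvd_of_dvd_sub ?_
    convert h using 1
    ring
  classical
  unfold quadChar
  exact if_congr h1 rfl (if_congr h2 rfl rfl)

theorem quadChar_eq_zero_iff {p a : F[X]} : quadChar p a = 0 ↔ p ∣ a := by
  unfold quadChar
  split_ifs <;> simp_all

theorem quadChar_sq_eq_one {p a : F[X]} (h : ¬ p ∣ a) : quadChar p a ^ 2 = 1 := by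
  unfold quadChar
  split_ifs <;> simp

theorem quadChar_pow_two {p : F[X]} (hp : Irreducible p) {a : F[X]} (h : ¬ p ∣ a) :
    quadChar p (a ^ 2) = 1 := by
  unfold quadChar
  rw [if_neg (fun h2 => h (hp.prime.dvd_of_dvd_pow h2)), if_pos ⟨a, by simp⟩]

theorem quadChar_one {p : F[X]} (hp : Irreducible p) : quadChar p 1 = 1 := by
  have := quadChar_pow_two hp (a := 1) (fun h => hp.not_isUnit (isUnit_of_dvd_one h))
  simpa using this

theorem finite_adjoinRoot [Finite F] {p : F[X]} (hp : p.Monic) : Finite (AdjoinRoot p) := by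
  have := hp.finite_adjoinRoot
  exact Module.finite_of_finite F

/-- The quadratic character modulo a prime is that of the residue field. -/
theorem quadChar_eq_quadraticChar {p : F[X]} [Fact (Irreducible p)] [Fintype (AdjoinRoot p)]
    [DecidableEq (AdjoinRoot p)] (a : F[X]) :
    quadChar p a = quadraticChar (AdjoinRoot p) (AdjoinRoot.mk p a) := by
  classical
  rw [quadraticChar_apply, quadraticCharFun, quadChar]
  refine if_congr AdjoinRoot.mk_eq_zero.symm rfl (if_congr ?_ rfl rfl)
  constructor
  · rintro ⟨x, hx⟩
    refine ⟨AdjoinRoot.mk p x, ?_⟩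
    rw [← map_mul, AdjoinRoot.mk_eq_mk, ← pow_two]
    exact hx
  · rintro ⟨y, hy⟩
    obtain ⟨x, rfl⟩ := AdjoinRoot.mk_surjective y
    rw [← map_mul, AdjoinRoot.mk_eq_mk, ← pow_two] at hy
    exact ⟨x, hy⟩

theorem quadChar_mul [Finite F] {p : F[X]} (hpm : p.Monic) (hp : Irreducible p) (a b : F[X]) :
    quadChar p (a * b) = quadChar p a * quadChar p b := by
  classical
  have := finite_adjoinRoot hpm
  have := Fintype.ofFinite (AdjoinRoot p)
  have := Fact.mk hp
  simp only [quadChar_eq_quadraticChar, map_mul]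

theorem residueSymbol_one_left (a : F[X]) : residueSymbol 1 a = 1 := by
  simp [residueSymbol]

theorem residueSymbol_mul_left {m n : F[X]} (hm : m ≠ 0) (hn : n ≠ 0) (a : F[X]) :
    residueSymbol (m * n) a = residueSymbol m a * residueSymbol n a := by
  classical
  simp [residueSymbol, UniqueFactorizationMonoid.normalizedFactors_mul hm hn]

theorem residueSymbol_prime {p : F[X]} (hpm : p.Monic) (hp : Irreducible p) (a : F[X]) :
    residueSymbol p a = quadChar p a := by
  classical
  rw [residueSymbol, UniqueFactorizationMonoid.normalizedFactors_irreducible hp,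
    hpm.normalize_eq_self]
  simp

theorem residueSymbol_pow_left (m : F[X]) (n : ℕ) (a : F[X]) :
    residueSymbol (m ^ n) a = residueSymbol m a ^ n := by
  classical
  simp [residueSymbol, UniqueFactorizationMonoid.normalizedFactors_pow,
    Multiset.map_nsmul, Multiset.prod_nsmul]

theorem residueSymbol_congr {m a b : F[X]} (hm : m.Monic) (h : m ∣ a - b) :
    residueSymbol m a = residueSymbol m b := by
  revert h
  induction m, hm using monic_induction with
  | h1 => intro _; rw [residueSymbol_one_left, residueSymbol_one_left]
  | hmul p m hpm hp hm ih =>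
    intro h
    rw [residueSymbol_mul_left hpm.ne_zero hm.ne_zero,
      residueSymbol_mul_left hpm.ne_zero hm.ne_zero, ih (dvd_of_mul_left_dvd h),
      residueSymbol_prime hpm hp, residueSymbol_prime hpm hp,
      quadChar_congr (dvd_of_mul_right_dvd h)]

theorem residueSymbol_one_right {m : F[X]} (hm : m.Monic) : residueSymbol m 1 = 1 := by
  induction m, hm using monic_induction with
  | h1 => rw [residueSymbol_one_left]
  | hmul p m hpm hp hm ih =>
    rw [residueSymbol_mul_left hpm.ne_zero hm.ne_zero, ih, residueSymbol_prime hpm hp,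
      quadChar_one hp, mul_one]

theorem residueSymbol_mul_right [Finite F] {m : F[X]} (hm : m.Monic) (a b : F[X]) :
    residueSymbol m (a * b) = residueSymbol m a * residueSymbol m b := by
  induction m, hm using monic_induction with
  | h1 => simp [residueSymbol_one_left]
  | hmul p m hpm hp hm ih =>
    simp only [residueSymbol_mul_left hpm.ne_zero hm.ne_zero, ih, residueSymbol_prime hpm hp,
      quadChar_mul hpm hp]
    ring

theorem residueSymbol_pow_right [Finite F] {m : F[X]} (hm : m.Monic) (a : F[X]) (n : ℕ) :
    residueSymbol m (a ^ n) = residueSymbol m a ^ n := by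
  induction n with
  | zero => simp [residueSymbol_one_right hm]
  | succ n ih => rw [pow_succ, residueSymbol_mul_right hm, ih, pow_succ]

theorem residueSymbol_sq_eq_one {m a : F[X]} (hm : m.Monic) (h : IsCoprime m a) :
    residueSymbol m a ^ 2 = 1 := by
  revert h
  induction m, hm using monic_induction with
  | h1 => simp [residueSymbol_one_left]
  | hmul p m hpm hp hm ih =>
    intro h
    rw [residueSymbol_mul_left hpm.ne_zero hm.ne_zero, mul_pow, ih h.of_mul_left_right,
      residueSymbol_prime hpm hp,
      quadChar_sq_eq_one (fun hd => hp.not_isUnit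
        (h.of_mul_left_left.isUnit_of_dvd' dvd_rfl hd)), mul_one]

theorem residueSymbol_eq_zero {p m a : F[X]} (hpm : p.Monic) (hp : Irreducible p) (hm : m.Monic)
    (hpm' : p ∣ m) (ha : p ∣ a) : residueSymbol m a = 0 := by
  obtain ⟨n, rfl⟩ := hpm'
  rw [residueSymbol_mul_left hpm.ne_zero (hpm.of_mul_monic_left hm).ne_zero,
    residueSymbol_prime hpm hp, quadChar_eq_zero_iff.2 ha, zero_mul]

theorem not_X_dvd_C {c : F} (hc : c ≠ 0) : ¬ (Polynomial.X : F[X]) ∣ Polynomial.C c := by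
  rw [Polynomial.X_dvd_iff, Polynomial.coeff_C_zero]
  exact hc

theorem quadChar_X_C_sq {c : F} (hc : c ≠ 0) :
    quadChar Polynomial.X (Polynomial.C c) ^ 2 = 1 :=
  quadChar_sq_eq_one (not_X_dvd_C hc)

theorem residueSymbol_zero_right {m : F[X]} (hm : m.Monic) (hm1 : 0 < m.natDegree) :
    residueSymbol m 0 = 0 := by
  obtain ⟨p, hpm, hp, hd⟩ := Polynomial.exists_monic_irreducible_factor m
    (fun hu => by rw [Polynomial.natDegree_eq_zero_of_isUnit hu] at hm1; omega)
  exact residueSymbol_eq_zero hpm hp hm hd (dvd_zero p)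

end Symbols

section SumResidues

variable {F : Type} [Field F] [Finite F]

theorem sum_low_adjoinRoot {M : Type*} [AddCommMonoid M] {m : F[X]} (hm : m.Monic)
    [Fintype (AdjoinRoot m)] (G : AdjoinRoot m → M) :
    ∑ a ∈ low F m.natDegree, G (AdjoinRoot.mk m a) = ∑ x, G x := by
  refine Finset.sum_bij (fun a _ => AdjoinRoot.mk m a) (fun _ _ => Finset.mem_univ _) ?_ ?_
    fun _ _ => rfl
  · intro a ha b hb hab
    rw [AdjoinRoot.mk_eq_mk] at hab
    have h1 : a + -b ∈ low F m.natDegree := add_mem_low ha (neg_mem_low hb)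
    rw [← sub_eq_add_neg, mem_low, ← Polynomial.degree_eq_natDegree hm.ne_zero] at h1
    exact sub_eq_zero.1 (Polynomial.eq_zero_of_dvd_of_degree_lt hab h1)
  · intro x _
    obtain ⟨a, rfl⟩ := AdjoinRoot.mk_surjective x
    refine ⟨a %ₘ m, ?_, ?_⟩
    · rw [mem_low, ← Polynomial.degree_eq_natDegree hm.ne_zero]
      exact Polynomial.degree_modByMonic_lt a hm
    · rw [AdjoinRoot.mk_eq_mk]
      refine ⟨-(a /ₘ m), ?_⟩
      nth_rewrite 2 [← Polynomial.modByMonic_add_div a m]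
      ring

/-- The Chinese remainder theorem, for representatives of minimal degree. -/
theorem sum_low_mul {M : Type*} [AddCommMonoid M] {m n : F[X]} (hm : m.Monic) (hn : n.Monic)
    (h : IsCoprime m n) (G : F[X] → M) :
    ∑ a ∈ low F (m * n).natDegree, G a =
      ∑ a ∈ low F m.natDegree, ∑ b ∈ low F n.natDegree, G (n * a + m * b) := by
  rw [← Finset.sum_product', hm.natDegree_mul hn]
  have hmap : ∀ x ∈ low F m.natDegree ×ˢ low F n.natDegree,
      n * x.1 + m * x.2 ∈ low F (m.natDegree + n.natDegree) := by
    rintro ⟨a, b⟩ hx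
    obtain ⟨ha, hb⟩ := Finset.mem_product.1 hx
    refine add_mem_low ?_ ?_
    · rw [mem_low, Polynomial.degree_mul, Polynomial.degree_eq_natDegree hn.ne_zero, add_comm,
        Nat.cast_add]
      exact WithBot.add_lt_add_right (by simp) (mem_low.1 ha)
    · rw [mem_low, Polynomial.degree_mul, Polynomial.degree_eq_natDegree hm.ne_zero,
        Nat.cast_add]
      exact WithBot.add_lt_add_left (by simp) (mem_low.1 hb)
  have hinj : Set.InjOn (fun x : F[X] × F[X] => n * x.1 + m * x.2)
      (low F m.natDegree ×ˢ low F n.natDegree : Finset (F[X] × F[X])) := by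
    rintro ⟨a, b⟩ hx ⟨a', b'⟩ hx' hxx
    obtain ⟨ha, hb⟩ := Finset.mem_product.1 (Finset.mem_coe.1 hx)
    obtain ⟨ha', hb'⟩ := Finset.mem_product.1 (Finset.mem_coe.1 hx')
    simp only at hxx ha hb ha' hb'
    have h1 : n * (a - a') = m * (b' - b) := by linear_combination hxx
    have h2 : a - a' = 0 := by
      refine Polynomial.eq_zero_of_dvd_of_degree_lt (p := m) (h.dvd_of_dvd_mul_left ⟨_, h1⟩) ?_
      rw [Polynomial.degree_eq_natDegree hm.ne_zero, sub_eq_add_neg]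
      exact mem_low.1 (add_mem_low ha (neg_mem_low ha'))
    rw [h2, mul_zero, eq_comm, mul_eq_zero, or_iff_right hm.ne_zero] at h1
    rw [sub_eq_zero.1 h2, sub_eq_zero.1 h1]
  symm
  refine Finset.sum_nbij (fun x => n * x.1 + m * x.2) hmap hinj ?_ fun _ _ => rfl
  refine Finset.surjOn_of_injOn_of_card_le _ hmap hinj ?_
  rw [Finset.card_product, card_low, card_low, card_low, pow_add]

end SumResidues

/-! ### Square sums and Gauss sums -/

section GaussSums

variable {F : Type} [Field F] [Fintype F] {ψ : AddChar F ℂ}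

theorem two_ne_zero_of_card (hq : Nat.card F % 4 = 1) : (2 : F) ≠ 0 := by
  refine Ring.two_ne_zero fun h => ?_
  have := FiniteField.even_card_of_char_two h
  rw [← Nat.card_eq_fintype_card] at this
  omega

theorem ringChar_adjoinRoot_ne_two (hq : Nat.card F % 4 = 1) {p : F[X]} [Fact (Irreducible p)] :
    ringChar (AdjoinRoot p) ≠ 2 := by
  intro h
  have h2 : (2 : AdjoinRoot p) = 0 := by
    have := ringChar.Nat.cast_ringChar (R := AdjoinRoot p)
    rw [h] at this
    exact_mod_cast this
  have h3 : AdjoinRoot.of p 2 = 0 := by rw [map_ofNat, h2]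
  exact two_ne_zero_of_card hq ((map_eq_zero _).1 h3)

variable (ψ) in
/-- The quadratic Gauss sum of `F` attached to the additive character `ψ`. -/
def quadGauss : ℂ := ∑ x : F, ψ (x ^ 2)

variable (ψ) in
/-- The sum of `e(c β² / m)` over residues `β` modulo `m`, where `e` is the additive character
`ψ` of the coefficient of `t⁻¹`. -/
def squareSum (m c : F[X]) : ℂ :=
  ∑ b ∈ low F m.natDegree, ψ (residueAtInfinity m (c * b ^ 2))

variable (ψ) in
/-- The Gauss sum of the residue symbol modulo `m`, evaluated at `f`. -/
def symbolGaussSum (m f : F[X]) : ℂ :=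
  ∑ a ∈ low F m.natDegree, (residueSymbol m a : ℂ) * ψ (residueAtInfinity m (f * a))

/-- For constant `c ≠ 0` the quadratic form `c β²` has a large isotropic subspace, the polynomials
of degree less than `deg m / 2`; averaging over its translates leaves the orthogonal complement. -/
theorem squareSum_C (hψ : ψ ≠ 1) (hq : Nat.card F % 4 = 1) {m : F[X]} (hm : m.Monic) {c : F}
    (hc : c ≠ 0) {h : ℕ} (hh : 2 * h ≤ m.natDegree) :
    squareSum ψ m (Polynomial.C c) = ∑ b ∈ low F (m.natDegree - h),
      ψ (residueAtInfinity m (Polynomial.C c * b ^ 2)) := by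
  classical
  have hq0 : ((Nat.card F : ℂ) ^ h) ≠ 0 := by
    have : Nat.card F ≠ 0 := by omega
    positivity
  have h2 := two_ne_zero_of_card hq
  have key : (Nat.card F : ℂ) ^ h * squareSum ψ m (Polynomial.C c) =
      (Nat.card F : ℂ) ^ h * ∑ b ∈ low F (m.natDegree - h),
        ψ (residueAtInfinity m (Polynomial.C c * b ^ 2)) := by
    calc (Nat.card F : ℂ) ^ h * squareSum ψ m (Polynomial.C c)
        = ∑ w ∈ low F h, ∑ b ∈ low F m.natDegree,
            ψ (residueAtInfinity m (Polynomial.C c * (b + w) ^ 2)) := by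
          have h1 : ∀ w ∈ low F h, ∑ b ∈ low F m.natDegree,
              ψ (residueAtInfinity m (Polynomial.C c * (b + w) ^ 2)) =
                squareSum ψ m (Polynomial.C c) := fun w hw =>
            sum_low_add (low_mono (by omega) hw)
              fun b => ψ (residueAtInfinity m (Polynomial.C c * b ^ 2))
          rw [Finset.sum_congr rfl h1, Finset.sum_const, card_low, nsmul_eq_mul, Nat.cast_pow]
      _ = ∑ b ∈ low F m.natDegree, ψ (residueAtInfinity m (Polynomial.C c * b ^ 2)) *
            ∑ w ∈ low F h, ψ (residueAtInfinity m (Polynomial.C (2 * c) * b * w)) := by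
          rw [Finset.sum_comm]
          refine Finset.sum_congr rfl fun b _ => ?_
          rw [Finset.mul_sum]
          refine Finset.sum_congr rfl fun w hw => ?_
          have h1 : residueAtInfinity m (Polynomial.C c * w ^ 2) = 0 := by
            by_cases hw0 : w = 0
            · simp [hw0]
            have hwd := natDegree_lt_of_mem_low hw hw0
            have hlt : (Polynomial.C c * w ^ 2).natDegree < m.natDegree - 1 := by
              refine lt_of_le_of_lt (Polynomial.natDegree_C_mul_le _ _) ?_
              rw [Polynomial.natDegree_pow]
              omega
            rw [residueAtInfinity_of_degree_lt hm, Polynomial.coeff_eq_zero_of_natDegree_lt hlt]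
            exact mem_low.1 (mem_low_of_natDegree_lt (by omega))
          have h3 : Polynomial.C c * (b + w) ^ 2 = Polynomial.C c * b ^ 2 +
              Polynomial.C (2 * c) * b * w + Polynomial.C c * w ^ 2 := by
            rw [Polynomial.C_mul, show (Polynomial.C (2 : F)) = 2 from rfl]
            ring
          rw [h3, map_add (residueAtInfinity m), map_add (residueAtInfinity m), h1, add_zero,
            AddChar.map_add_eq_mul]
      _ = _ := by
          rw [Finset.mul_sum]
          have h3 : ∀ b ∈ low F m.natDegree, ψ (residueAtInfinity m (Polynomial.C c * b ^ 2)) *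
              ∑ w ∈ low F h, ψ (residueAtInfinity m (Polynomial.C (2 * c) * b * w)) =
              if b ∈ low F (m.natDegree - h) then (Nat.card F : ℂ) ^ h *
                ψ (residueAtInfinity m (Polynomial.C c * b ^ 2)) else 0 := by
            intro b hb
            rw [sum_low_addChar_residue hψ hm (C_mul_mem_low _ hb)]
            have : Polynomial.C (2 * c) * b ∈ low F (m.natDegree - h) ↔
                b ∈ low F (m.natDegree - h) := by
              refine ⟨fun hb => ?_, fun hb => C_mul_mem_low _ hb⟩
              have := C_mul_mem_low (2 * c)⁻¹ hb
              rwa [← mul_assoc, ← Polynomial.C_mul, inv_mul_cancel₀ (mul_ne_zero h2 hc),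
                Polynomial.C_1, one_mul] at this
            rw [if_congr this rfl rfl, mul_ite, mul_zero, mul_comm (ψ _)]
          rw [Finset.sum_congr rfl h3, ← Finset.sum_filter]
          refine Finset.sum_congr ?_ fun _ _ => rfl
          rw [Finset.filter_mem_eq_inter, Finset.inter_eq_right]
          exact low_mono (by omega)
  exact mul_left_cancel₀ hq0 key

theorem squareSum_C_even (hψ : ψ ≠ 1) (hq : Nat.card F % 4 = 1) {m : F[X]} (hm : m.Monic) {c : F}
    (hc : c ≠ 0) {h : ℕ} (hh : m.natDegree = 2 * h) :
    squareSum ψ m (Polynomial.C c) = (Nat.card F : ℂ) ^ h := by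
  rw [squareSum_C hψ hq hm hc hh.ge, hh, two_mul, Nat.add_sub_cancel]
  have h1 : ∀ b ∈ low F h, ψ (residueAtInfinity m (Polynomial.C c * b ^ 2)) = 1 := by
    intro b hb
    by_cases hb0 : b = 0
    · simp [hb0]
    have hbd := natDegree_lt_of_mem_low hb hb0
    have hlt : (Polynomial.C c * b ^ 2).natDegree < m.natDegree - 1 := by
      refine lt_of_le_of_lt (Polynomial.natDegree_C_mul_le _ _) ?_
      rw [Polynomial.natDegree_pow]
      omega
    rw [residueAtInfinity_of_degree_lt hm, Polynomial.coeff_eq_zero_of_natDegree_lt hlt,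
      AddChar.map_zero_eq_one]
    exact mem_low.1 (mem_low_of_natDegree_lt (by omega))
  rw [Finset.sum_congr rfl h1]
  simp [card_low]

theorem squareSum_C_odd (hψ : ψ ≠ 1) (hq : Nat.card F % 4 = 1) {m : F[X]} (hm : m.Monic) {c : F}
    (hc : c ≠ 0) {h : ℕ} (hh : m.natDegree = 2 * h + 1) :
    squareSum ψ m (Polynomial.C c) = (Nat.card F : ℂ) ^ h * ∑ x : F, ψ (c * x ^ 2) := by
  rw [squareSum_C hψ hq hm hc (h := h) (by omega),
    show m.natDegree - h = h + 1 by omega, sum_low_succ_eq_sum_coeff, Finset.mul_sum]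
  refine Finset.sum_congr rfl fun x _ => ?_
  have h1 : ∀ u ∈ low F h, ψ (residueAtInfinity m
      (Polynomial.C c * (Polynomial.C x * Polynomial.X ^ h + u) ^ 2)) = ψ (c * x ^ 2) := by
    intro u hu
    set b := Polynomial.C x * Polynomial.X ^ h + u with hb
    have hbl : b ∈ low F (h + 1) :=
      add_mem_low (C_mul_mem_low x (mem_low_of_natDegree_lt (by simp))) (low_mono (by omega) hu)
    have hbd : b.natDegree ≤ h := by
      by_cases hb0 : b = 0
      · simp [hb0]
      · have := natDegree_lt_of_mem_low hbl hb0
        omega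
    have hbc : b.coeff h = x := by simp [hb, coeff_eq_zero_of_mem_low hu le_rfl]
    rw [residueAtInfinity_of_degree_lt hm, hh, Polynomial.coeff_C_mul,
      show 2 * h + 1 - 1 = h * 2 by omega, mul_comm h 2, ← hbc, mul_comm 2 h,
      Polynomial.coeff_pow_of_natDegree_le hbd |>.symm]
    · rw [mul_comm h 2]
    · refine mem_low.1 (mem_low_of_natDegree_lt
        (lt_of_le_of_lt (Polynomial.natDegree_C_mul_le _ _) ?_))
      rw [Polynomial.natDegree_pow]
      omega
  rw [Finset.sum_congr rfl h1]
  simp [card_low]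

theorem squareSum_mul {m n : F[X]} (hm : m.Monic) (hn : n.Monic) (h : IsCoprime m n) :
    squareSum ψ (m * n) 1 = squareSum ψ m n * squareSum ψ n m := by
  rw [squareSum, sum_low_mul hm hn h, squareSum, squareSum, Finset.sum_mul_sum]
  refine Finset.sum_congr rfl fun a _ => Finset.sum_congr rfl fun b _ => ?_
  have h1 : 1 * (n * a + m * b) ^ 2 = n * (n * a ^ 2) + m * (m * b ^ 2) + m * n * (2 * a * b) := by
    ring
  have h2 : residueAtInfinity (m * n) (m * n * (2 * a * b)) = 0 := by
    rw [residueAtInfinity_apply, (Polynomial.modByMonic_eq_zero_iff_dvd (hm.mul hn)).2 ⟨_, rfl⟩,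
      Polynomial.coeff_zero]
  rw [h1, map_add (residueAtInfinity _), map_add (residueAtInfinity _), h2, add_zero,
    AddChar.map_add_eq_mul, residueAtInfinity_mul_left hm hn, mul_comm m n,
    residueAtInfinity_mul_left hn hm]

theorem sum_low_residue_eq_zero (hψ : ψ ≠ 1) {m f : F[X]} (hm : m.Monic) (hf : ¬ m ∣ f) :
    ∑ a ∈ low F m.natDegree, ψ (residueAtInfinity m (f * a)) = 0 := by
  classical
  have h1 : ∀ a ∈ low F m.natDegree, ψ (residueAtInfinity m (f * a)) =
      ψ (residueAtInfinity m ((f %ₘ m) * a)) := by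
    intro a _
    rw [residueAtInfinity_congr hm]
    rw [← sub_mul]
    refine Dvd.dvd.mul_right ⟨f /ₘ m, ?_⟩ a
    nth_rewrite 1 [← Polynomial.modByMonic_add_div f m]
    ring
  have h2 : f %ₘ m ∈ low F m.natDegree := by
    rw [mem_low, ← Polynomial.degree_eq_natDegree hm.ne_zero]
    exact Polynomial.degree_modByMonic_lt f hm
  rw [Finset.sum_congr rfl h1, sum_low_addChar_residue hψ hm h2, Nat.sub_self, low_zero, if_neg]
  rwa [Finset.mem_singleton, Polynomial.modByMonic_eq_zero_iff_dvd hm]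

/-- Replacing `a` by `β²` counts `a` as often as it has square roots, `1 + χ_p(a)` times. -/
theorem squareSum_eq_symbolGaussSum (hψ : ψ ≠ 1) (hq : Nat.card F % 4 = 1) {p f : F[X]}
    (hpm : p.Monic) (hp : Irreducible p) (hf : ¬ p ∣ f) :
    squareSum ψ p f = symbolGaussSum ψ p f := by
  classical
  have := finite_adjoinRoot hpm
  have := Fintype.ofFinite (AdjoinRoot p)
  have := Fact.mk hp
  set G : AdjoinRoot p → ℂ := fun x =>
    ψ (residueAtInfinity p (f * AdjoinRoot.modByMonicHom hpm x)) with hG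
  have hGmk : ∀ a : F[X], G (AdjoinRoot.mk p a) = ψ (residueAtInfinity p (f * a)) := by
    intro a
    rw [hG]
    simp only [AdjoinRoot.modByMonicHom_mk]
    rw [residueAtInfinity_congr hpm]
    rw [← mul_sub]
    refine Dvd.dvd.mul_left ⟨-(a /ₘ p), ?_⟩ f
    nth_rewrite 2 [← Polynomial.modByMonic_add_div a p]
    ring
  have h1 : squareSum ψ p f = ∑ x : AdjoinRoot p, G (x ^ 2) := by
    rw [squareSum, ← sum_low_adjoinRoot hpm]
    refine Finset.sum_congr rfl fun b _ => ?_
    rw [← map_pow, hGmk]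
  have h2 : ∑ x : AdjoinRoot p, G (x ^ 2) =
      ∑ y : AdjoinRoot p, ((quadraticChar (AdjoinRoot p) y : ℂ) + 1) * G y := by
    rw [← Finset.sum_fiberwise_of_maps_to (t := Finset.univ) (g := fun x : AdjoinRoot p => x ^ 2)
      (fun _ _ => Finset.mem_univ _)]
    refine Finset.sum_congr rfl fun y _ => ?_
    rw [Finset.sum_congr rfl (g := fun _ => G y) fun x hx => by rw [(Finset.mem_filter.1 hx).2]]
    rw [Finset.sum_const, nsmul_eq_mul]
    congr 1
    have := quadraticChar_card_sqrts (ringChar_adjoinRoot_ne_two hq) y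
    have h3 : ({x : AdjoinRoot p | x ^ 2 = y}.toFinset) =
        Finset.univ.filter fun x => x ^ 2 = y := by ext x; simp
    rw [h3] at this
    exact_mod_cast congrArg (Int.cast (R := ℂ)) this
  have h3 : ∑ y : AdjoinRoot p, G y = 0 := by
    rw [← sum_low_adjoinRoot hpm, Finset.sum_congr rfl fun a _ => hGmk a]
    exact sum_low_residue_eq_zero hψ hpm hf
  rw [h1, h2]
  simp only [add_mul, one_mul, Finset.sum_add_distrib, h3, add_zero]
  rw [symbolGaussSum, ← sum_low_adjoinRoot hpm]
  refine Finset.sum_congr rfl fun a _ => ?_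
  rw [hGmk, residueSymbol_prime hpm hp, quadChar_eq_quadraticChar]

theorem sum_low_quadChar (hq : Nat.card F % 4 = 1) {p : F[X]} (hpm : p.Monic)
    (hp : Irreducible p) : ∑ a ∈ low F p.natDegree, (quadChar p a : ℂ) = 0 := by
  classical
  have := finite_adjoinRoot hpm
  have := Fintype.ofFinite (AdjoinRoot p)
  have := Fact.mk hp
  simp only [quadChar_eq_quadraticChar]
  rw [sum_low_adjoinRoot hpm (fun x => ((quadraticChar (AdjoinRoot p) x : ℤ) : ℂ))]
  exact_mod_cast quadraticChar_sum_zero (ringChar_adjoinRoot_ne_two hq)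

/-- Multiplication by `f` permutes the residues modulo `m` when `f` is prime to `m`. -/
theorem sum_low_mul_left {M : Type*} [AddCommMonoid M] {m f : F[X]} (hm : m.Monic)
    (hf : IsCoprime m f) {G : F[X] → M} (hG : ∀ a b, m ∣ a - b → G a = G b) :
    ∑ a ∈ low F m.natDegree, G (f * a) = ∑ a ∈ low F m.natDegree, G a := by
  have hmod : ∀ a : F[X], m ∣ a - a %ₘ m := fun a => ⟨a /ₘ m, by
    nth_rewrite 1 [← Polynomial.modByMonic_add_div a m]
    ring⟩
  have hmaps : ∀ a ∈ low F m.natDegree, (f * a) %ₘ m ∈ low F m.natDegree := by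
    intro a _
    rw [mem_low, ← Polynomial.degree_eq_natDegree hm.ne_zero]
    exact Polynomial.degree_modByMonic_lt _ hm
  have hinj : Set.InjOn (fun a => (f * a) %ₘ m) (low F m.natDegree : Set F[X]) := by
    intro a ha b hb hab
    have h1 : m ∣ f * (a - b) := by
      have := dvd_sub (hmod (f * a)) (hmod (f * b))
      simp only at hab
      rw [hab] at this
      convert this using 1
      ring
    have h2 := hf.dvd_of_dvd_mul_left h1
    have h3 := add_mem_low ha (neg_mem_low hb)
    rw [← sub_eq_add_neg, mem_low, ← Polynomial.degree_eq_natDegree hm.ne_zero] at h3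
    exact sub_eq_zero.1 (Polynomial.eq_zero_of_dvd_of_degree_lt h2 h3)
  exact Finset.sum_nbij (fun a => (f * a) %ₘ m) hmaps hinj
    (Finset.surjOn_of_injOn_of_card_le _ hmaps hinj le_rfl) fun a _ => hG _ _ (hmod _)

theorem symbolGaussSum_prime_eq (hq : Nat.card F % 4 = 1) {p : F[X]}
    (hpm : p.Monic) (hp : Irreducible p) (f : F[X]) :
    symbolGaussSum ψ p f = residueSymbol p f * symbolGaussSum ψ p 1 := by
  by_cases hf : p ∣ f
  · rw [residueSymbol_prime hpm hp, quadChar_eq_zero_iff.2 hf, Int.cast_zero, zero_mul,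
      symbolGaussSum, ← sum_low_quadChar hq hpm hp]
    refine Finset.sum_congr rfl fun a _ => ?_
    rw [residueAtInfinity_eq_zero_of_dvd hpm (hf.mul_right a), AddChar.map_zero_eq_one, mul_one,
      residueSymbol_prime hpm hp]
  · have hcop : IsCoprime p f := (hp.coprime_iff_not_dvd).2 hf
    have hs : (residueSymbol p f : ℂ) ^ 2 = 1 := by
      exact_mod_cast residueSymbol_sq_eq_one hpm hcop
    rw [symbolGaussSum, symbolGaussSum, ← sum_low_mul_left hpm hcop
      (G := fun a => (residueSymbol p a : ℂ) * ψ (residueAtInfinity p (1 * a))), Finset.mul_sum]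
    · refine Finset.sum_congr rfl fun a _ => ?_
      rw [one_mul, residueSymbol_mul_right hpm, Int.cast_mul]
      linear_combination (-((residueSymbol p a : ℂ) * ψ (residueAtInfinity p (f * a)))) * hs
    · intro a b hab
      rw [residueSymbol_congr hpm hab, one_mul, one_mul, residueAtInfinity_congr hpm hab]

end GaussSums

/-! ### Evaluation of Gauss sums and quadratic reciprocity -/

section Reciprocity

variable {F : Type} [Field F] [Fintype F] {ψ : AddChar F ℂ}

/-- The modulus `X` recovers the quadratic Gauss sum of `F`, twisted by the quadratic character of
`F`, which is the quadratic character modulo `X` on constants. -/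
theorem sum_addChar_mul_sq (hψ : ψ ≠ 1) (hq : Nat.card F % 4 = 1) {c : F} (hc : c ≠ 0) :
    ∑ x : F, ψ (c * x ^ 2) = quadChar Polynomial.X (Polynomial.C c) * quadGauss ψ := by
  have h1 : ∀ c : F, c ≠ 0 →
      ∑ x : F, ψ (c * x ^ 2) = symbolGaussSum ψ Polynomial.X (Polynomial.C c) := by
    intro c hc
    rw [← squareSum_eq_symbolGaussSum hψ hq Polynomial.monic_X Polynomial.irreducible_X
      (not_X_dvd_C hc), squareSum_C_odd hψ hq Polynomial.monic_X hc (h := 0) (by simp)]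
    simp
  have h2 := h1 1 one_ne_zero
  rw [h1 c hc, symbolGaussSum_prime_eq hq Polynomial.monic_X Polynomial.irreducible_X,
    ← Polynomial.C_1, ← h2, quadGauss,
    residueSymbol_prime Polynomial.monic_X Polynomial.irreducible_X]
  simp

theorem quadChar_X_neg_one (hq : Nat.card F % 4 = 1) :
    quadChar Polynomial.X (Polynomial.C (-1 : F)) = 1 := by
  have h1 : IsSquare (-1 : F) := by
    rw [FiniteField.isSquare_neg_one_iff, ← Nat.card_eq_fintype_card]
    omega
  obtain ⟨r, hr⟩ := h1
  have hr0 : r ≠ 0 := by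
    rintro rfl
    simp at hr
  rw [hr, ← pow_two, Polynomial.C_pow]
  exact quadChar_pow_two Polynomial.irreducible_X (not_X_dvd_C hr0)

theorem squareSum_degree_one (hψ : ψ ≠ 1) (hq : Nat.card F % 4 = 1) {p : F[X]} (hp : p.Monic)
    (hd : p.natDegree = 1) : squareSum ψ p 1 = quadGauss ψ := by
  rw [← Polynomial.C_1, squareSum_C_odd hψ hq hp one_ne_zero (h := 0) (by simpa using hd)]
  simp [quadGauss]

/-- The square of the quadratic Gauss sum of `F`, from the modulus `X (X - 1)`. -/
theorem quadGauss_sq (hψ : ψ ≠ 1) (hq : Nat.card F % 4 = 1) :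
    quadGauss ψ ^ 2 = Nat.card F := by
  have hX := Polynomial.monic_X (R := F)
  have hY := Polynomial.monic_X_sub_C (1 : F)
  have hXi := Polynomial.irreducible_X (R := F)
  have hYi := Polynomial.irreducible_X_sub_C (1 : F)
  have hcop : IsCoprime (Polynomial.X : F[X]) (Polynomial.X - Polynomial.C 1) :=
    ⟨1, -1, by simp⟩
  have h1 : squareSum ψ (Polynomial.X * (Polynomial.X - Polynomial.C 1)) 1 = Nat.card F := by
    rw [← Polynomial.C_1, squareSum_C_even hψ hq (hX.mul hY) one_ne_zero (h := 1), pow_one]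
    rw [hX.natDegree_mul hY, Polynomial.natDegree_X, Polynomial.natDegree_X_sub_C]
  rw [squareSum_mul hX hY hcop,
    squareSum_eq_symbolGaussSum hψ hq hX hXi ((hXi.coprime_iff_not_dvd).1 hcop),
    squareSum_eq_symbolGaussSum hψ hq hY hYi ((hYi.coprime_iff_not_dvd).1 hcop.symm),
    symbolGaussSum_prime_eq hq hX hXi, symbolGaussSum_prime_eq hq hY hYi,
    ← squareSum_eq_symbolGaussSum hψ hq hX hXi (fun h => hXi.not_isUnit (isUnit_of_dvd_one h)),
    ← squareSum_eq_symbolGaussSum hψ hq hY hYi (fun h => hYi.not_isUnit (isUnit_of_dvd_one h)),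
    squareSum_degree_one hψ hq hX Polynomial.natDegree_X,
    squareSum_degree_one hψ hq hY (Polynomial.natDegree_X_sub_C 1)] at h1
  have h2 : residueSymbol Polynomial.X (Polynomial.X - Polynomial.C (1 : F)) = 1 := by
    rw [residueSymbol_prime hX hXi, ← quadChar_X_neg_one hq]
    exact quadChar_congr (by simp)
  have h3 : residueSymbol (Polynomial.X - Polynomial.C (1 : F)) Polynomial.X = 1 := by
    rw [← residueSymbol_one_right hY]
    exact residueSymbol_congr hY (by simp)
  rw [h2, h3] at h1
  rw [← h1]
  push_cast
  ring

theorem quadGauss_ne_zero (hψ : ψ ≠ 1) (hq : Nat.card F % 4 = 1) : quadGauss ψ ≠ 0 := by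
  intro h
  have h1 := quadGauss_sq hψ hq
  rw [h, zero_pow two_ne_zero] at h1
  have : Nat.card F = 0 := by exact_mod_cast h1.symm
  omega

theorem squareSum_const (hψ : ψ ≠ 1) (hq : Nat.card F % 4 = 1) {m : F[X]} (hm : m.Monic) {c : F}
    (hc : c ≠ 0) : squareSum ψ m (Polynomial.C c) =
      (quadChar Polynomial.X (Polynomial.C c) * quadGauss ψ) ^ m.natDegree := by
  have h1 : (quadChar Polynomial.X (Polynomial.C c) * quadGauss ψ) ^ 2 = Nat.card F := by
    rw [mul_pow, quadGauss_sq hψ hq]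
    have : (quadChar Polynomial.X (Polynomial.C c) : ℂ) ^ 2 = 1 := by
      exact_mod_cast quadChar_X_C_sq hc
    rw [this, one_mul]
  rcases Nat.even_or_odd' m.natDegree with ⟨h, hh | hh⟩
  · rw [squareSum_C_even hψ hq hm hc hh, hh, pow_mul, h1]
  · rw [squareSum_C_odd hψ hq hm hc hh, hh, pow_succ, pow_mul, h1, sum_addChar_mul_sq hψ hq hc]

theorem squareSum_one (hψ : ψ ≠ 1) (hq : Nat.card F % 4 = 1) {m : F[X]} (hm : m.Monic) :
    squareSum ψ m 1 = quadGauss ψ ^ m.natDegree := by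
  have h1 : quadChar Polynomial.X (Polynomial.C (1 : F)) = 1 := by
    rw [Polynomial.C_1, quadChar_one Polynomial.irreducible_X]
  rw [← Polynomial.C_1, squareSum_const hψ hq hm one_ne_zero, h1, Int.cast_one, one_mul]

theorem squareSum_prime (hψ : ψ ≠ 1) (hq : Nat.card F % 4 = 1) {p f : F[X]}
    (hpm : p.Monic) (hp : Irreducible p) (hf : ¬ p ∣ f) :
    squareSum ψ p f = quadChar p f * quadGauss ψ ^ p.natDegree := by
  rw [squareSum_eq_symbolGaussSum hψ hq hpm hp hf, symbolGaussSum_prime_eq hq hpm hp,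
    ← squareSum_eq_symbolGaussSum hψ hq hpm hp (fun h => hp.not_isUnit (isUnit_of_dvd_one h)),
    squareSum_one hψ hq hpm, residueSymbol_prime hpm hp]

theorem exists_addChar_ne_one : ∃ ψ : AddChar F ℂ, ψ ≠ 1 := by
  refine ⟨AddChar.FiniteField.primitiveChar_to_Complex F, fun h => ?_⟩
  have := AddChar.FiniteField.primitiveChar_to_Complex_isPrimitive F (a := 1) one_ne_zero
  rw [AddChar.mulShift_one] at this
  exact this h

/-- The square sum modulo `p` of a constant `c` depends on `deg p` only, not on `p`. -/
theorem quadChar_C (hq : Nat.card F % 4 = 1) {p : F[X]} (hpm : p.Monic) (hp : Irreducible p)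
    {c : F} (hc : c ≠ 0) :
    quadChar p (Polynomial.C c) = quadChar Polynomial.X (Polynomial.C c) ^ p.natDegree := by
  obtain ⟨ψ, hψ⟩ := exists_addChar_ne_one (F := F)
  have hd : ¬ p ∣ Polynomial.C c := fun h => hp.not_isUnit
    (isUnit_of_dvd_unit h (Polynomial.isUnit_C.2 hc.isUnit))
  have h1 := squareSum_prime hψ hq hpm hp hd
  rw [squareSum_const hψ hq hpm hc, mul_pow] at h1
  have h2 := mul_right_cancel₀ (pow_ne_zero _ (quadGauss_ne_zero hψ hq)) h1
  exact_mod_cast h2.symm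

/-- On constants the residue symbol modulo `m` is trivial when `deg m` is even, and the quadratic
character of `F` when `deg m` is odd. -/
theorem residueSymbol_C (hq : Nat.card F % 4 = 1) {m : F[X]} (hm : m.Monic)
    {c : F} (hc : c ≠ 0) :
    residueSymbol m (Polynomial.C c) = quadChar Polynomial.X (Polynomial.C c) ^ m.natDegree := by
  induction m, hm using monic_induction with
  | h1 => simp [residueSymbol_one_left]
  | hmul p m hpm hp hm ih =>
    rw [residueSymbol_mul_left hpm.ne_zero hm.ne_zero, ih, residueSymbol_prime hpm hp,
      quadChar_C hq hpm hp hc, hpm.natDegree_mul hm, pow_add]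

/-- Quadratic reciprocity for two primes, by computing the square sum modulo `p r` twice. -/
theorem quadChar_reciprocity (hq : Nat.card F % 4 = 1) {p r : F[X]} (hpm : p.Monic)
    (hp : Irreducible p) (hrm : r.Monic) (hr : Irreducible r) (h : ¬ p ∣ r) :
    quadChar p r * quadChar r p = 1 := by
  obtain ⟨ψ, hψ⟩ := exists_addChar_ne_one (F := F)
  have hcop : IsCoprime p r := (hp.coprime_iff_not_dvd).2 h
  have h1 := squareSum_mul (ψ := ψ) hpm hrm hcop
  rw [squareSum_one hψ hq (hpm.mul hrm), squareSum_prime hψ hq hpm hp h,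
    squareSum_prime hψ hq hrm hr ((hr.coprime_iff_not_dvd).1 hcop.symm),
    hpm.natDegree_mul hrm] at h1
  have h2 : (quadGauss ψ ^ (p.natDegree + r.natDegree)) *
      ((quadChar p r : ℂ) * quadChar r p) = quadGauss ψ ^ (p.natDegree + r.natDegree) * 1 := by
    rw [mul_one]
    nth_rewrite 2 [h1]
    ring
  exact_mod_cast mul_left_cancel₀ (pow_ne_zero _ (quadGauss_ne_zero hψ hq)) h2

theorem residueSymbol_reciprocity (hq : Nat.card F % 4 = 1) {p m : F[X]} (hpm : p.Monic)
    (hp : Irreducible p) (hm : m.Monic) (h : ¬ p ∣ m) :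
    residueSymbol p m * residueSymbol m p = 1 := by
  revert h
  induction m, hm using monic_induction with
  | h1 => simp [residueSymbol_one_left, residueSymbol_one_right hpm]
  | hmul r m hrm hr hm ih =>
    intro h
    have h1 : ¬ p ∣ r := fun hd => h (hd.mul_right m)
    have h2 : ¬ p ∣ m := fun hd => h (hd.mul_left r)
    rw [residueSymbol_mul_left hrm.ne_zero hm.ne_zero, residueSymbol_mul_right hpm,
      residueSymbol_prime hpm hp, residueSymbol_prime hrm hr]
    have h3 := ih h2
    rw [residueSymbol_prime hpm hp] at h3 ⊢
    linear_combination quadChar p m * residueSymbol m p *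
      quadChar_reciprocity hq hpm hp hrm hr h1 + h3

/-- The residue symbol modulo a squarefree `m` is a primitive character, and its root number has no
sign depending on `m`: the cross symbols which the Chinese remainder theorem brings in cancel by
reciprocity. -/
theorem symbolGaussSum_eq (hψ : ψ ≠ 1) (hq : Nat.card F % 4 = 1) {m : F[X]} (hm : m.Monic)
    (hsq : Squarefree m) (f : F[X]) :
    symbolGaussSum ψ m f = residueSymbol m f * quadGauss ψ ^ m.natDegree := by
  revert hsq
  induction m, hm using monic_induction with
  | h1 => intro _; simp [symbolGaussSum, residueSymbol_one_left, low_zero]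
  | hmul p m hpm hp hm ih =>
    intro hsq
    have hpd : ¬ p ∣ m := fun hd => hp.not_isUnit (hsq p (mul_dvd_mul_left p hd))
    have hcop : IsCoprime p m := (hp.coprime_iff_not_dvd).2 hpd
    have h1 : symbolGaussSum ψ (p * m) f =
        ((residueSymbol p m * residueSymbol m p : ℤ) : ℂ) *
          (symbolGaussSum ψ p f * symbolGaussSum ψ m f) := by
      rw [symbolGaussSum, sum_low_mul hpm hm hcop, symbolGaussSum, symbolGaussSum,
        Finset.sum_mul_sum, Finset.mul_sum]
      refine Finset.sum_congr rfl fun a _ => ?_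
      rw [Finset.mul_sum]
      refine Finset.sum_congr rfl fun b _ => ?_
      have h2 : f * (m * a + p * b) = m * (f * a) + p * (f * b) := by ring
      rw [h2, map_add (residueAtInfinity _), AddChar.map_add_eq_mul,
        residueAtInfinity_mul_left hpm hm, mul_comm p m, residueAtInfinity_mul_left hm hpm,
        residueSymbol_mul_left hm.ne_zero hpm.ne_zero,
        residueSymbol_congr (b := p * b) hm ⟨a, by ring⟩,
        residueSymbol_congr (b := m * a) hpm ⟨b, by ring⟩,
        residueSymbol_mul_right hm, residueSymbol_mul_right hpm]
      push_cast
      ring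
    rw [h1, residueSymbol_reciprocity hq hpm hp hm hpd, ih hsq.of_mul_right,
      symbolGaussSum_prime_eq hq hpm hp,
      ← squareSum_eq_symbolGaussSum hψ hq hpm hp (fun h => hp.not_isUnit (isUnit_of_dvd_one h)),
      squareSum_one hψ hq hpm, residueSymbol_mul_left hpm.ne_zero hm.ne_zero,
      hpm.natDegree_mul hm, pow_add]
    push_cast
    ring

end Reciprocity

/-! ### Poisson summation for quadratic character sums -/

section CharacterSums

variable {F : Type} [Field F] [Fintype F] {ψ : AddChar F ℂ}

/-- The coefficients of the `L`-function of the residue symbol modulo `m`. -/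
def charSum (m : F[X]) (n : ℕ) : ℂ := ∑ f ∈ monics F n, (residueSymbol m f : ℂ)

/-- The sum of the residue symbol modulo `m` over all polynomials of degree less than `n`. -/
def lowCharSum (m : F[X]) (n : ℕ) : ℂ := ∑ f ∈ low F n, (residueSymbol m f : ℂ)

/-- Poisson summation over the polynomials of degree less than `n`. -/
theorem lowCharSum_poisson (hψ : ψ ≠ 1) (hq : Nat.card F % 4 = 1) {m : F[X]} (hm : m.Monic)
    (hsq : Squarefree m) (n : ℕ) :
    quadGauss ψ ^ m.natDegree * lowCharSum m n =
      (Nat.card F : ℂ) ^ n * lowCharSum m (m.natDegree - n) := by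
  classical
  calc quadGauss ψ ^ m.natDegree * lowCharSum m n
      = ∑ f ∈ low F n, symbolGaussSum ψ m f := by
        rw [lowCharSum, Finset.mul_sum]
        refine Finset.sum_congr rfl fun f _ => ?_
        rw [symbolGaussSum_eq hψ hq hm hsq, mul_comm]
    _ = ∑ a ∈ low F m.natDegree, (residueSymbol m a : ℂ) *
          ∑ f ∈ low F n, ψ (residueAtInfinity m (a * f)) := by
        simp only [symbolGaussSum]
        rw [Finset.sum_comm]
        refine Finset.sum_congr rfl fun a _ => ?_
        rw [Finset.mul_sum]
        exact Finset.sum_congr rfl fun f _ => by rw [mul_comm f a]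
    _ = _ := by
        rw [Finset.sum_congr rfl fun a ha => by rw [sum_low_addChar_residue hψ hm ha n, mul_ite,
          mul_zero], ← Finset.sum_filter, Finset.filter_mem_eq_inter,
          Finset.inter_eq_right.2 (low_mono (Nat.sub_le _ _)), ← Finset.sum_mul, mul_comm,
          lowCharSum]

/-- Poisson summation over the monic polynomials of degree `n`. -/
theorem charSum_poisson (hψ : ψ ≠ 1) (hq : Nat.card F % 4 = 1) {m : F[X]} (hm : m.Monic)
    (hsq : Squarefree m) (n : ℕ) :
    quadGauss ψ ^ m.natDegree * charSum m n =
      (Nat.card F : ℂ) ^ n * ∑ a ∈ low F (m.natDegree - n), (residueSymbol m a : ℂ) *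
        ψ (residueAtInfinity m (a * Polynomial.X ^ n)) := by
  classical
  calc quadGauss ψ ^ m.natDegree * charSum m n
      = ∑ u ∈ low F n, symbolGaussSum ψ m (Polynomial.X ^ n + u) := by
        rw [charSum, sum_monics, Finset.mul_sum]
        refine Finset.sum_congr rfl fun f _ => ?_
        rw [symbolGaussSum_eq hψ hq hm hsq, mul_comm]
    _ = ∑ a ∈ low F m.natDegree, (residueSymbol m a : ℂ) *
          ψ (residueAtInfinity m (a * Polynomial.X ^ n)) *
          ∑ f ∈ low F n, ψ (residueAtInfinity m (a * f)) := by
        simp only [symbolGaussSum]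
        rw [Finset.sum_comm]
        refine Finset.sum_congr rfl fun a _ => ?_
        rw [Finset.mul_sum]
        refine Finset.sum_congr rfl fun f _ => ?_
        rw [mul_comm _ a, mul_add, map_add (residueAtInfinity m), AddChar.map_add_eq_mul, mul_assoc]
    _ = _ := by
        rw [Finset.sum_congr rfl fun a ha => by rw [sum_low_addChar_residue hψ hm ha n, mul_ite,
          mul_zero], ← Finset.sum_filter, Finset.filter_mem_eq_inter,
          Finset.inter_eq_right.2 (low_mono (Nat.sub_le _ _)), ← Finset.sum_mul, mul_comm]

theorem lowCharSum_zero {m : F[X]} (hm : m.Monic) (hm1 : 0 < m.natDegree) :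
    lowCharSum m 0 = 0 := by
  simp [lowCharSum, low_zero, residueSymbol_zero_right hm hm1]

theorem charSum_zero {m : F[X]} (hm : m.Monic) : charSum m 0 = 1 := by
  simp [charSum, monics_zero, residueSymbol_one_right hm]

theorem charSum_one (n : ℕ) : charSum (1 : F[X]) n = (Nat.card F : ℂ) ^ n := by
  simp [charSum, residueSymbol_one_left, card_monics]

theorem charSum_eq_zero (hq : Nat.card F % 4 = 1) {m : F[X]} (hm : m.Monic)
    (hsq : Squarefree m) (hm1 : 0 < m.natDegree) {n : ℕ} (hn : m.natDegree ≤ n) :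
    charSum m n = 0 := by
  obtain ⟨ψ, hψ⟩ := exists_addChar_ne_one (F := F)
  have h := charSum_poisson hψ hq hm hsq n
  rw [Nat.sub_eq_zero_of_le hn, low_zero, Finset.sum_singleton, residueSymbol_zero_right hm hm1,
    Int.cast_zero, zero_mul, mul_zero] at h
  exact (mul_eq_zero.1 h).resolve_left (pow_ne_zero _ (quadGauss_ne_zero hψ hq))

theorem lowCharSum_eq_zero (hq : Nat.card F % 4 = 1) {m : F[X]} (hm : m.Monic)
    (hsq : Squarefree m) (hm1 : 0 < m.natDegree) {n : ℕ} (hn : m.natDegree ≤ n) :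
    lowCharSum m n = 0 := by
  obtain ⟨ψ, hψ⟩ := exists_addChar_ne_one (F := F)
  have h := lowCharSum_poisson hψ hq hm hsq n
  rw [Nat.sub_eq_zero_of_le hn, lowCharSum_zero hm hm1, mul_zero] at h
  exact (mul_eq_zero.1 h).resolve_left (pow_ne_zero _ (quadGauss_ne_zero hψ hq))

/-- For even `deg m`, it is the sums over all polynomials, not only the monic ones, which Poisson
summation exchanges. -/
theorem lowCharSum_functional (hq : Nat.card F % 4 = 1) {m : F[X]} (hm : m.Monic)
    (hsq : Squarefree m) {h : ℕ} (hd : m.natDegree = 2 * h) (n : ℕ) :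
    (Nat.card F : ℂ) ^ h * lowCharSum m n = (Nat.card F : ℂ) ^ n * lowCharSum m (2 * h - n) := by
  obtain ⟨ψ, hψ⟩ := exists_addChar_ne_one (F := F)
  have := lowCharSum_poisson hψ hq hm hsq n
  rwa [hd, pow_mul, quadGauss_sq hψ hq] at this

/-- For even `deg m` the residue symbol modulo `m` is trivial on constants. -/
theorem lowCharSum_succ_even (hq : Nat.card F % 4 = 1) {m : F[X]} (hm : m.Monic)
    {h : ℕ} (hd : m.natDegree = 2 * h) (n : ℕ) :
    lowCharSum m (n + 1) = lowCharSum m n + ((Nat.card F : ℂ) - 1) * charSum m n := by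
  classical
  rw [lowCharSum, sum_low_succ, ← lowCharSum]
  congr 1
  have h1 : ∀ c ∈ Finset.univ.erase (0 : F), ∑ f ∈ monics F n,
      (residueSymbol m (Polynomial.C c * f) : ℂ) = charSum m n := by
    intro c hc
    refine Finset.sum_congr rfl fun f _ => ?_
    rw [residueSymbol_mul_right hm, residueSymbol_C hq hm (Finset.ne_of_mem_erase hc), hd, pow_mul,
      quadChar_X_C_sq (Finset.ne_of_mem_erase hc), one_pow, one_mul]
  rw [Finset.sum_congr rfl h1, Finset.sum_const, Finset.card_erase_of_mem (Finset.mem_univ _),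
    Finset.card_univ, nsmul_eq_mul, Nat.card_eq_fintype_card, Nat.cast_pred Fintype.card_pos]

/-- For odd `deg m` the residue symbol modulo `m` is nontrivial on constants. -/
theorem lowCharSum_odd (hq : Nat.card F % 4 = 1) {m : F[X]} (hm : m.Monic)
    {h : ℕ} (hd : m.natDegree = 2 * h + 1) (n : ℕ) : lowCharSum m n = 0 := by
  -- otherwise the quadratic character modulo `X` would not sum to zero over `F`
  obtain ⟨c, hc0, hc⟩ : ∃ c : F, c ≠ 0 ∧ quadChar Polynomial.X (Polynomial.C c) ≠ 1 := by
    by_contra! hall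
    have h1 := sum_low_quadChar hq (Polynomial.monic_X (R := F)) Polynomial.irreducible_X
    classical
    rw [Polynomial.natDegree_X, sum_low_succ, low_zero, Finset.sum_singleton,
      quadChar_eq_zero_iff.2 (dvd_zero _), Int.cast_zero, zero_add] at h1
    have h2 : ∀ c ∈ Finset.univ.erase (0 : F), ∑ f ∈ monics F 0,
        (quadChar Polynomial.X (Polynomial.C c * f) : ℂ) = 1 := by
      intro c hc
      rw [Finset.sum_congr rfl (g := fun _ => (1 : ℂ))]
      · simp [card_monics]
      · intro f hf
        obtain ⟨hfm, hfd⟩ := mem_monics.1 hf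
        rw [hfm.natDegree_eq_zero.1 hfd, mul_one, hall c (Finset.ne_of_mem_erase hc), Int.cast_one]
    rw [Finset.sum_congr rfl h2, Finset.sum_const, Finset.card_erase_of_mem (Finset.mem_univ _),
      Finset.card_univ, nsmul_eq_mul, mul_one, ← Nat.card_eq_fintype_card] at h1
    have h3 : Nat.card F - 1 = 0 := by exact_mod_cast h1
    have := Finite.one_lt_card (α := F)
    omega
  have hsym : residueSymbol m (Polynomial.C c) = quadChar Polynomial.X (Polynomial.C c) := by
    rw [residueSymbol_C hq hm hc0, hd, pow_succ, pow_mul, quadChar_X_C_sq hc0, one_pow, one_mul]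
  have h1 : lowCharSum m n = quadChar Polynomial.X (Polynomial.C c) * lowCharSum m n := by
    rw [← hsym, lowCharSum, Finset.mul_sum]
    refine Finset.sum_nbij' (fun f => Polynomial.C c⁻¹ * f) (fun f => Polynomial.C c * f)
      (fun f hf => C_mul_mem_low _ hf) (fun f hf => C_mul_mem_low _ hf) ?_ ?_ ?_
    · intro f _; rw [← mul_assoc, ← Polynomial.C_mul, mul_inv_cancel₀ hc0]; simp
    · intro f _; rw [← mul_assoc, ← Polynomial.C_mul, inv_mul_cancel₀ hc0]; simp
    · intro f _
      rw [← Int.cast_mul, ← residueSymbol_mul_right hm, ← mul_assoc, ← Polynomial.C_mul,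
        mul_inv_cancel₀ hc0]
      simp
  have h2 : ((quadChar Polynomial.X (Polynomial.C c) : ℂ) - 1) * lowCharSum m n = 0 := by
    linear_combination -h1
  refine (mul_eq_zero.1 h2).resolve_left (sub_ne_zero.2 ?_)
  exact_mod_cast hc

/-- The Gauss sum of `F` as a sum over the quadratic character, read off from the modulus `X`. -/
theorem sum_quadChar_mul_addChar (hψ : ψ ≠ 1) (hq : Nat.card F % 4 = 1) [DecidableEq F] :
    ∑ c ∈ Finset.univ.erase (0 : F), (quadChar Polynomial.X (Polynomial.C c) : ℂ) * ψ c =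
      quadGauss ψ := by
  have hX := Polynomial.monic_X (R := F)
  have hXi := Polynomial.irreducible_X (R := F)
  have h0 := squareSum_eq_symbolGaussSum hψ hq hX hXi (f := 1)
    (fun h => hXi.not_isUnit (isUnit_of_dvd_one h))
  rw [squareSum_degree_one hψ hq hX Polynomial.natDegree_X, symbolGaussSum, Polynomial.natDegree_X,
    sum_low_succ, low_zero, Finset.sum_singleton, residueSymbol_prime hX hXi,
    quadChar_eq_zero_iff.2 (dvd_zero _), Int.cast_zero, zero_mul, zero_add] at h0
  rw [h0]
  refine Finset.sum_congr rfl fun c _ => ?_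
  rw [monics_zero, Finset.sum_singleton, mul_one, residueSymbol_prime hX hXi, one_mul,
    residueAtInfinity_of_degree_lt hX]
  · simp
  · exact mem_low.1 (mem_low_of_natDegree_lt (by simp))

/-- The functional equation of the `L`-function for odd `deg m`. -/
theorem charSum_functional (hq : Nat.card F % 4 = 1) {m : F[X]} (hm : m.Monic)
    (hsq : Squarefree m) {h : ℕ} (hd : m.natDegree = 2 * h + 1) {n : ℕ} (hn : n ≤ 2 * h) :
    (Nat.card F : ℂ) ^ h * charSum m n = (Nat.card F : ℂ) ^ n * charSum m (2 * h - n) := by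
  classical
  obtain ⟨ψ, hψ⟩ := exists_addChar_ne_one (F := F)
  have h1 := charSum_poisson hψ hq hm hsq n
  have hsplit : ∑ a ∈ low F (m.natDegree - n), (residueSymbol m a : ℂ) *
      ψ (residueAtInfinity m (a * Polynomial.X ^ n)) = quadGauss ψ * charSum m (2 * h - n) := by
    rw [hd, show 2 * h + 1 - n = (2 * h - n) + 1 by omega, sum_low_succ]
    -- in degrees less than `2 h - n` the additive character is trivial, and the symbol sums to zero
    have h2 : ∑ a ∈ low F (2 * h - n), (residueSymbol m a : ℂ) *
        ψ (residueAtInfinity m (a * Polynomial.X ^ n)) = 0 := by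
      rw [← lowCharSum_odd hq hm hd (2 * h - n), lowCharSum]
      refine Finset.sum_congr rfl fun a ha => ?_
      by_cases ha0 : a = 0
      · simp [ha0]
      have had := natDegree_lt_of_mem_low ha ha0
      have hlt : (a * Polynomial.X ^ n).natDegree < m.natDegree - 1 := by
        rw [Polynomial.natDegree_mul_X_pow _ ha0]
        omega
      rw [residueAtInfinity_of_degree_lt hm, Polynomial.coeff_eq_zero_of_natDegree_lt hlt,
        AddChar.map_zero_eq_one, mul_one]
      exact mem_low.1 (mem_low_of_natDegree_lt (by omega))
    rw [h2, zero_add, ← sum_quadChar_mul_addChar hψ hq, Finset.sum_mul]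
    refine Finset.sum_congr rfl fun c hc => ?_
    have hc0 := Finset.ne_of_mem_erase hc
    rw [charSum, Finset.mul_sum]
    refine Finset.sum_congr rfl fun f hf => ?_
    obtain ⟨hfm, hfd⟩ := mem_monics.1 hf
    have hdeg : (f * Polynomial.X ^ n).natDegree = 2 * h := by
      rw [Polynomial.natDegree_mul_X_pow _ hfm.ne_zero, hfd]
      omega
    have hres : residueAtInfinity m (Polynomial.C c * f * Polynomial.X ^ n) = c := by
      rw [mul_assoc, residueAtInfinity_of_degree_lt hm, hd, Polynomial.coeff_C_mul,
        Nat.add_sub_cancel, ← hdeg, (hfm.mul (Polynomial.monic_X_pow n)).coeff_natDegree, mul_one]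
      refine mem_low.1 (mem_low_of_natDegree_lt
        (lt_of_le_of_lt (Polynomial.natDegree_C_mul_le _ _) ?_))
      omega
    rw [hres, residueSymbol_mul_right hm, residueSymbol_C hq hm hc0, hd, pow_succ, pow_mul,
      quadChar_X_C_sq hc0, one_pow, one_mul]
    push_cast
    ring
  rw [hsplit, hd, pow_succ, pow_mul, quadGauss_sq hψ hq] at h1
  refine mul_left_cancel₀ (quadGauss_ne_zero hψ hq) ?_
  linear_combination h1

end CharacterSums

/-! ### Self-dual power series and the functional equation of quadratic `L`-functions -/

section SelfDuality

theorem coeffZ_natCast (s : ℂ⟦X⟧) (n : ℕ) : coeffZ s n = PowerSeries.coeff n s := by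
  simp [coeffZ]

theorem coeffZ_of_neg (s : ℂ⟦X⟧) {k : ℤ} (hk : k < 0) : coeffZ s k = 0 := by
  simp [coeffZ, hk]

/-- The symmetry `s_k = Q^{k - v} s_{2 v - k}` of the coefficients of a power series `s`, with the
convention that coefficients at negative indices vanish; so `s` is a polynomial of degree at most
`2 v`. -/
def SelfDual (Q : ℂ) (v : ℕ) (s : ℂ⟦X⟧) : Prop :=
  ∀ k : ℤ, coeffZ s k = Q ^ (k - v) * coeffZ s (2 * v - k)

variable {Q : ℂ} {v : ℕ} {s : ℂ⟦X⟧}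

theorem selfDual_iff_coeff (hQ : Q ≠ 0) : SelfDual Q v s ↔
    (∀ k ≤ 2 * v, Q ^ v * PowerSeries.coeff k s = Q ^ k * PowerSeries.coeff (2 * v - k) s) ∧
      ∀ k, 2 * v < k → PowerSeries.coeff k s = 0 := by
  constructor
  · intro h
    refine ⟨fun k hk => ?_, fun k hk => ?_⟩
    · have h1 := h k
      rw [show (2 * v - k : ℤ) = ((2 * v - k : ℕ) : ℤ) by omega, coeffZ_natCast, coeffZ_natCast,
        zpow_sub₀ hQ, zpow_natCast, zpow_natCast] at h1
      rw [h1]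
      field_simp
    · have h1 := h k
      rwa [coeffZ_of_neg s (k := 2 * v - k) (by omega), mul_zero, coeffZ_natCast] at h1
  · rintro ⟨h1, h2⟩ k
    by_cases hk : k < 0
    · rw [coeffZ_of_neg s hk, show (2 * v - k : ℤ) = ((2 * v + k.natAbs : ℕ) : ℤ) by omega,
        coeffZ_natCast, h2 _ (by omega), mul_zero]
    · lift k to ℕ using not_lt.1 hk
      by_cases hk2 : 2 * v < k
      · rw [coeffZ_natCast, h2 k hk2, coeffZ_of_neg s (by omega), mul_zero]
      · rw [show (2 * v - k : ℤ) = ((2 * v - k : ℕ) : ℤ) by omega, coeffZ_natCast, coeffZ_natCast,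
          zpow_sub₀ hQ, zpow_natCast, zpow_natCast]
        have := h1 k (by omega)
        field_simp
        linear_combination this

theorem eval_reflect {N : ℂ[X]} {n : ℕ} (hN : N.natDegree ≤ n) {x : ℂ} (hx : x ≠ 0) :
    (N.reflect n).eval x = x ^ n * N.eval x⁻¹ := by
  have : Invertible x⁻¹ := invertibleOfNonzero (inv_ne_zero hx)
  have h1 := Polynomial.eval₂_reflect_mul_pow (RingHom.id ℂ) x⁻¹ n N hN
  rw [invOf_eq_inv, inv_inv] at h1
  rw [Polynomial.eval, Polynomial.eval, ← h1, mul_left_comm, ← mul_pow, mul_inv_cancel₀ hx,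
    one_pow, mul_one]

/-- The coefficient symmetry is the functional equation of a polynomial under `x ↦ (Q x)⁻¹`. -/
theorem selfDual_iff_polynomial (hQ : Q ≠ 0) : SelfDual Q v s ↔
    ∃ N : ℂ[X], s = (N : ℂ⟦X⟧) ∧ N.natDegree ≤ 2 * v ∧
      ∀ x : ℂ, x ≠ 0 → Q ^ v * x ^ (2 * v) * N.eval ((Q * x)⁻¹) = N.eval x := by
  rw [selfDual_iff_coeff hQ]
  have key : ∀ N : ℂ[X], N.natDegree ≤ 2 * v →
      ((∀ k ≤ 2 * v, Q ^ v * N.coeff k = Q ^ k * N.coeff (2 * v - k)) ↔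
        Polynomial.C (Q ^ v) * N = (N.reflect (2 * v)).comp (Polynomial.C Q * Polynomial.X)) := by
    intro N hN
    rw [Polynomial.ext_iff]
    simp only [Polynomial.coeff_C_mul, Polynomial.comp_C_mul_X_coeff, Polynomial.coeff_reflect]
    refine ⟨fun h k => ?_, fun h k hk => ?_⟩
    · by_cases hk : k ≤ 2 * v
      · rw [h k hk, Polynomial.revAt_le hk, mul_comm]
      · rw [Polynomial.revAt_eq_self_of_lt (by omega),
          Polynomial.coeff_eq_zero_of_natDegree_lt (by omega)]
        simp
    · rw [h k, Polynomial.revAt_le hk, mul_comm]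
  have key2 : ∀ N : ℂ[X], N.natDegree ≤ 2 * v → ∀ x : ℂ, x ≠ 0 →
      ((N.reflect (2 * v)).comp (Polynomial.C Q * Polynomial.X)).eval x =
        (Q * x) ^ (2 * v) * N.eval ((Q * x)⁻¹) := by
    intro N hN x hx
    rw [Polynomial.eval_comp, Polynomial.eval_mul, Polynomial.eval_C, Polynomial.eval_X,
      eval_reflect hN (mul_ne_zero hQ hx)]
  constructor
  · rintro ⟨h1, h2⟩
    set N := PowerSeries.trunc (2 * v + 1) s with hN
    have hcoeff : ∀ k, N.coeff k = PowerSeries.coeff k s := by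
      intro k
      rw [hN, PowerSeries.coeff_trunc]
      split_ifs with hk
      · rfl
      · rw [h2 k (by omega)]
    have hdeg : N.natDegree ≤ 2 * v := by
      rw [Polynomial.natDegree_le_iff_coeff_eq_zero]
      intro k hk
      rw [hcoeff, h2 k hk]
    refine ⟨N, ?_, hdeg, fun x hx => ?_⟩
    · ext k
      rw [Polynomial.coeff_coe, hcoeff]
    · have h3 := (key N hdeg).1 fun k hk => by rw [hcoeff, hcoeff, h1 k hk]
      have h4 := congrArg (Polynomial.eval x) h3
      rw [key2 N hdeg x hx, Polynomial.eval_mul, Polynomial.eval_C] at h4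
      refine mul_left_cancel₀ (pow_ne_zero v hQ) ?_
      rw [h4]
      ring
  · rintro ⟨N, rfl, hdeg, hN⟩
    simp only [Polynomial.coeff_coe]
    refine ⟨(key N hdeg).2 ?_, fun k hk => Polynomial.coeff_eq_zero_of_natDegree_lt (by omega)⟩
    refine Polynomial.eq_of_infinite_eval_eq _ _ (Set.Infinite.mono (s := {0}ᶜ) ?_
      (Set.finite_singleton (0 : ℂ)).infinite_compl)
    intro x hx
    rw [Set.mem_ofPred_eq, key2 N hdeg x hx, Polynomial.eval_mul, Polynomial.eval_C, ← hN x hx]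
    ring

theorem SelfDual.add {t : ℂ⟦X⟧} (hs : SelfDual Q v s) (ht : SelfDual Q v t) :
    SelfDual Q v (s + t) := by
  have h : ∀ k : ℤ, coeffZ (s + t) k = coeffZ s k + coeffZ t k := by
    intro k
    unfold coeffZ
    split_ifs <;> simp
  intro k
  rw [h, h, hs k, ht k, mul_add]

theorem SelfDual.C_mul (c : ℂ) (hs : SelfDual Q v s) : SelfDual Q v (PowerSeries.C c * s) := by
  have h : ∀ k : ℤ, coeffZ (PowerSeries.C c * s) k = c * coeffZ s k := by
    intro k
    unfold coeffZ
    split_ifs <;> simp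
  intro k
  rw [h, h, hs k]
  ring

theorem SelfDual.zero : SelfDual Q v 0 := by
  intro k
  simp [coeffZ]

theorem SelfDual.sum {ι : Type*} {S : Finset ι} {f : ι → ℂ⟦X⟧}
    (h : ∀ x ∈ S, SelfDual Q v (f x)) : SelfDual Q v (∑ x ∈ S, f x) := by
  classical
  induction S using Finset.induction_on with
  | empty => simpa using SelfDual.zero
  | insert a S ha ih =>
    rw [Finset.sum_insert ha]
    exact (h a (Finset.mem_insert_self a S)).add
      (ih fun x hx => h x (Finset.mem_insert_of_mem hx))

theorem SelfDual.mul {w : ℕ} {t : ℂ⟦X⟧} (hQ : Q ≠ 0) (hs : SelfDual Q v s)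
    (ht : SelfDual Q w t) : SelfDual Q (v + w) (s * t) := by
  rw [selfDual_iff_polynomial hQ] at *
  obtain ⟨M, rfl, hMd, hM⟩ := hs
  obtain ⟨N, rfl, hNd, hN⟩ := ht
  refine ⟨M * N, by simp, Polynomial.natDegree_mul_le.trans (by omega), fun x hx => ?_⟩
  rw [Polynomial.eval_mul, Polynomial.eval_mul, ← hM x hx, ← hN x hx]
  ring

theorem SelfDual.one : SelfDual Q 0 1 := by
  intro k
  rcases lt_trichotomy k 0 with hk | rfl | hk
  · rw [coeffZ_of_neg _ hk, show (2 * ((0 : ℕ) : ℤ) - k) = ((-k).toNat : ℤ) by omega,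
      coeffZ_natCast, PowerSeries.coeff_one, if_neg (by omega), mul_zero]
  · simp
  · lift k to ℕ using hk.le
    rw [coeffZ_natCast, PowerSeries.coeff_one, if_neg (by omega), coeffZ_of_neg _ (by omega),
      mul_zero]

theorem SelfDual.eq_one (hs : SelfDual Q 0 s) (h0 : PowerSeries.coeff 0 s = 1) : s = 1 := by
  ext n
  rw [PowerSeries.coeff_one]
  split_ifs with hn
  · rw [hn, h0]
  · rw [← coeffZ_natCast, hs n, coeffZ_of_neg _ (by omega), mul_zero]

/-- The substitution `s(x) ↦ s(e x^d)`. -/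
def dilate (e : ℂ) {d : ℕ} (hd : d ≠ 0) : ℂ⟦X⟧ →+* ℂ⟦X⟧ :=
  (PowerSeries.expand d hd : ℂ⟦X⟧ →ₐ[ℂ] ℂ⟦X⟧).toRingHom.comp (PowerSeries.rescale e)

theorem coeff_dilate (e : ℂ) {d : ℕ} (hd : d ≠ 0) (s : ℂ⟦X⟧) (n : ℕ) :
    PowerSeries.coeff n (dilate e hd s) =
      if d ∣ n then e ^ (n / d) * PowerSeries.coeff (n / d) s else 0 := by
  change PowerSeries.coeff n (PowerSeries.expand d hd (PowerSeries.rescale e s)) = _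
  rw [PowerSeries.coeff_expand, PowerSeries.coeff_rescale]

theorem dilate_X (e : ℂ) {d : ℕ} (hd : d ≠ 0) :
    dilate e hd PowerSeries.X = PowerSeries.C e * PowerSeries.X ^ d := by
  change PowerSeries.expand d hd (PowerSeries.rescale e PowerSeries.X) = _
  rw [PowerSeries.rescale_X, map_mul, PowerSeries.expand_C, PowerSeries.expand_X]

theorem dilate_C (e : ℂ) {d : ℕ} (hd : d ≠ 0) (c : ℂ) :
    dilate e hd (PowerSeries.C c) = PowerSeries.C c := by
  change PowerSeries.expand d hd (PowerSeries.rescale e (PowerSeries.C c)) = _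
  have : PowerSeries.rescale e (PowerSeries.C c) = PowerSeries.C c := by
    ext n
    rw [PowerSeries.coeff_rescale, PowerSeries.coeff_C]
    split_ifs with h <;> simp [h]
  rw [this, PowerSeries.expand_C]

theorem dilate_polynomial (e : ℂ) {d : ℕ} (hd : d ≠ 0) (N : ℂ[X]) :
    dilate e hd (N : ℂ⟦X⟧) =
      (N.comp (Polynomial.C e * Polynomial.X ^ d) : ℂ[X]) := by
  induction N using Polynomial.induction_on' with
  | add p q hp hq => simp [hp, hq]
  | monomial n c =>
    rw [← Polynomial.C_mul_X_pow_eq_monomial]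
    simp [dilate_C, dilate_X]

theorem SelfDual.dilate {q e : ℂ} {d : ℕ} (hq : q ≠ 0) (he : e ^ 2 = 1) (hd : d ≠ 0)
    (hs : SelfDual (q ^ d) v s) : SelfDual q (d * v) (dilate e hd s) := by
  rw [selfDual_iff_polynomial (pow_ne_zero d hq)] at hs
  rw [selfDual_iff_polynomial hq]
  obtain ⟨N, rfl, hNd, hN⟩ := hs
  have he0 : e ≠ 0 := by rintro rfl; simp at he
  refine ⟨_, dilate_polynomial e hd N, ?_, fun x hx => ?_⟩
  · refine Polynomial.natDegree_comp_le.trans ?_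
    have : (Polynomial.C e * Polynomial.X ^ d : ℂ[X]).natDegree ≤ d :=
      (Polynomial.natDegree_C_mul_le _ _).trans (by simp)
    calc _ ≤ 2 * v * d := Nat.mul_le_mul hNd this
      _ = _ := by ring
  · have h1 := hN (e * x ^ d) (mul_ne_zero he0 (pow_ne_zero d hx))
    simp only [Polynomial.eval_comp, Polynomial.eval_mul, Polynomial.eval_C, Polynomial.eval_pow,
      Polynomial.eval_X]
    rw [← h1, mul_pow, pow_mul e, he, one_pow, one_mul]
    have h2 : e * (q * x)⁻¹ ^ d = (q ^ d * (e * x ^ d))⁻¹ := by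
      rw [eq_comm, inv_eq_iff_eq_inv, mul_inv, inv_pow, inv_inv, mul_pow]
      have : e⁻¹ = e := by
        rw [inv_eq_iff_eq_inv]
        exact eq_inv_of_mul_eq_one_left (by rw [← pow_two, he])
      rw [this]
      ring
    rw [h2]
    ring

/-- The factor `1 - Q x` when `n` is even, and `1` when `n` is odd: the denominator of a
one-variable series whose neighbouring exponents sum to `n`, with `Q = q` for the global series and
`Q = 1` for the local ones. -/
def evenFactor (Q : ℂ) (n : ℕ) : ℂ⟦X⟧ :=
  if Even n then 1 - PowerSeries.C Q * PowerSeries.X else 1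

/-- The factor by which the completed `L`-function of even degree exceeds the symmetric series. -/
theorem selfDual_one_sub_mul_one_sub (hQ : Q ≠ 0) :
    SelfDual Q 1 ((1 - PowerSeries.X) * (1 - PowerSeries.C Q * PowerSeries.X)) := by
  rw [selfDual_iff_polynomial hQ]
  refine ⟨(1 - Polynomial.X) * (1 - Polynomial.C Q * Polynomial.X), by simp, ?_, fun x hx => ?_⟩
  · compute_degree
  · simp only [Polynomial.eval_mul, Polynomial.eval_sub, Polynomial.eval_one, Polynomial.eval_X,
      Polynomial.eval_C]
    field_simp
    ring

end SelfDuality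

section LSeries

variable {F : Type} [Field F] [Finite F]

/-- The `L`-function of the residue symbol modulo `m`, as a power series in `q^{-s}`. -/
def symbolLSeries (m : F[X]) : ℂ⟦X⟧ :=
  PowerSeries.mk fun n => ∑ f ∈ monics F n, (residueSymbol m f : ℂ)

/-- The functional equation of the `L`-function of a squarefree modulus. For even degree the factor
`1 - q x` completes the trivial zero at `x = 1`, or removes the pole at `x = 1 / q` if `m = 1`. -/
theorem selfDual_symbolLSeries (hq : Nat.card F % 4 = 1) {m : F[X]} (hm : m.Monic)
    (hsq : Squarefree m) :
    SelfDual (Nat.card F) (m.natDegree / 2)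
      (evenFactor (Nat.card F) m.natDegree * symbolLSeries m) := by
  have := Fintype.ofFinite F
  have hq0 : (Nat.card F : ℂ) ≠ 0 := by
    have : Nat.card F ≠ 0 := by omega
    exact_mod_cast this
  have hcoeff : ∀ n, PowerSeries.coeff n (symbolLSeries m) = charSum m n := fun n => by
    rw [symbolLSeries, PowerSeries.coeff_mk, charSum]
  rcases Nat.even_or_odd' m.natDegree with ⟨h, hh | hh⟩
  · rw [evenFactor, if_pos (by rw [hh]; exact even_two_mul h), hh,
      Nat.mul_div_cancel_left h two_pos]
    rcases Nat.eq_zero_or_pos h with rfl | hpos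
    · have hm1 : m = 1 := hm.natDegree_eq_zero.1 hh
      have h1 : (1 - PowerSeries.C (Nat.card F : ℂ) * PowerSeries.X) * symbolLSeries m = 1 := by
        ext n
        rw [sub_mul, one_mul, map_sub, mul_assoc, PowerSeries.coeff_C_mul, hcoeff, hm1, charSum_one]
        cases n with
        | zero => simp
        | succ n =>
          rw [PowerSeries.coeff_succ_X_mul, ← hm1, hcoeff, hm1, charSum_one, PowerSeries.coeff_one]
          simp [pow_succ']
      rw [h1]
      exact SelfDual.one
    · have hd : 0 < m.natDegree := by omega
      -- the symmetry belongs to the sums over all polynomials of degree at most `n`, whose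
      -- generating series differs from the `L`-function by the factor `1 - x`
      set V : ℂ⟦X⟧ := PowerSeries.mk fun n => lowCharSum m (n + 1) with hV
      have h1 : (1 - PowerSeries.X) * V =
          PowerSeries.C ((Nat.card F : ℂ) - 1) * symbolLSeries m := by
        ext n
        rw [sub_mul, one_mul, map_sub, PowerSeries.coeff_C_mul, hcoeff]
        cases n with
        | zero =>
          have := lowCharSum_succ_even hq hm hh 0
          rw [lowCharSum_zero hm hd, zero_add, zero_add] at this
          simp only [hV, PowerSeries.coeff_mk, PowerSeries.coeff_zero_X_mul, sub_zero,
            zero_add]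
          exact this
        | succ n =>
          have := lowCharSum_succ_even hq hm hh (n + 1)
          rw [PowerSeries.coeff_succ_X_mul]
          simp only [hV, PowerSeries.coeff_mk]
          rw [this]
          ring
      have h2 : SelfDual (Nat.card F) (h - 1) V := by
        rw [selfDual_iff_coeff hq0]
        simp only [hV, PowerSeries.coeff_mk]
        refine ⟨fun k hk => ?_, fun k hk => lowCharSum_eq_zero hq hm hsq hd (by omega)⟩
        have := lowCharSum_functional hq hm hsq hh (k + 1)
        rw [show 2 * (h - 1) - k + 1 = 2 * h - (k + 1) by omega]
        refine mul_left_cancel₀ hq0 ?_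
        obtain ⟨g, rfl⟩ : ∃ g, h = g + 1 := ⟨h - 1, by omega⟩
        rw [Nat.add_sub_cancel]
        linear_combination this
      have h3 := (selfDual_one_sub_mul_one_sub hq0).mul hq0 h2
      have h4 : (1 - PowerSeries.C (Nat.card F : ℂ) * PowerSeries.X) * symbolLSeries m =
          PowerSeries.C (((Nat.card F : ℂ) - 1)⁻¹) *
            ((1 - PowerSeries.X) * (1 - PowerSeries.C (Nat.card F : ℂ) * PowerSeries.X) * V) := by
        have h5 : (1 - PowerSeries.X) * (1 - PowerSeries.C (Nat.card F : ℂ) * PowerSeries.X) * V =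
            PowerSeries.C ((Nat.card F : ℂ) - 1) *
              ((1 - PowerSeries.C (Nat.card F : ℂ) * PowerSeries.X) * symbolLSeries m) := by
          linear_combination (1 - PowerSeries.C (Nat.card F : ℂ) * PowerSeries.X) * h1
        have h6 : (Nat.card F : ℂ) - 1 ≠ 0 := by
          have := Finite.one_lt_card (α := F)
          rw [sub_ne_zero]
          exact_mod_cast this.ne'
        rw [h5, ← mul_assoc, ← map_mul, inv_mul_cancel₀ h6, map_one, one_mul]
      rw [h4, show h = 1 + (h - 1) by omega]
      exact h3.C_mul _
  · rw [evenFactor, if_neg (by rw [hh]; simp), one_mul, hh,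
      show (2 * h + 1) / 2 = h by omega, selfDual_iff_coeff hq0]
    simp only [hcoeff]
    exact ⟨fun k hk => charSum_functional hq hm hsq hh hk,
      fun k hk => charSum_eq_zero hq hm hsq (by omega) (by omega)⟩

theorem evenFactor_mul_symbolLSeries_of_degree_le_one (hq : Nat.card F % 4 = 1) {m : F[X]}
    (hm : m.Monic) (hsq : Squarefree m) (hd : m.natDegree ≤ 1) :
    evenFactor (Nat.card F) m.natDegree * symbolLSeries m = 1 := by
  have h := selfDual_symbolLSeries hq hm hsq
  rw [show m.natDegree / 2 = 0 by omega] at h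
  refine h.eq_one ?_
  have := Fintype.ofFinite F
  have h1 : PowerSeries.coeff 0 (symbolLSeries m) = 1 := by
    rw [symbolLSeries, PowerSeries.coeff_mk]
    exact charSum_zero hm
  have h2 : PowerSeries.coeff 0 (evenFactor (Nat.card F) m.natDegree) = 1 := by
    rw [evenFactor]
    split_ifs <;> simp
  rw [PowerSeries.coeff_zero_eq_constantCoeff_apply] at h1 h2 ⊢
  rw [map_mul, h1, h2, one_mul]

end LSeries

/-! ### Separating the powers of a prime -/

section PrimePart

variable {F : Type} [Field F]

theorem exists_eq_pow_mul_not_dvd {p f : F[X]} (hpm : p.Monic) (hp : Irreducible p)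
    (hf : f.Monic) : ∃ (n : ℕ) (g : F[X]), g.Monic ∧ ¬ p ∣ g ∧ f = p ^ n * g := by
  obtain ⟨g, hg, hd⟩ :=
    (FiniteMultiplicity.of_prime_left hp.prime hf.ne_zero).exists_eq_pow_mul_and_not_dvd
  refine ⟨_, g, ?_, hd, hg⟩
  rw [hg] at hf
  exact (hpm.pow _).of_mul_monic_left hf

theorem pow_mul_left_injective {p g g' : F[X]} (hp : p ≠ 0) (hg : ¬ p ∣ g)
    (hg' : ¬ p ∣ g') {n n' : ℕ} (h : p ^ n * g = p ^ n' * g') : n = n' ∧ g = g' := by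
  wlog hle : n ≤ n' generalizing n n' g g'
  · obtain ⟨h1, h2⟩ := this hg' hg h.symm (not_le.1 hle).le
    exact ⟨h1.symm, h2.symm⟩
  obtain ⟨k, rfl⟩ := Nat.exists_eq_add_of_le hle
  rw [pow_add, mul_assoc] at h
  have h1 := mul_left_cancel₀ (pow_ne_zero n hp) h
  cases k with
  | zero => exact ⟨rfl, by simpa using h1⟩
  | succ k => exact absurd ⟨p ^ k * g', by rw [h1]; ring⟩ hg

open Classical in
/-- If `Φ` is multiplicative along the `p`-part of its argument, its generating series over monic
polynomials factors. -/
theorem mk_sum_monics_eq_mul [Finite F] {p : F[X]} (hpm : p.Monic) (hp : Irreducible p)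
    {Φ Φ' : F[X] → ℂ} {α : ℕ → ℂ}
    (h : ∀ (k : ℕ) (g : F[X]), g.Monic → ¬ p ∣ g → Φ (p ^ k * g) = α k * Φ' g) :
    (PowerSeries.mk fun n => ∑ g ∈ monics F n, Φ g : ℂ⟦X⟧) =
      (PowerSeries.mk fun n => if p.natDegree ∣ n then α (n / p.natDegree) else 0) *
        PowerSeries.mk fun n => ∑ g ∈ (monics F n).filter (fun g => ¬ p ∣ g), Φ' g := by
  have hd : 0 < p.natDegree := hp.natDegree_pos
  ext n
  rw [PowerSeries.coeff_mul]
  simp only [PowerSeries.coeff_mk, ite_mul, zero_mul]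
  rw [← Finset.sum_filter]
  simp only [Finset.mul_sum]
  rw [Finset.sum_sigma']
  symm
  refine Finset.sum_bij (fun x _ => p ^ (x.1.1 / p.natDegree) * x.2) ?_ ?_ ?_ ?_
  · rintro ⟨⟨u, w⟩, g⟩ hx
    simp only [Finset.mem_sigma, Finset.mem_filter, Finset.HasAntidiagonal.mem_antidiagonal,
      mem_monics] at hx
    obtain ⟨⟨huv, hdvd⟩, ⟨hgm, hgd⟩, hpg⟩ := hx
    rw [mem_monics]
    refine ⟨(hpm.pow _).mul hgm, ?_⟩
    rw [(hpm.pow _).natDegree_mul hgm, hpm.natDegree_pow, Nat.div_mul_cancel hdvd, hgd, huv]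
  · rintro ⟨⟨u, w⟩, g⟩ hx ⟨⟨u', w'⟩, g'⟩ hx' hxx
    simp only [Finset.mem_sigma, Finset.mem_filter, Finset.HasAntidiagonal.mem_antidiagonal,
      mem_monics] at hx hx'
    obtain ⟨⟨huv, hdvd⟩, ⟨hgm, hgd⟩, hpg⟩ := hx
    obtain ⟨⟨huv', hdvd'⟩, ⟨hgm', hgd'⟩, hpg'⟩ := hx'
    obtain ⟨h1, h2⟩ := pow_mul_left_injective hp.ne_zero hpg hpg' hxx
    obtain ⟨k, rfl⟩ := hdvd
    obtain ⟨k', rfl⟩ := hdvd'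
    simp only at h1 h2
    rw [Nat.mul_div_cancel_left _ hd, Nat.mul_div_cancel_left _ hd] at h1
    subst h1 h2
    have : w = w' := by rw [← hgd, ← hgd']
    subst this
    rfl
  · intro f hf
    obtain ⟨hfm, hfd⟩ := mem_monics.1 hf
    obtain ⟨k, g, hgm, hpg, rfl⟩ := exists_eq_pow_mul_not_dvd hpm hp hfm
    refine ⟨⟨⟨p.natDegree * k, g.natDegree⟩, g⟩, ?_, ?_⟩
    · simp only [Finset.mem_sigma, Finset.mem_filter, Finset.HasAntidiagonal.mem_antidiagonal,
      mem_monics]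
      refine ⟨⟨?_, dvd_mul_right _ _⟩, ⟨hgm, trivial⟩, hpg⟩
      rw [← hfd, (hpm.pow _).natDegree_mul hgm, hpm.natDegree_pow, mul_comm]
    · simp [Nat.mul_div_cancel_left _ hd]
  · rintro ⟨⟨u, w⟩, g⟩ hx
    simp only [Finset.mem_sigma, Finset.mem_filter, Finset.HasAntidiagonal.mem_antidiagonal,
      mem_monics] at hx
    exact (h _ g hx.2.1.1 hx.2.2).symm

end PrimePart

/-! ### Weights twisted by a quadratic character -/

section Twisted

variable {V : Type*} [Fintype V] [DecidableEq V] {Γ : SimpleGraph V} [DecidableRel Γ.Adj]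

/-- Isolating the contribution of the vertex `i` to a product over ordered pairs of adjacent
vertices. -/
theorem prod_prod_neighborFinset_update (i : V) (b : V → ℕ) (hb : b i = 0) (w : V → ℂ)
    (hw : w i = 1) (k : ℕ) (y : ℂ) :
    ∏ i', ∏ j ∈ Γ.neighborFinset i', Function.update w i y j ^ Function.update b i k i' =
      (∏ i', ∏ j ∈ Γ.neighborFinset i', w j ^ b i') * (∏ j ∈ Γ.neighborFinset i, w j) ^ k *
        y ^ nbrSum Γ i b := by
  have h1 : ∀ i', ∀ j ∈ Γ.neighborFinset i',
      Function.update w i y j ^ Function.update b i k i' =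
        w j ^ b i' * (if i' = i then w j ^ k else 1) * (if j = i then y ^ b i' else 1) := by
    intro i' j hj
    rw [SimpleGraph.mem_neighborFinset] at hj
    by_cases hi : i' = i
    · subst hi
      rw [Function.update_of_ne hj.ne', Function.update_self, if_pos rfl, if_neg hj.ne', hb]
      simp
    · rw [Function.update_of_ne hi, if_neg hi]
      by_cases hji : j = i
      · subst hji
        rw [Function.update_self, if_pos rfl, hw]
        simp
      · rw [Function.update_of_ne hji, if_neg hji]
        simp
  have h2 : ∏ i', ∏ j ∈ Γ.neighborFinset i', (if i' = i then w j ^ k else 1) =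
      (∏ j ∈ Γ.neighborFinset i, w j) ^ k := by
    rw [Finset.prod_eq_single i]
    · simp [Finset.prod_pow]
    · intro i' _ hi
      simp [hi]
    · simp
  have h3 : ∏ i', ∏ j ∈ Γ.neighborFinset i', (if j = i then y ^ b i' else 1) =
      y ^ nbrSum Γ i b := by
    have h4 : ∀ i', ∏ j ∈ Γ.neighborFinset i', (if j = i then y ^ b i' else 1) =
        if i' ∈ Γ.neighborFinset i then y ^ b i' else 1 := by
      intro i'
      rw [Finset.prod_ite_eq']
      simp only [SimpleGraph.mem_neighborFinset, Γ.adj_comm]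
    rw [Finset.prod_congr rfl fun i' _ => h4 i', Finset.prod_ite_mem, Finset.univ_inter,
      Finset.prod_pow_eq_pow_sum, nbrSum]
  rw [Finset.prod_congr rfl fun i' _ => Finset.prod_congr rfl (h1 i')]
  simp only [Finset.prod_mul_distrib]
  rw [h2, h3]

/-- The series `∑_g H(f_1, …, g, …, f_{n+1}) χ_e(g) x^{deg g}` over monic `g` in position `i`. -/
def twistedSeries (H : Weights V) {F : Type} [Field F] [Finite F] (i : V) (f : V → F[X])
    (e : F[X]) : ℂ⟦X⟧ :=
  PowerSeries.mk fun n =>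
    ∑ g ∈ monics F n, H F (Function.update f i g) * (residueSymbol e g : ℂ)

variable {H : Weights V} {C P : (V → ℕ) → ℂ[X]} {F : Type} [Field F] [Finite F]

theorem twistedSeries_one (hax : FourAxioms Γ H C P) (hq : Nat.card F % 4 = 1) (i : V)
    (e : F[X]) : twistedSeries H i (fun _ => 1) e = symbolLSeries e := by
  ext n
  simp only [twistedSeries, symbolLSeries, PowerSeries.coeff_mk]
  refine Finset.sum_congr rfl fun g hg => ?_
  rw [hax.initial F hq i g (mem_monics.1 hg).1, one_mul]

/-- Twisted multiplicativity, for the separation of the powers of a prime `p`. -/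
theorem weight_primePart (hax : FourAxioms Γ H C P) (hq : Nat.card F % 4 = 1) {p : F[X]}
    (hpm : p.Monic) (hp : Irreducible p) (i : V) {b : V → ℕ} (hb : b i = 0) {f : V → F[X]}
    (hf : ∀ j, (f j).Monic) (hfi : f i = 1) (hpf : ∀ j, ¬ p ∣ f j) (k : ℕ) {g : F[X]}
    (hg : g.Monic) (hpg : ¬ p ∣ g) :
    H F (Function.update (fun j => p ^ b j * f j) i (p ^ k * g)) =
      (∏ i', ∏ j ∈ Γ.neighborFinset i', (quadChar p (f j) : ℂ) ^ b i') *
        (quadChar p (∏ j ∈ Γ.neighborFinset i, f j) : ℂ) ^ k *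
        localWeight H F p (Function.update b i k) *
        (H F (Function.update f i g) * (quadChar p g : ℂ) ^ nbrSum Γ i b) := by
  have hf' : ∀ j, (Function.update f i g j).Monic := by
    intro j
    by_cases hj : j = i
    · subst hj; rwa [Function.update_self]
    · rw [Function.update_of_ne hj]; exact hf j
  have hpf' : ∀ j, ¬ p ∣ Function.update f i g j := by
    intro j
    by_cases hj : j = i
    · subst hj; rwa [Function.update_self]
    · rw [Function.update_of_ne hj]; exact hpf j
  have h1 := hax.twisted_mul F hq (fun j => p ^ Function.update b i k j) (Function.update f i g)
    (fun j => hpm.pow _) hf' (IsCoprime.prod_left fun j _ => IsCoprime.prod_right fun j' _ =>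
      IsCoprime.pow_left ((hp.coprime_iff_not_dvd).2 (hpf' j')))
  have h2 : (fun j => p ^ Function.update b i k j * Function.update f i g j) =
      Function.update (fun j => p ^ b j * f j) i (p ^ k * g) := by
    funext j
    by_cases hj : j = i
    · subst hj; simp
    · simp [hj]
  have hχ : ∀ g : F[X], ∀ n : ℕ,
      (residueSymbol (p ^ n) g : ℂ) = (quadChar p g : ℂ) ^ n := by
    intro g n
    rw [residueSymbol_pow_left, residueSymbol_prime hpm hp, Int.cast_pow]
  have hupd : ∀ j, (quadChar p (Function.update f i g j) : ℂ) =
      Function.update (fun j => (quadChar p (f j) : ℂ)) i (quadChar p g : ℂ) j := by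
    intro j
    by_cases hj : j = i
    · subst hj; simp
    · simp [hj]
  have hprod : ∏ j ∈ Γ.neighborFinset i, (quadChar p (f j) : ℂ) =
      quadChar p (∏ j ∈ Γ.neighborFinset i, f j) := by
    induction Γ.neighborFinset i using Finset.induction_on with
    | empty => simp [quadChar_one hp]
    | insert j t hj ih =>
      rw [Finset.prod_insert hj, Finset.prod_insert hj, quadChar_mul hpm hp, ih, Int.cast_mul]
  rw [h2] at h1
  simp only [hχ, hupd] at h1
  rw [prod_prod_neighborFinset_update i b hb (fun j => (quadChar p (f j) : ℂ))
    (by simp only [hfi, quadChar_one hp, Int.cast_one]), hprod] at h1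
  rw [h1, localWeight]
  ring

/-- At the zero exponents the local series is the geometric series. -/
theorem one_sub_X_mul_slice_zero (hax : FourAxioms Γ H C P) (hq : Nat.card F % 4 = 1) {p : F[X]}
    (hpm : p.Monic) (i : V) :
    (1 - PowerSeries.X) * slice (localWeight H F p) i (fun _ => 0) = 1 := by
  have h1 : ∀ n, PowerSeries.coeff n (slice (localWeight H F p) i (fun _ => 0)) = 1 := by
    intro n
    rw [slice, PowerSeries.coeff_mk, localWeight, ← hax.initial F hq i (p ^ n) (hpm.pow n)]
    congr 1
    funext j
    by_cases hj : j = i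
    · subst hj; simp
    · simp [hj]
  ext n
  rw [sub_mul, one_mul, map_sub, h1]
  cases n with
  | zero => simp
  | succ n => rw [PowerSeries.coeff_succ_X_mul, h1]; simp [PowerSeries.coeff_one]

/-- Removing from `f` the powers of a prime `p`. If the exponent `A` at `p` of the product of the
neighbours of `i` is even, the local series keeps the Euler factor of the `L`-function at `p`;
if `A` is odd, `p` enters the modulus of the character. -/
theorem twistedSeries_primePart (hax : FourAxioms Γ H C P) (hq : Nat.card F % 4 = 1) {p : F[X]}
    (hpm : p.Monic) (hp : Irreducible p) (i : V) {b : V → ℕ} (hb : b i = 0) {f : V → F[X]}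
    (hf : ∀ j, (f j).Monic) (hfi : f i = 1) (hpf : ∀ j, ¬ p ∣ f j) {e : F[X]} (he : e.Monic) :
    twistedSeries H i (fun j => p ^ b j * f j) e =
      PowerSeries.C (∏ i', ∏ j ∈ Γ.neighborFinset i', (quadChar p (f j) : ℂ) ^ b i') *
        dilate (quadChar p (∏ j ∈ Γ.neighborFinset i, f j) * residueSymbol e p)
          hp.natDegree_pos.ne'
          (evenFactor 1 (nbrSum Γ i b) * slice (localWeight H F p) i b) *
        twistedSeries H i f (if Even (nbrSum Γ i b) then e else p * e) := by
  classical
  have hd := hp.natDegree_pos.ne'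
  set K : ℂ := ∏ i', ∏ j ∈ Γ.neighborFinset i', (quadChar p (f j) : ℂ) ^ b i'
  set ε : ℂ := quadChar p (∏ j ∈ Γ.neighborFinset i, f j) * residueSymbol e p with hε
  -- the general factorization, used for `b` and for the zero exponents
  have key : ∀ b : V → ℕ, b i = 0 →
      twistedSeries H i (fun j => p ^ b j * f j) e =
        PowerSeries.C (∏ i', ∏ j ∈ Γ.neighborFinset i', (quadChar p (f j) : ℂ) ^ b i') *
        dilate ε hd (slice (localWeight H F p) i b) *
        PowerSeries.mk fun n => ∑ g ∈ (monics F n).filter (fun g => ¬ p ∣ g),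
          H F (Function.update f i g) * (quadChar p g : ℂ) ^ nbrSum Γ i b *
            (residueSymbol e g : ℂ) := by
    intro b hb
    rw [twistedSeries, mk_sum_monics_eq_mul hpm hp
      (Φ' := fun g => H F (Function.update f i g) * (quadChar p g : ℂ) ^ nbrSum Γ i b *
        (residueSymbol e g : ℂ))
      (α := fun k => (∏ i', ∏ j ∈ Γ.neighborFinset i', (quadChar p (f j) : ℂ) ^ b i') *
        (ε ^ k * localWeight H F p (Function.update b i k)))]
    · congr 1
      ext n
      rw [PowerSeries.coeff_C_mul, coeff_dilate, PowerSeries.coeff_mk, slice, PowerSeries.coeff_mk,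
        mul_ite, mul_zero]
    · intro k g hg hpg
      rw [weight_primePart hax hq hpm hp i hb hf hfi hpf k hg hpg, residueSymbol_mul_right he,
        residueSymbol_pow_right he, hε, mul_pow]
      push_cast
      ring
  have h0 : (1 - PowerSeries.C ε * PowerSeries.X ^ p.natDegree) * twistedSeries H i f e =
      PowerSeries.mk fun n => ∑ g ∈ (monics F n).filter (fun g => ¬ p ∣ g),
          H F (Function.update f i g) * (residueSymbol e g : ℂ) := by
    have h1 := key (fun _ => 0) rfl
    simp only [pow_zero, one_mul, Finset.prod_const_one, map_one, nbrSum, Finset.sum_const_zero,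
      mul_one] at h1
    have h4 := congrArg (dilate ε hd) (one_sub_X_mul_slice_zero hax hq hpm i)
    rw [map_mul, map_sub, map_one, dilate_X] at h4
    rw [h1, ← mul_assoc, h4, one_mul]
  rw [key b hb]
  by_cases hA : Even (nbrSum Γ i b)
  · rw [if_pos hA, evenFactor, if_pos hA, map_mul, map_sub, map_one, map_one, one_mul, dilate_X]
    have h1 : (PowerSeries.mk fun n => ∑ g ∈ (monics F n).filter (fun g => ¬ p ∣ g),
          H F (Function.update f i g) * (quadChar p g : ℂ) ^ nbrSum Γ i b *
            (residueSymbol e g : ℂ)) =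
        PowerSeries.mk fun n => ∑ g ∈ (monics F n).filter (fun g => ¬ p ∣ g),
          H F (Function.update f i g) * (residueSymbol e g : ℂ) := by
      ext n
      simp only [PowerSeries.coeff_mk]
      refine Finset.sum_congr rfl fun g hg => ?_
      obtain ⟨c, hc⟩ := hA
      have h2 : (quadChar p g : ℂ) ^ 2 = 1 := by
        exact_mod_cast quadChar_sq_eq_one (Finset.mem_filter.1 hg).2
      rw [hc, ← two_mul, pow_mul, h2, one_pow, mul_one]
    rw [h1, ← h0]
    ring
  · rw [if_neg hA, evenFactor, if_neg hA, one_mul]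
    congr 1
    ext n
    simp only [twistedSeries, PowerSeries.coeff_mk]
    rw [← Finset.sum_filter_add_sum_filter_not (monics F n) (fun g => ¬ p ∣ g)
      (fun g => H F (Function.update f i g) * (residueSymbol (p * e) g : ℂ))]
    have h2 : ∑ g ∈ (monics F n).filter (fun g => ¬ ¬ p ∣ g),
        H F (Function.update f i g) * (residueSymbol (p * e) g : ℂ) = 0 := by
      refine Finset.sum_eq_zero fun g hg => ?_
      rw [residueSymbol_eq_zero hpm hp (hpm.mul he) (dvd_mul_right p e)
        (not_not.1 (Finset.mem_filter.1 hg).2), Int.cast_zero, mul_zero]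
    rw [h2, add_zero]
    refine Finset.sum_congr rfl fun g hg => ?_
    obtain ⟨c, hc⟩ := Nat.not_even_iff_odd.1 hA
    have h3 : (quadChar p g : ℂ) ^ 2 = 1 := by
      exact_mod_cast quadChar_sq_eq_one (Finset.mem_filter.1 hg).2
    rw [hc, pow_succ, pow_mul, h3, one_pow, one_mul, residueSymbol_mul_left hp.ne_zero he.ne_zero,
      residueSymbol_prime hpm hp]
    push_cast
    ring

/-- The functional equation of `twistedSeries`, from the local ones at the primes dividing `f`: the
primes are removed one by one, until the `L`-function of a squarefree modulus is left. -/
theorem selfDual_twistedSeries (hax : FourAxioms Γ H C P) (hq : Nat.card F % 4 = 1) (i : V)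
    {f : V → F[X]} (hf : ∀ j, (f j).Monic) (hfi : f i = 1)
    (hloc : ∀ (p : F[X]), p.Monic → Irreducible p → ∀ (b : V → ℕ) (g : V → F[X]),
      (∀ j, f j = p ^ b j * g j) → (∀ j, ¬ p ∣ g j) → (∃ j, b j ≠ 0) →
      SelfDual ((Nat.card F : ℂ) ^ p.natDegree) (nbrSum Γ i b / 2)
        (evenFactor 1 (nbrSum Γ i b) * slice (localWeight H F p) i b))
    {e : F[X]} (he : e.Monic) (hsq : Squarefree e) (hef : ∀ j, IsCoprime e (f j)) :
    SelfDual (Nat.card F) ((nbrSum Γ i (fun j => (f j).natDegree) + e.natDegree) / 2)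
      (evenFactor (Nat.card F) (nbrSum Γ i (fun j => (f j).natDegree) + e.natDegree) *
        twistedSeries H i f e) := by
  have hq0 : (Nat.card F : ℂ) ≠ 0 := by
    have : Nat.card F ≠ 0 := by omega
    exact_mod_cast this
  induction hn : ∑ j, (f j).natDegree using Nat.strong_induction_on generalizing f e with
  | _ n ih =>
    by_cases hall : ∀ j, f j = 1
    · have : f = fun _ => 1 := funext hall
      subst this
      simpa [nbrSum, twistedSeries_one hax hq] using selfDual_symbolLSeries hq he hsq
    push Not at hall
    obtain ⟨j₀, hj₀⟩ := hall
    obtain ⟨p, hpm, hp, hpd⟩ := Polynomial.exists_monic_irreducible_factor (f j₀)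
      (fun hu => hj₀ ((hf j₀).eq_one_of_isUnit hu))
    choose b g hgm hpg hfg using fun j => exists_eq_pow_mul_not_dvd hpm hp (hf j)
    have hbi : b i = 0 := by
      by_contra hb
      have h1 : p ∣ 1 := by
        rw [← hfi, hfg i]
        exact (dvd_pow_self p hb).mul_right _
      exact hp.not_isUnit (isUnit_of_dvd_one h1)
    have hgi : g i = 1 := by
      have := hfg i
      rw [hbi, pow_zero, one_mul, hfi] at this
      exact this.symm
    have hbj : b j₀ ≠ 0 := by
      intro h0
      have := hfg j₀
      rw [h0, pow_zero, one_mul] at this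
      exact hpg j₀ (this ▸ hpd)
    have hfe : f = fun j => p ^ b j * g j := funext hfg
    have hdeg : ∀ j, (f j).natDegree = p.natDegree * b j + (g j).natDegree := by
      intro j
      rw [hfg j, (hpm.pow _).natDegree_mul (hgm j), hpm.natDegree_pow, mul_comm]
    have hpe : ¬ p ∣ e := fun h => hp.not_isUnit ((hef j₀).isUnit_of_dvd' h hpd)
    set A := nbrSum Γ i b with hA
    set B := nbrSum Γ i (fun j => (g j).natDegree) with hB
    have hAB : nbrSum Γ i (fun j => (f j).natDegree) = p.natDegree * A + B := by
      rw [hA, hB, nbrSum, nbrSum, nbrSum, Finset.mul_sum, ← Finset.sum_add_distrib]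
      exact Finset.sum_congr rfl fun j _ => hdeg j
    have hlocp := hloc p hpm hp b g hfg hpg ⟨j₀, hbj⟩
    have hlt : ∑ j, (g j).natDegree < n := by
      rw [← hn]
      refine Finset.sum_lt_sum (fun j _ => by rw [hdeg j]; omega) ⟨j₀, Finset.mem_univ _, ?_⟩
      rw [hdeg j₀]
      have := Nat.mul_pos hp.natDegree_pos (Nat.pos_of_ne_zero hbj)
      omega
    have hlocg : ∀ (r : F[X]), r.Monic → Irreducible r → ∀ (c : V → ℕ) (u : V → F[X]),
        (∀ j, g j = r ^ c j * u j) → (∀ j, ¬ r ∣ u j) → (∃ j, c j ≠ 0) →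
        SelfDual ((Nat.card F : ℂ) ^ r.natDegree) (nbrSum Γ i c / 2)
          (evenFactor 1 (nbrSum Γ i c) * slice (localWeight H F r) i c) := by
      rintro r hrm hr c u hgu hru ⟨j₁, hj₁⟩
      have hrp : ¬ r ∣ p := by
        intro h
        have h1 : r = p := Polynomial.eq_of_monic_of_associated hrm hpm (hr.associated_of_dvd hp h)
        refine hpg j₁ ?_
        rw [hgu j₁, ← h1]
        exact (dvd_pow_self r hj₁).mul_right _
      refine hloc r hrm hr c (fun j => p ^ b j * u j) (fun j => ?_) (fun j h => ?_) ⟨j₁, hj₁⟩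
      · rw [hfg j, hgu j]; ring
      · rcases hr.prime.dvd_or_dvd h with h | h
        · exact hrp (hr.prime.dvd_of_dvd_pow h)
        · exact hru j h
    have hε : ((quadChar p (∏ j ∈ Γ.neighborFinset i, g j) : ℂ) * residueSymbol e p) ^ 2 = 1 := by
      have h1 : ¬ p ∣ ∏ j ∈ Γ.neighborFinset i, g j := by
        rw [hp.prime.dvd_finsetProd_iff]
        rintro ⟨j, -, hj⟩
        exact hpg j hj
      have h2 := quadChar_sq_eq_one h1
      have h3 := residueSymbol_sq_eq_one he ((hp.coprime_iff_not_dvd).2 hpe).symm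
      rw [mul_pow]
      exact_mod_cast by rw [h2, h3, one_mul]
    have hdil := hlocp.dilate hq0 hε hp.natDegree_pos.ne'
    have hge : ∀ j, IsCoprime e (g j) := fun j =>
      (hef j).of_isCoprime_of_dvd_right ⟨p ^ b j, by rw [hfg j, mul_comm]⟩
    rw [hAB]
    have hfs := twistedSeries_primePart hax hq hpm hp i hbi hgm hgi hpg he
    rw [← hfe] at hfs
    rw [hfs]
    by_cases hAe : Even A
    · rw [if_pos hAe]
      have h1 := ih _ hlt hgm hgi hlocg he hsq hge rfl
      have h2 := ((hdil.mul hq0 h1).C_mul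
        (∏ i', ∏ j ∈ Γ.neighborFinset i', (quadChar p (g j) : ℂ) ^ b i'))
      obtain ⟨c, hc⟩ := hAe
      have h3 : evenFactor (Nat.card F) (p.natDegree * A + B + e.natDegree) =
          evenFactor (Nat.card F) (B + e.natDegree) := by
        have : Even (p.natDegree * A + B + e.natDegree) ↔ Even (B + e.natDegree) := by
          rw [add_assoc, Nat.even_add]
          simp [hc]
        simp only [evenFactor, this]
      have h4 : (p.natDegree * A + B + e.natDegree) / 2 =
          p.natDegree * (A / 2) + (B + e.natDegree) / 2 := by
        have : p.natDegree * A = 2 * (p.natDegree * (A / 2)) := by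
          rw [hc, ← two_mul, Nat.mul_div_cancel_left c two_pos]; ring
        omega
      rw [h3, h4]
      convert h2 using 1
      ring
    · rw [if_neg hAe]
      have hpe' : IsCoprime p e := (hp.coprime_iff_not_dvd).2 hpe
      have h1 := ih _ hlt hgm hgi hlocg (hpm.mul he)
        ((squarefree_mul_iff).2 ⟨hpe'.isRelPrime, hp.squarefree, hsq⟩)
        (fun j => ((hp.coprime_iff_not_dvd).2 (hpg j)).mul_left (hge j)) rfl
      have h2 := ((hdil.mul hq0 h1).C_mul
        (∏ i', ∏ j ∈ Γ.neighborFinset i', (quadChar p (g j) : ℂ) ^ b i'))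
      obtain ⟨c, hc⟩ := Nat.not_even_iff_odd.1 hAe
      rw [hpm.natDegree_mul he] at h2
      have h3 : evenFactor (Nat.card F) (p.natDegree * A + B + e.natDegree) =
          evenFactor (Nat.card F) (B + (p.natDegree + e.natDegree)) := by
        have : Even (p.natDegree * A + B + e.natDegree) ↔
            Even (B + (p.natDegree + e.natDegree)) := by
          have h5 : p.natDegree * A + B + e.natDegree =
              2 * (p.natDegree * c) + (B + (p.natDegree + e.natDegree)) := by rw [hc]; ring
          rw [h5, Nat.even_add]
          simp
        simp only [evenFactor, this]
      have h4 : (p.natDegree * A + B + e.natDegree) / 2 =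
          p.natDegree * (A / 2) + (B + (p.natDegree + e.natDegree)) / 2 := by
        have h5 : A / 2 = c := by omega
        have : p.natDegree * A = 2 * (p.natDegree * (A / 2)) + p.natDegree := by
          rw [h5, hc]; ring
        omega
      rw [h3, h4]
      convert h2 using 1
      ring

end Twisted

/-! ### Separation of degrees -/

section PolynomialIdentities

/-- There are infinitely many finite fields with `q ≡ 1 mod 4`, so a polynomial in `q` is determined
by its values. -/
theorem eq_of_eval_card_eq {f g : ℂ[X]}
    (h : ∀ (F : Type) [Field F] [Finite F], Nat.card F % 4 = 1 →
      f.eval (Nat.card F : ℂ) = g.eval (Nat.card F : ℂ)) : f = g := by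
  have : Fact (Nat.Prime 5) := ⟨by norm_num⟩
  refine Polynomial.eq_of_infinite_eval_eq f g
    ((Set.infinite_range_of_injective (f := fun n : ℕ => ((5 ^ (n + 1) : ℕ) : ℂ)) ?_).mono ?_)
  · intro m n hmn
    have : 5 ^ (m + 1) = 5 ^ (n + 1) := Nat.cast_injective (R := ℂ) hmn
    have := Nat.pow_right_injective (le_refl 2 |>.trans (by norm_num : 2 ≤ 5)) this
    omega
  · rintro _ ⟨n, rfl⟩
    have hc : Nat.card (GaloisField 5 (n + 1)) = 5 ^ (n + 1) :=
      GaloisField.card 5 (n + 1) (by omega)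
    have h4 : 5 ^ (n + 1) % 4 = 1 := by rw [Nat.pow_mod]; simp
    have := h (GaloisField 5 (n + 1)) (by rw [hc, h4])
    rwa [hc] at this

/-- The coefficients of `evenFactor w A * ∑_k U_k x^k`. -/
def evenDiff (w : ℂ[X]) (A : ℕ) (U : ℕ → ℂ[X]) : ℕ → ℂ[X]
  | 0 => U 0
  | k + 1 => if Even A then U (k + 1) - w * U k else U (k + 1)

theorem coeff_evenFactor_mul {w : ℂ[X]} {A : ℕ} {U : ℕ → ℂ[X]} {x : ℂ} {s : ℂ⟦X⟧}
    (hs : ∀ k, PowerSeries.coeff k s = (U k).eval x) (k : ℕ) :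
    PowerSeries.coeff k (evenFactor (w.eval x) A * s) = (evenDiff w A U k).eval x := by
  unfold evenFactor
  by_cases hA : Even A
  · rw [if_pos hA, sub_mul, one_mul, map_sub, mul_assoc, PowerSeries.coeff_C_mul]
    cases k with
    | zero => simp [evenDiff, hs]
    | succ k => simp [evenDiff, hA, PowerSeries.coeff_succ_X_mul, hs]
  · rw [if_neg hA, one_mul, hs]
    cases k <;> simp [evenDiff, hA]

theorem evenDiff_coeff_ne_zero {w : ℂ[X]} {A : ℕ} {U : ℕ → ℂ[X]} {k m : ℕ}
    (h : (evenDiff w A U k).coeff m ≠ 0) :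
    (U k).coeff m ≠ 0 ∨ ∃ l, k = l + 1 ∧ (w * U l).coeff m ≠ 0 := by
  cases k with
  | zero => exact Or.inl h
  | succ k =>
    by_contra! hcon
    refine h ?_
    rw [evenDiff]
    split_ifs
    · rw [Polynomial.coeff_sub, hcon.1, hcon.2 k rfl, sub_zero]
    · exact hcon.1

/-- Two pieces of a polynomial identity which live in disjoint ranges of degrees, above and below
the bound `N / 2`, satisfy it separately. -/
theorem X_pow_mul_eq_of_separated {N u v : ℕ} {g g' h h' : ℂ[X]}
    (hg : ∀ m, g.coeff m ≠ 0 → N < 2 * (m + u)) (hg' : ∀ m, g'.coeff m ≠ 0 → N < 2 * (m + v))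
    (hh : ∀ m, h.coeff m ≠ 0 → 2 * (m + 1 + u) < N)
    (hh' : ∀ m, h'.coeff m ≠ 0 → 2 * (m + 1 + v) < N)
    (heq : Polynomial.X ^ u * (g - Polynomial.X * h) =
      Polynomial.X ^ v * (g' - Polynomial.X * h')) :
    Polynomial.X ^ u * h = Polynomial.X ^ v * h' := by
  have hzero : ∀ (w : ℕ) (f : ℂ[X]) (n : ℕ), (∀ m, n = m + w → f.coeff m = 0) →
      (Polynomial.X ^ w * f).coeff n = 0 := by
    intro w f n hf
    rw [Polynomial.coeff_X_pow_mul']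
    split_ifs with hw
    · exact hf (n - w) (by omega)
    · rfl
  ext n
  have h1 := congrArg (fun f => Polynomial.coeff f (n + 1)) heq
  have h2 : ∀ (w : ℕ) (a b : ℂ[X]), (Polynomial.X ^ w * (a - Polynomial.X * b)).coeff (n + 1) =
      (Polynomial.X ^ w * a).coeff (n + 1) - (Polynomial.X ^ w * b).coeff n := by
    intro w a b
    rw [mul_sub, Polynomial.coeff_sub, mul_left_comm, Polynomial.coeff_X_mul]
  simp only [h2] at h1
  by_cases hn : 2 * (n + 1) < N
  · rw [hzero u g, hzero v g'] at h1
    · linear_combination -h1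
    · intro m hm
      by_contra hne
      have := hg' m hne
      omega
    · intro m hm
      by_contra hne
      have := hg m hne
      omega
  · rw [hzero u h, hzero v h']
    · intro m hm
      by_contra hne
      have := hh' m hne
      omega
    · intro m hm
      by_contra hne
      have := hh m hne
      omega

end PolynomialIdentities

/-! ### Consequences of the axioms -/

section AxiomConsequences

variable {V : Type*} [Fintype V] [DecidableEq V] {Γ : SimpleGraph V} [DecidableRel Γ.Adj]
  {H : Weights V} {C P : (V → ℕ) → ℂ[X]}

theorem localWeight_degree_one (hax : FourAxioms Γ H C P) {F : Type} [Field F] [Finite F]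
    (hq : Nat.card F % 4 = 1) (c : F) (a : V → ℕ) :
    localWeight H F (Polynomial.X - Polynomial.C c) a = (P a).eval (Nat.card F : ℂ) := by
  rw [hax.local_poly F hq _ (Polynomial.monic_X_sub_C c) (Polynomial.irreducible_X_sub_C c),
    Polynomial.natDegree_X_sub_C, pow_one]

/-- The local polynomials are the reversed global ones. -/
theorem FourAxioms.eq_reflect (hax : FourAxioms Γ H C P) (a : V → ℕ) :
    P a = (C a).reflect (∑ j, a j) := by
  refine eq_of_eval_card_eq fun F _ _ hq => ?_
  have hq0 : (Nat.card F : ℂ) ≠ 0 := by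
    have : Nat.card F ≠ 0 := by omega
    exact_mod_cast this
  rw [eval_reflect (hax.natDegree_global a) hq0, ← localWeight_degree_one hax hq 0,
    ← hax.local_global F hq _ (Polynomial.monic_X_sub_C 0) (Polynomial.irreducible_X_sub_C 0),
    Polynomial.natDegree_X_sub_C, mul_one, pow_one]

/-- The local polynomial at the exponents which dominance leaves out. -/
theorem FourAxioms.single_eq_one (hax : FourAxioms Γ H C P) (j : V) : P (Pi.single j 1) = 1 := by
  refine eq_of_eval_card_eq fun F _ _ hq => ?_
  rw [Polynomial.eval_one, ← localWeight_degree_one hax hq 0, localWeight,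
    ← hax.initial F hq j _ (Polynomial.monic_X_sub_C 0)]
  congr 1
  funext j'
  by_cases hj : j' = j
  · subst hj; simp
  · simp [hj]

theorem FourAxioms.local_coeff_ne_zero (hax : FourAxioms Γ H C P) {a : V → ℕ}
    (ha : 1 ≤ ∑ j, a j) {m : ℕ} (hm : (P a).coeff m ≠ 0) :
    2 * m + 1 < ∑ j, a j ∨ (∑ j, a j = 1 ∧ m = 0) := by
  by_cases hs : ∃ j, a = Pi.single j 1
  · obtain ⟨j, rfl⟩ := hs
    right
    rw [hax.single_eq_one, Polynomial.coeff_one] at hm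
    refine ⟨by simp, ?_⟩
    by_contra h0
    exact hm (if_neg h0)
  · left
    push Not at hs
    have h0 : a ≠ 0 := by
      rintro rfl
      simp at ha
    have h1 := hax.dominance a h0 hs
    have h2 := Polynomial.le_natDegree_of_ne_zero hm
    omega

theorem FourAxioms.global_coeff_ne_zero (hax : FourAxioms Γ H C P) {a : V → ℕ}
    (ha : 1 ≤ ∑ j, a j) {m : ℕ} (hm : (C a).coeff m ≠ 0) :
    ∑ j, a j + 1 < 2 * m ∨ (∑ j, a j = 1 ∧ m = 1) := by
  have h1 : m ≤ ∑ j, a j := (Polynomial.le_natDegree_of_ne_zero hm).trans (hax.natDegree_global a)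
  have h2 : (P a).coeff (∑ j, a j - m) = (C a).coeff m := by
    rw [hax.eq_reflect, Polynomial.coeff_reflect, Polynomial.revAt_le (Nat.sub_le _ _),
      Nat.sub_sub_self h1]
  have h3 := hax.local_coeff_ne_zero ha (h2 ▸ hm)
  omega

theorem sum_update_of_eq_zero {i : V} {a : V → ℕ} (ha : a i = 0) (k : ℕ) :
    ∑ j, Function.update a i k j = k + ∑ j, a j := by
  rw [Finset.sum_update_of_mem (Finset.mem_univ i),
    ← Finset.add_sum_erase Finset.univ a (Finset.mem_univ i), ha, zero_add,
    Finset.erase_eq]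

theorem nbrSum_le_sum {V : Type*} [Fintype V] {Γ : SimpleGraph V} [DecidableRel Γ.Adj] {i : V}
    (a : V → ℕ) : nbrSum Γ i a ≤ ∑ j, a j :=
  Finset.sum_le_sum_of_subset (Finset.subset_univ _)

theorem coeff_evenFactor_mul_slice_local (hax : FourAxioms Γ H C P) {F : Type} [Field F] [Finite F]
    (hq : Nat.card F % 4 = 1) {p : F[X]} (hpm : p.Monic) (hp : Irreducible p) (i : V)
    (a : V → ℕ) (A k : ℕ) :
    PowerSeries.coeff k (evenFactor 1 A * slice (localWeight H F p) i a) =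
      (evenDiff 1 A (fun k => P (Function.update a i k)) k).eval
        ((Nat.card F : ℂ) ^ p.natDegree) := by
  have := coeff_evenFactor_mul (w := 1) (A := A) (U := fun k => P (Function.update a i k))
    (x := (Nat.card F : ℂ) ^ p.natDegree) (s := slice (localWeight H F p) i a)
    (fun k => by rw [slice, PowerSeries.coeff_mk, hax.local_poly F hq p hpm hp]) k
  rwa [Polynomial.eval_one] at this

theorem coeff_evenFactor_mul_slice_global (hax : FourAxioms Γ H C P) {F : Type} [Field F]
    [Finite F] (hq : Nat.card F % 4 = 1) (i : V) (a : V → ℕ) (A k : ℕ) :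
    PowerSeries.coeff k (evenFactor (Nat.card F) A * slice (globalCoeff H F) i a) =
      (evenDiff Polynomial.X A (fun k => C (Function.update a i k)) k).eval (Nat.card F : ℂ) := by
  have := coeff_evenFactor_mul (w := Polynomial.X) (A := A)
    (U := fun k => C (Function.update a i k))
    (x := (Nat.card F : ℂ)) (s := slice (globalCoeff H F) i a)
    (fun k => by rw [slice, PowerSeries.coeff_mk, hax.global_poly F hq]) k
  rwa [Polynomial.eval_X] at this

/-- The local coefficients live in degrees below the middle; in `evenDiff_global_coeff_ne_zero` the
global ones live above it. -/
theorem evenDiff_local_coeff_ne_zero (hax : FourAxioms Γ H C P) {i : V} {a : V → ℕ}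
    (ha : a i = 0) {A k m : ℕ} (hk : 2 ≤ k + ∑ j, a j)
    (hm : (evenDiff 1 A (fun k => P (Function.update a i k)) k).coeff m ≠ 0) :
    2 * m + 1 < k + ∑ j, a j := by
  rcases evenDiff_coeff_ne_zero hm with h | ⟨l, rfl, h⟩
  · have := hax.local_coeff_ne_zero (by rw [sum_update_of_eq_zero ha]; omega) h
    rw [sum_update_of_eq_zero ha] at this
    omega
  · rw [one_mul] at h
    have := hax.local_coeff_ne_zero (by rw [sum_update_of_eq_zero ha]; omega) h
    rw [sum_update_of_eq_zero ha] at this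
    omega

theorem evenDiff_global_coeff_ne_zero (hax : FourAxioms Γ H C P) {i : V} {a : V → ℕ}
    (ha : a i = 0) {A k m : ℕ} (hk : 2 ≤ k + ∑ j, a j)
    (hm : (evenDiff Polynomial.X A (fun k => C (Function.update a i k)) k).coeff m ≠ 0) :
    k + ∑ j, a j + 1 < 2 * m := by
  rcases evenDiff_coeff_ne_zero hm with h | ⟨l, rfl, h⟩
  · have := hax.global_coeff_ne_zero (by rw [sum_update_of_eq_zero ha]; omega) h
    rw [sum_update_of_eq_zero ha] at this
    omega
  · cases m with
    | zero => simp at h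
    | succ m =>
      rw [Polynomial.coeff_X_mul] at h
      have := hax.global_coeff_ne_zero (by rw [sum_update_of_eq_zero ha]; omega) h
      rw [sum_update_of_eq_zero ha] at this
      omega

variable {F : Type} [Field F] [Finite F]

variable (F) in
/-- The tuples of monic polynomials of degrees `a`, as a finite set. -/
def monicTuplesFinset (a : V → ℕ) : Finset (V → F[X]) := (monicTuples_finite F a).toFinset

theorem mem_monicTuplesFinset {V : Type*} [Fintype V] {a : V → ℕ} {f : V → F[X]} :
    f ∈ monicTuplesFinset F a ↔ ∀ j, (f j).Monic ∧ (f j).natDegree = a j := by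
  simp [monicTuplesFinset, monicTuples]

theorem slice_globalCoeff (H : Weights V) {i : V} {a : V → ℕ} (ha : a i = 0) :
    slice (globalCoeff H F) i a = ∑ f ∈ monicTuplesFinset F a, twistedSeries H i f 1 := by
  ext k
  rw [map_sum, slice, PowerSeries.coeff_mk, globalCoeff,
    finsum_mem_eq_finite_toFinset_sum _ (monicTuples_finite F _)]
  simp only [twistedSeries, PowerSeries.coeff_mk, residueSymbol_one_left, Int.cast_one, mul_one]
  rw [← Finset.sum_product']
  refine Finset.sum_nbij' (fun h => (Function.update h i 1, h i))
    (fun x => Function.update x.1 i x.2) ?_ ?_ ?_ ?_ ?_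
  · intro h hh
    have hh' := mem_monicTuplesFinset.1 hh
    rw [Finset.mem_product, mem_monicTuplesFinset, mem_monics]
    refine ⟨fun j => ?_, ?_⟩
    · by_cases hj : j = i
      · subst hj; simp [ha]
      · have := hh' j
        simpa [hj] using this
    · have := hh' i
      simpa using this
  · rintro ⟨f, g⟩ hx
    rw [Finset.mem_product, mem_monicTuplesFinset, mem_monics] at hx
    refine mem_monicTuplesFinset.2 fun j => ?_
    by_cases hj : j = i
    · subst hj; simpa using hx.2
    · simpa [hj] using hx.1 j
  · intro h _; simp
  · rintro ⟨f, g⟩ hx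
    rw [Finset.mem_product, mem_monicTuplesFinset] at hx
    have h1 : f i = 1 := (hx.1 i).1.natDegree_eq_zero.1 (by rw [(hx.1 i).2, ha])
    have : Function.update f i 1 = f := by rw [← h1, Function.update_eq_self]
    simp [this]
  · intro h _; simp

theorem dilate_one_of_eq_one {d : ℕ} (hd : d ≠ 0) (h1 : d = 1) (s : ℂ⟦X⟧) : dilate 1 hd s = s := by
  subst h1
  ext n
  rw [coeff_dilate]
  simp

/-- The tuples of powers of a single linear prime contribute the local series. -/
theorem evenFactor_mul_twistedSeries_linear (hax : FourAxioms Γ H C P)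
    (hq : Nat.card F % 4 = 1) {i : V} {a : V → ℕ} (ha : a i = 0) (c : F) :
    evenFactor (Nat.card F) (nbrSum Γ i a) *
        twistedSeries H i (fun j => (Polynomial.X - Polynomial.C c) ^ a j) 1 =
      evenFactor 1 (nbrSum Γ i a) *
        slice (localWeight H F (Polynomial.X - Polynomial.C c)) i a := by
  have hpm := Polynomial.monic_X_sub_C c
  have hp := Polynomial.irreducible_X_sub_C c
  have h1 := twistedSeries_primePart hax hq hpm hp i ha (f := fun _ => 1)
    (fun _ => Polynomial.monic_one) rfl (fun _ h => hp.not_isUnit (isUnit_of_dvd_one h))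
    Polynomial.monic_one
  simp only [mul_one, Finset.prod_const_one, quadChar_one hp, residueSymbol_one_left,
    Int.cast_one, one_pow, map_one, one_mul] at h1
  rw [dilate_one_of_eq_one _ (Polynomial.natDegree_X_sub_C c), twistedSeries_one hax hq] at h1
  rw [h1, mul_left_comm]
  refine (congrArg _ ?_).trans (mul_one _)
  by_cases hA : Even (nbrSum Γ i a)
  · rw [if_pos hA]
    have := evenFactor_mul_symbolLSeries_of_degree_le_one hq (Polynomial.monic_one (R := F))
      squarefree_one (by simp)
    rw [← this, evenFactor, evenFactor, if_pos hA, if_pos (by simp)]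
  · rw [if_neg hA]
    have := evenFactor_mul_symbolLSeries_of_degree_le_one hq hpm hp.squarefree (by simp)
    rw [← this, evenFactor, evenFactor, if_neg hA, if_neg (by simp)]

theorem linear_pow_injective {V : Type*} [Fintype V] {F : Type} [Field F] {a : V → ℕ}
    (ha : 1 ≤ ∑ j, a j) :
    Function.Injective fun (c : F) (j : V) => (Polynomial.X - Polynomial.C c) ^ a j := by
  intro c c' hcc
  obtain ⟨j, -, hj⟩ : ∃ j ∈ Finset.univ, a j ≠ 0 := by
    by_contra! h
    rw [Finset.sum_eq_zero h] at ha
    omega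
  have h1 := congrArg (Polynomial.eval c) (congrFun hcc j)
  simp only [Polynomial.eval_pow, Polynomial.eval_sub, Polynomial.eval_X, Polynomial.eval_C,
    sub_self, zero_pow hj] at h1
  exact sub_eq_zero.1 ((pow_eq_zero_iff hj).1 h1.symm)

/-- If the exponents at `p` of a tuple of degrees `a` are as large as possible, then `p` is linear
and the tuple consists of powers of `p`. -/
theorem eq_linear_pow_of_sum_le {V : Type*} [Fintype V] {F : Type} [Field F] {a b : V → ℕ}
    {f g : V → F[X]} {p : F[X]} (hpm : p.Monic)
    (hp : Irreducible p) (hf : ∀ j, (f j).Monic ∧ (f j).natDegree = a j)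
    (hfg : ∀ j, f j = p ^ b j * g j) (hb : ∃ j, b j ≠ 0) (hle : ∑ j, a j ≤ ∑ j, b j) :
    ∃ c : F, f = fun j => (Polynomial.X - Polynomial.C c) ^ a j := by
  have hd := hp.natDegree_pos
  have hgm : ∀ j, (g j).Monic := fun j => (hpm.pow (b j)).of_mul_monic_left (hfg j ▸ (hf j).1)
  have hdeg : ∀ j, a j = b j * p.natDegree + (g j).natDegree := by
    intro j
    rw [← (hf j).2, hfg j, (hpm.pow _).natDegree_mul (hgm j), hpm.natDegree_pow]
  have hba : ∀ j, b j ≤ a j := fun j => by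
    rw [hdeg j]
    have := Nat.le_mul_of_pos_right (b j) hd
    omega
  have hab : ∀ j, b j = a j := fun j =>
    (Finset.sum_eq_sum_iff_of_le fun j _ => hba j).1
      (le_antisymm (Finset.sum_le_sum fun j _ => hba j) hle) j (Finset.mem_univ j)
  obtain ⟨j₀, hj₀⟩ := hb
  have hd1 : p.natDegree = 1 := by
    have h1 := hdeg j₀
    rw [← hab j₀] at h1
    by_contra hne
    have h2 : b j₀ * 2 ≤ b j₀ * p.natDegree := Nat.mul_le_mul_left _ (by omega)
    omega
  have hg1 : ∀ j, g j = 1 := fun j => by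
    refine (hgm j).natDegree_eq_zero.1 ?_
    have h1 := hdeg j
    rw [hd1, mul_one, hab j] at h1
    omega
  refine ⟨-p.coeff 0, funext fun j => ?_⟩
  rw [hfg j, hg1 j, mul_one, hab j, Polynomial.C_neg, sub_neg_eq_add,
    ← hpm.eq_X_add_C hd1]

end AxiomConsequences

/-! ### Local and global functional equations -/

section Induction

variable {V : Type*} [Fintype V] [DecidableEq V] {Γ : SimpleGraph V} [DecidableRel Γ.Adj]
  {H : Weights V} {C P : (V → ℕ) → ℂ[X]}

variable (Γ H) in
/-- The functional equation of the local series with exponents `a`, for all fields and primes. -/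
def LocalSelfDual (i : V) (a : V → ℕ) : Prop :=
  ∀ (F : Type) [Field F] [Finite F], Nat.card F % 4 = 1 → ∀ p : F[X], p.Monic → Irreducible p →
    SelfDual ((Nat.card F : ℂ) ^ p.natDegree) (nbrSum Γ i a / 2)
      (evenFactor 1 (nbrSum Γ i a) * slice (localWeight H F p) i a)

/-- Each tuple of degrees `a` contributes a self-dual series, if the local functional equations are
known for the exponents of its primes. -/
theorem selfDual_twistedSeries_one (hax : FourAxioms Γ H C P) {F : Type} [Field F] [Finite F]
    (hq : Nat.card F % 4 = 1) {i : V} {a : V → ℕ} (ha : a i = 0) {f : V → F[X]}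
    (hf : f ∈ monicTuplesFinset F a)
    (hloc : ∀ (p : F[X]), p.Monic → Irreducible p → ∀ (b : V → ℕ) (g : V → F[X]), b i = 0 →
      (∀ j, f j = p ^ b j * g j) → (∃ j, b j ≠ 0) → LocalSelfDual Γ H i b) :
    SelfDual (Nat.card F) (nbrSum Γ i a / 2)
      (evenFactor (Nat.card F) (nbrSum Γ i a) * twistedSeries H i f 1) := by
  rw [mem_monicTuplesFinset] at hf
  have hfi : f i = 1 := (hf i).1.natDegree_eq_zero.1 (by rw [(hf i).2, ha])
  have h := selfDual_twistedSeries hax hq i (fun j => (hf j).1) hfi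
    (fun p hpm hp b g hfg _ hb => ?_) Polynomial.monic_one squarefree_one
    (fun j => isCoprime_one_left)
  · simpa [hf] using h
  · refine hloc p hpm hp b g ?_ hfg hb F hq p hpm hp
    by_contra hbi
    have h1 : p ∣ 1 := by
      rw [← hfi, hfg i]
      exact (dvd_pow_self p hbi).mul_right _
    exact hp.not_isUnit (isUnit_of_dvd_one h1)

/-- Removing the `q` tuples of powers of a linear prime from the global series leaves a series with
a functional equation, if the local functional equations are known for smaller exponents. -/
theorem selfDual_global_sub_local (hax : FourAxioms Γ H C P) {i : V} {a : V → ℕ} (ha : a i = 0)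
    (hB : 1 ≤ ∑ j, a j)
    (ih : ∀ b : V → ℕ, b i = 0 → ∑ j, b j < ∑ j, a j → LocalSelfDual Γ H i b)
    {F : Type} [Field F] [Finite F] (hq : Nat.card F % 4 = 1) :
    SelfDual (Nat.card F) (nbrSum Γ i a / 2)
      (evenFactor (Nat.card F) (nbrSum Γ i a) * slice (globalCoeff H F) i a -
        PowerSeries.C (Nat.card F : ℂ) * (evenFactor 1 (nbrSum Γ i a) *
          slice (localWeight H F (Polynomial.X - Polynomial.C 0)) i a)) := by
  classical
  have := Fintype.ofFinite F
  set linPow : Finset (V → F[X]) := Finset.univ.image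
    fun (c : F) (j : V) => (Polynomial.X - Polynomial.C c) ^ a j with hlinPow
  have hsub : linPow ⊆ monicTuplesFinset F a := by
    intro f hf
    obtain ⟨c, -, rfl⟩ := Finset.mem_image.1 hf
    refine mem_monicTuplesFinset.2 fun j => ⟨(Polynomial.monic_X_sub_C c).pow _, ?_⟩
    rw [(Polynomial.monic_X_sub_C c).natDegree_pow, Polynomial.natDegree_X_sub_C, mul_one]
  have h1 : ∑ f ∈ linPow, evenFactor (Nat.card F) (nbrSum Γ i a) * twistedSeries H i f 1 =
      PowerSeries.C (Nat.card F : ℂ) * (evenFactor 1 (nbrSum Γ i a) *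
          slice (localWeight H F (Polynomial.X - Polynomial.C 0)) i a) := by
    rw [hlinPow, Finset.sum_image (linear_pow_injective hB).injOn]
    have h2 : ∀ c : F, evenFactor (Nat.card F) (nbrSum Γ i a) *
        twistedSeries H i (fun j => (Polynomial.X - Polynomial.C c) ^ a j) 1 =
        evenFactor 1 (nbrSum Γ i a) *
          slice (localWeight H F (Polynomial.X - Polynomial.C 0)) i a := by
      intro c
      rw [evenFactor_mul_twistedSeries_linear hax hq ha]
      congr 1
      ext k
      rw [slice, slice, PowerSeries.coeff_mk, PowerSeries.coeff_mk, localWeight_degree_one hax hq,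
        localWeight_degree_one hax hq]
    rw [Finset.sum_congr rfl fun c _ => h2 c, Finset.sum_const, Finset.card_univ, nsmul_eq_mul,
      Nat.card_eq_fintype_card, map_natCast]
  rw [slice_globalCoeff H ha, Finset.mul_sum, ← Finset.sum_sdiff hsub, h1, add_sub_cancel_right]
  refine SelfDual.sum fun f hf => ?_
  obtain ⟨hf1, hf2⟩ := Finset.mem_sdiff.1 hf
  refine selfDual_twistedSeries_one hax hq ha hf1 fun p hpm hp b g hbi hfg hb => ih b hbi ?_
  by_contra! hle
  obtain ⟨c, hc⟩ := eq_linear_pow_of_sum_le hpm hp (mem_monicTuplesFinset.1 hf1) hfg hb hle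
  exact hf2 (Finset.mem_image.2 ⟨c, Finset.mem_univ c, hc.symm⟩)

/-- The local functional equations, by induction on the sum of the exponents. The difference of the
global and `q` times the local coefficients satisfies the symmetry, and the two are supported in
disjoint ranges of powers of `q` which the symmetry respects. -/
theorem localSelfDual (hax : FourAxioms Γ H C P) {i : V} {a : V → ℕ} (ha : a i = 0) :
    LocalSelfDual Γ H i a := by
  induction hn : ∑ j, a j using Nat.strong_induction_on generalizing a with
  | _ n ih =>
    rcases Nat.eq_zero_or_pos n with rfl | hpos
    · have ha0 : a = fun _ => 0 := by
        funext j
        exact Finset.sum_eq_zero_iff.1 hn j (Finset.mem_univ j)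
      intro F _ _ hq p hpm hp
      have h1 := one_sub_X_mul_slice_zero hax hq hpm i
      subst ha0
      have h2 : nbrSum Γ i (fun _ => 0) = 0 := by simp [nbrSum]
      rw [h2, evenFactor, if_pos Even.zero, map_one, one_mul, h1]
      exact SelfDual.one
    set A := nbrSum Γ i a with hA
    -- the coefficients of the global and the local series, completed by the even factors, as
    -- polynomials in `q`
    set γ := evenDiff Polynomial.X A (fun k => C (Function.update a i k)) with hγ
    set η := evenDiff 1 A (fun k => P (Function.update a i k)) with hη
    have hAn : A ≤ n := by rw [← hn]; exact nbrSum_le_sum a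
    have hE := fun (F : Type) [Field F] [Finite F] (hq : Nat.card F % 4 = 1) =>
      selfDual_global_sub_local hax ha (by omega)
        (fun b hb hlt => ih _ (hn ▸ hlt) hb rfl) (F := F) hq
    have hcoeff : ∀ (F : Type) [Field F] [Finite F] (_ : Nat.card F % 4 = 1) (k : ℕ),
        PowerSeries.coeff k (evenFactor (Nat.card F) A * slice (globalCoeff H F) i a -
          PowerSeries.C (Nat.card F : ℂ) * (evenFactor 1 A *
            slice (localWeight H F (Polynomial.X - Polynomial.C 0)) i a)) =
        (γ k - Polynomial.X * η k).eval (Nat.card F : ℂ) := by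
      intro F _ _ hq k
      rw [map_sub, PowerSeries.coeff_C_mul, coeff_evenFactor_mul_slice_global hax hq,
        coeff_evenFactor_mul_slice_local hax hq (Polynomial.monic_X_sub_C 0)
          (Polynomial.irreducible_X_sub_C 0), Polynomial.natDegree_X_sub_C, pow_one,
        Polynomial.eval_sub, Polynomial.eval_mul, Polynomial.eval_X]
    have hq0 : ∀ (F : Type) [Field F] [Finite F] (_ : Nat.card F % 4 = 1),
        (Nat.card F : ℂ) ≠ 0 := by
      intro F _ _ hq
      have : Nat.card F ≠ 0 := by omega
      exact_mod_cast this
    have hγm : ∀ k m, 2 ≤ k + n → (γ k).coeff m ≠ 0 → k + n + 1 < 2 * m := by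
      intro k m hk hm
      rw [← hn] at hk ⊢
      exact evenDiff_global_coeff_ne_zero hax ha hk hm
    have hηm : ∀ k m, 2 ≤ k + n → (η k).coeff m ≠ 0 → 2 * m + 1 < k + n := by
      intro k m hk hm
      rw [← hn] at hk ⊢
      exact evenDiff_local_coeff_ne_zero hax ha hk hm
    -- in the symmetry at `k`, the global part lives in degrees above `(k + n + 1) / 2 + A / 2` and
    -- `X` times the local part below
    have hsym : ∀ k ≤ 2 * (A / 2),
        Polynomial.X ^ (A / 2) * η k = Polynomial.X ^ k * η (2 * (A / 2) - k) := by
      intro k hk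
      -- for `A ≤ 1` only `k = 0` remains, where the symmetry is void
      rcases Nat.eq_zero_or_pos (A / 2) with h0 | h0
      · have hk0 : k = 0 := by omega
        rw [hk0, h0]
      have heq : Polynomial.X ^ (A / 2) * (γ k - Polynomial.X * η k) =
          Polynomial.X ^ k *
            (γ (2 * (A / 2) - k) - Polynomial.X * η (2 * (A / 2) - k)) := by
        refine eq_of_eval_card_eq fun F _ _ hq => ?_
        have h1 := ((selfDual_iff_coeff (hq0 F hq)).1 (hE F hq)).1 k hk
        rw [hcoeff F hq, hcoeff F hq] at h1
        rw [Polynomial.eval_mul, Polynomial.eval_mul, Polynomial.eval_pow, Polynomial.eval_pow,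
          Polynomial.eval_X]
        exact h1
      refine X_pow_mul_eq_of_separated (N := k + n + 1 + 2 * (A / 2)) ?_ ?_ ?_ ?_ heq
      · intro m hm
        have := hγm k m (by omega) hm
        omega
      · intro m hm
        have := hγm _ m (by omega) hm
        omega
      · intro m hm
        have := hηm k m (by omega) hm
        omega
      · intro m hm
        have := hηm _ m (by omega) hm
        omega
    have hvan : ∀ k, 2 * (A / 2) < k → η k = 0 := by
      intro k hk
      have heq : Polynomial.X ^ 0 * (γ k - Polynomial.X * η k) =
          Polynomial.X ^ 0 * (0 - Polynomial.X * 0) := by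
        refine eq_of_eval_card_eq fun F _ _ hq => ?_
        have h1 := ((selfDual_iff_coeff (hq0 F hq)).1 (hE F hq)).2 k hk
        rw [hcoeff F hq] at h1
        simpa using h1
      have := X_pow_mul_eq_of_separated (N := k + n + 1) ?_ ?_ ?_ ?_ heq
      · simpa using this
      · intro m hm
        have := hγm k m (by omega) hm
        omega
      · simp
      · intro m hm
        have := hηm k m (by omega) hm
        omega
      · simp
    intro F _ _ hq p hpm hp
    rw [selfDual_iff_coeff (pow_ne_zero _ (hq0 F hq))]
    simp only [coeff_evenFactor_mul_slice_local hax hq hpm hp]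
    refine ⟨fun k hk => ?_, fun k hk => ?_⟩
    · have := congrArg (Polynomial.eval ((Nat.card F : ℂ) ^ p.natDegree)) (hsym k hk)
      simpa only [Polynomial.eval_mul, Polynomial.eval_pow, Polynomial.eval_X] using this
    · have := congrArg (Polynomial.eval ((Nat.card F : ℂ) ^ p.natDegree)) (hvan k hk)
      simpa only [Polynomial.eval_zero] using this

theorem selfDual_global (hax : FourAxioms Γ H C P) {F : Type} [Field F] [Finite F]
    (hq : Nat.card F % 4 = 1) {i : V} {a : V → ℕ} (ha : a i = 0) :
    SelfDual (Nat.card F) (nbrSum Γ i a / 2)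
      (evenFactor (Nat.card F) (nbrSum Γ i a) * slice (globalCoeff H F) i a) := by
  rw [slice_globalCoeff H ha, Finset.mul_sum]
  exact SelfDual.sum fun f hf => selfDual_twistedSeries_one hax hq ha hf
    fun p _ _ b _ hb _ _ => localSelfDual hax hb

end Induction

/-! ### Functional equations in one and in several variables -/

section OneVariable

theorem sqrt_sq_card (q : ℕ) : ((√(q : ℝ) : ℝ) : ℂ) ^ 2 = q := by
  have : (√(q : ℝ)) ^ 2 = q := Real.sq_sqrt (by positivity)
  exact_mod_cast this

theorem sqrt_card_ne_zero {q : ℕ} (hq : q ≠ 0) : ((√(q : ℝ) : ℝ) : ℂ) ≠ 0 := by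
  have : (0 : ℝ) < q := by positivity
  exact_mod_cast (Real.sqrt_pos.2 this).ne'

/-- With `Q = q^d` and `y = x^d`, the functional equation under `y ↦ (Q y)⁻¹` is the one under
`x ↦ (q x)⁻¹`. -/
theorem SelfDual.oddFunctionalEquation {q d v : ℕ} (hq : q ≠ 0) {s : ℂ⟦X⟧}
    (h : SelfDual ((q : ℂ) ^ d) v s) : OddFunctionalEquation q d (2 * v + 1) s := by
  have hq0 : (q : ℂ) ≠ 0 := by exact_mod_cast hq
  obtain ⟨N, rfl, hNd, hN⟩ := (selfDual_iff_polynomial (pow_ne_zero d hq0)).1 h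
  refine ⟨N, rfl, by simpa using hNd, fun x hx => ?_⟩
  rw [← hN (x ^ d) (pow_ne_zero d hx), Nat.add_sub_cancel, ← mul_pow, ← mul_inv, ← inv_pow]
  congr 1
  rw [mul_assoc 2 v d, pow_mul _ 2, mul_pow, sqrt_sq_card, mul_pow]
  ring

theorem SelfDual.evenFunctionalEquation {q d v : ℕ} (hq : q ≠ 0) {w : ℂ} {s : ℂ⟦X⟧}
    (h : SelfDual ((q : ℂ) ^ d) v ((1 - PowerSeries.C w * PowerSeries.X) * s)) :
    EvenFunctionalEquation q d (2 * v) w s := by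
  have hq0 : (q : ℂ) ≠ 0 := by exact_mod_cast hq
  obtain ⟨N, hs, hNd, hN⟩ := (selfDual_iff_polynomial (pow_ne_zero d hq0)).1 h
  refine ⟨N, hs, hNd, fun x hx h1 h2 => ?_⟩
  rw [fracEval, fracEval, mul_div_cancel₀ _ (sub_ne_zero.2 h1.symm), mul_assoc,
    mul_div_cancel₀ _ (sub_ne_zero.2 h2.symm), ← hN (x ^ d) (pow_ne_zero d hx), ← mul_pow,
    ← mul_inv, ← inv_pow]
  congr 1
  rw [mul_assoc 2 v d, pow_mul _ 2, mul_pow, sqrt_sq_card, mul_pow]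
  ring

theorem coeffZ_one_sub_mul (w : ℂ) (s : ℂ⟦X⟧) (k : ℤ) :
    coeffZ ((1 - PowerSeries.C w * PowerSeries.X) * s) k = coeffZ s k - w * coeffZ s (k - 1) := by
  rcases lt_or_ge k 0 with hk | hk
  · rw [coeffZ_of_neg _ hk, coeffZ_of_neg _ hk, coeffZ_of_neg _ (by omega)]
    simp
  · lift k to ℕ using hk
    rw [coeffZ_natCast, coeffZ_natCast, sub_mul, one_mul, map_sub, mul_assoc,
      PowerSeries.coeff_C_mul]
    cases k with
    | zero => rw [coeffZ_of_neg _ (by simp)]; simp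
    | succ k =>
      rw [PowerSeries.coeff_succ_X_mul, ← coeffZ_natCast s k]
      congr 3
      push_cast
      ring

variable {V : Type*} [DecidableEq V]

theorem slice_update (u : (V → ℕ) → ℂ) (i : V) (a : V → ℕ) (k : ℕ) :
    slice u i (Function.update a i k) = slice u i a := by
  ext n
  simp [slice]

theorem nbrSum_update [Fintype V] (Γ : SimpleGraph V) [DecidableRel Γ.Adj] {M : Type*}
    [AddCommMonoid M] (i : V) (a : V → M) (k : M) :
    nbrSum Γ i (Function.update a i k) = nbrSum Γ i a := by
  refine Finset.sum_congr rfl fun j hj => Function.update_of_ne ?_ _ _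
  rw [SimpleGraph.mem_neighborFinset] at hj
  exact hj.ne'

end OneVariable

section SeveralVariables

variable {V : Type*} [DecidableEq V] {d : ℕ} {i : V}

theorem toBiSeries_eq_zero {V : Type*} {u : (V → ℕ) → ℂ} {b : V → ℤ} (j : V)
    (h : ¬ (0 ≤ b j ∧ (d : ℤ) ∣ b j)) : toBiSeries d u b = 0 :=
  if_neg fun hall => h (hall j)

theorem toBiSeries_eq_coeffZ (hd : d ≠ 0) (u : (V → ℕ) → ℂ) {b : V → ℤ} {a : V → ℕ}
    (hb : ∀ j ≠ i, b j = d * a j) {k : ℤ} (hk : b i = d * k) :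
    toBiSeries d u b = coeffZ (slice u i a) k := by
  have hdpos : (0 : ℤ) < d := by omega
  rcases lt_or_ge k 0 with hneg | hpos
  · rw [coeffZ_of_neg _ hneg]
    refine toBiSeries_eq_zero i fun h => ?_
    rw [hk] at h
    exact absurd h.1 (not_le.2 (mul_neg_of_pos_of_neg hdpos hneg))
  · lift k to ℕ using hpos
    rw [coeffZ_natCast, slice, PowerSeries.coeff_mk, toBiSeries, if_pos]
    · congr 1
      funext j
      by_cases hj : j = i
      · subst hj
        rw [hk, Int.mul_ediv_cancel_left _ hdpos.ne', Function.update_self, Int.toNat_natCast]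
      · rw [hb j hj, Int.mul_ediv_cancel_left _ hdpos.ne', Function.update_of_ne hj,
          Int.toNat_natCast]
    · intro j
      by_cases hj : j = i
      · subst hj
        rw [hk]
        exact ⟨by positivity, dvd_mul_right _ _⟩
      · rw [hb j hj]
        exact ⟨by positivity, dvd_mul_right _ _⟩

variable [Fintype V] {Γ : SimpleGraph V} [DecidableRel Γ.Adj]

theorem nbrSum_eq_mul {V : Type*} {i : V} [Fintype V] {Γ : SimpleGraph V} [DecidableRel Γ.Adj]
    {b : V → ℤ} {a : V → ℕ} (hb : ∀ j ≠ i, b j = d * a j) :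
    nbrSum Γ i b = d * (nbrSum Γ i a : ℕ) := by
  rw [nbrSum, nbrSum, Nat.cast_sum, Finset.mul_sum]
  refine Finset.sum_congr rfl fun j hj => hb j ?_
  rw [SimpleGraph.mem_neighborFinset] at hj
  exact hj.ne'

theorem substSigma_apply (q : ℕ) (S : BiSeries V) (b : V → ℤ) :
    substSigma Γ q i S b = ((√(q : ℝ) : ℝ) : ℂ) ^ (2 * b i - nbrSum Γ i b) *
      S (Function.update b i (nbrSum Γ i b - b i)) := by
  rw [substSigma, nbrSum_reflectExp]
  simp only [reflectExp, Function.update_self]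
  congr 2
  ring

/-- On the line of exponents in direction `i` through `d a`, the substitution `σ_i` reverses the
coefficients of the one-variable series at `a`. -/
theorem substSigma_eq_coeffZ (hd : d ≠ 0) {q : ℕ} (u : (V → ℕ) → ℂ) {b : V → ℤ}
    {a : V → ℕ} (hb : ∀ j ≠ i, b j = d * a j) {k : ℤ} (hk : b i = d * k) :
    substSigma Γ q i (toBiSeries d u) b =
      (((√(q : ℝ) : ℝ) : ℂ) ^ d) ^ (2 * k - nbrSum Γ i a) *
        coeffZ (slice u i a) (nbrSum Γ i a - k) := by
  rw [substSigma_apply, toBiSeries_eq_coeffZ (i := i) (a := a) (k := nbrSum Γ i a - k) hd u,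
    nbrSum_eq_mul hb, hk, ← zpow_natCast, ← zpow_mul]
  · congr 2
    ring
  · intro j hj
    rw [Function.update_of_ne hj, hb j hj]
  · rw [Function.update_self, nbrSum_eq_mul hb, hk]
    ring

/-- A tuple of exponents either is a multiple of `d` with nonnegative entries away from `i`, or
does not occur in any series of the functional equations. -/
theorem exists_eq_mul_or (hd : d ≠ 0) (i : V) (b : V → ℤ) :
    (∃ (a : V → ℕ) (k : ℤ), (∀ j ≠ i, b j = d * a j) ∧ b i = d * k) ∨
      ∀ (u : (V → ℕ) → ℂ) (q : ℕ) (m : ℤ),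
        toBiSeries d u (Function.update b i (b i - d * m)) = 0 ∧
        substSigma Γ q i (toBiSeries d u) (Function.update b i (b i - d * m)) = 0 := by
  have hdpos : (0 : ℤ) < d := by omega
  by_cases hgood : ∀ j ≠ i, 0 ≤ b j ∧ (d : ℤ) ∣ b j
  · have hb : ∀ j ≠ i, b j = d * ((b j / d).toNat : ℕ) := by
      intro j hj
      obtain ⟨h0, c, hc⟩ := hgood j hj
      have hc0 : 0 ≤ c := by
        rw [hc] at h0
        exact nonneg_of_mul_nonneg_right h0 hdpos
      rw [hc, Int.mul_ediv_cancel_left _ hdpos.ne', Int.toNat_of_nonneg hc0]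
    by_cases hi : (d : ℤ) ∣ b i
    · obtain ⟨k, hk⟩ := hi
      exact Or.inl ⟨fun j => (b j / d).toNat, k, hb, hk⟩
    · right
      intro u q m
      have h1 : ¬ (d : ℤ) ∣ b i - d * m := fun h =>
        hi ((dvd_sub_left (dvd_mul_right _ _)).1 h)
      refine ⟨toBiSeries_eq_zero i fun h => h1 ?_, ?_⟩
      · simpa using h.2
      · rw [substSigma_apply, toBiSeries_eq_zero i, mul_zero]
        rintro ⟨-, h⟩
        rw [Function.update_self, nbrSum_update, Function.update_self,
          nbrSum_eq_mul (a := fun j => (b j / d).toNat) hb] at h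
        exact h1 ((dvd_sub_right (dvd_mul_right _ _)).1 h)
  · right
    push Not at hgood
    obtain ⟨j, hj, hbj⟩ := hgood
    intro u q m
    refine ⟨toBiSeries_eq_zero j fun h => ?_, ?_⟩
    · rw [Function.update_of_ne hj] at h
      exact hbj h.1 h.2
    · rw [substSigma_apply, toBiSeries_eq_zero j, mul_zero]
      rintro ⟨h1, h2⟩
      rw [Function.update_of_ne hj, Function.update_of_ne hj] at h1 h2
      exact hbj h1 h2

theorem slice_oddPart (u : (V → ℕ) → ℂ) (a : V → ℕ) :
    slice (oddPart Γ i u) i a = if Odd (nbrSum Γ i a) then slice u i a else 0 := by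
  ext k
  simp only [slice, PowerSeries.coeff_mk, oddPart, nbrSum_update]
  split_ifs <;> simp

theorem slice_evenPart (u : (V → ℕ) → ℂ) (a : V → ℕ) :
    slice (evenPart Γ i u) i a = if Even (nbrSum Γ i a) then slice u i a else 0 := by
  ext k
  simp only [slice, PowerSeries.coeff_mk, evenPart, nbrSum_update]
  split_ifs <;> simp

/-- The functional equation of the odd part, line by line in direction `i`. -/
theorem substSigma_oddPart (hd : d ≠ 0) {q : ℕ} (hq : q ≠ 0) {u : (V → ℕ) → ℂ}
    (h : ∀ a : V → ℕ, Odd (nbrSum Γ i a) →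
      SelfDual ((q : ℂ) ^ d) (nbrSum Γ i a / 2) (slice u i a)) :
    substSigma Γ q i (toBiSeries d (oddPart Γ i u)) =
      monomialMul (((√(q : ℝ) : ℝ) : ℂ) ^ d) i d (toBiSeries d (oddPart Γ i u)) := by
  have hs := pow_ne_zero d (sqrt_card_ne_zero hq)
  funext b
  rcases exists_eq_mul_or (Γ := Γ) hd i b with ⟨a, k, hb, hk⟩ | hzero
  · rw [monomialMul, substSigma_eq_coeffZ hd _ hb hk,
      toBiSeries_eq_coeffZ (i := i) (a := a) (k := k - 1) hd, slice_oddPart]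
    · split_ifs with hA
      · rw [h a hA (k - 1)]
        obtain ⟨v, hv⟩ := hA
        rw [hv, show (2 * v + 1) / 2 = v by omega, ← sqrt_sq_card q, ← pow_mul, mul_comm 2 d,
          pow_mul, ← zpow_natCast (_ ^ d) 2, ← zpow_mul, ← mul_assoc, ← zpow_one_add₀ hs]
        congr 2
        · push_cast
          ring
        · push_cast
          ring
      · simp [coeffZ]
    · intro j hj
      rw [Function.update_of_ne hj, hb j hj]
    · rw [Function.update_self, hk]
      ring
  · have h0 := (hzero (oddPart Γ i u) q 0).2
    have h1 := (hzero (oddPart Γ i u) q 1).1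
    rw [mul_zero, sub_zero, Function.update_eq_self] at h0
    rw [mul_one] at h1
    rw [h0, monomialMul, h1, mul_zero]

/-- The functional equation of the even part, for both global (`d = 1`, `w = q`) and local (`w = 1`)
series. -/
theorem substSigma_evenPart (hd : d ≠ 0) {q : ℕ} (hq : q ≠ 0) {w : ℂ} {u : (V → ℕ) → ℂ}
    (h : ∀ a : V → ℕ, Even (nbrSum Γ i a) →
      SelfDual ((q : ℂ) ^ d) (nbrSum Γ i a / 2)
        ((1 - PowerSeries.C w * PowerSeries.X) * slice u i a)) :
    substSigma Γ q i (toBiSeries d (evenPart Γ i u)) -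
        monomialMul (w * ((q : ℂ) ^ d)⁻¹) i (-(d : ℤ))
          (substSigma Γ q i (toBiSeries d (evenPart Γ i u))) =
      toBiSeries d (evenPart Γ i u) - monomialMul w i d (toBiSeries d (evenPart Γ i u)) := by
  have hs := pow_ne_zero d (sqrt_card_ne_zero hq)
  have hq0 : ((q : ℂ) ^ d) ≠ 0 := pow_ne_zero d (by exact_mod_cast hq)
  funext b
  rw [Pi.sub_apply, Pi.sub_apply, monomialMul, monomialMul]
  rcases exists_eq_mul_or (Γ := Γ) hd i b with ⟨a, k, hb, hk⟩ | hzero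
  · rw [substSigma_eq_coeffZ hd _ hb hk, toBiSeries_eq_coeffZ hd _ hb hk,
      toBiSeries_eq_coeffZ (i := i) (a := a) (k := k - 1) hd,
      substSigma_eq_coeffZ (i := i) (a := a) (k := k + 1) hd, slice_evenPart]
    · split_ifs with hA
      · have h1 := h a hA k
        rw [coeffZ_one_sub_mul, coeffZ_one_sub_mul] at h1
        rw [h1]
        obtain ⟨v, hv⟩ := hA
        have h2 : ∀ z : ℤ, (((√(q : ℝ) : ℝ) : ℂ) ^ d) ^ (2 * z) = ((q : ℂ) ^ d) ^ z := by
          intro z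
          rw [zpow_mul]
          congr 1
          rw [← sqrt_sq_card q, ← pow_mul, mul_comm 2 d, pow_mul]
          norm_cast
        rw [hv, show (v + v) / 2 = v by omega,
          show (2 * k - ((v + v : ℕ) : ℤ)) = 2 * (k - v) by push_cast; ring,
          show (2 * (k + 1) - ((v + v : ℕ) : ℤ)) = 2 * (k - v + 1) by push_cast; ring, h2, h2,
          zpow_add_one₀ hq0, show ((v + v : ℕ) : ℤ) - k = 2 * v - k by push_cast; ring,
          show ((v + v : ℕ) : ℤ) - (k + 1) = 2 * v - k - 1 by push_cast; ring]
        field_simp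
      · simp [coeffZ]
    · intro j hj
      rw [Function.update_of_ne hj, hb j hj]
    · rw [Function.update_self, hk]
      ring
    · intro j hj
      rw [Function.update_of_ne hj, hb j hj]
    · rw [Function.update_self, hk]
      ring
  · have h0 := hzero (evenPart Γ i u) q 0
    have h1 := (hzero (evenPart Γ i u) q 1).1
    have h2 := (hzero (evenPart Γ i u) q (-1)).2
    rw [mul_zero, sub_zero, Function.update_eq_self] at h0
    rw [mul_one] at h1
    rw [mul_neg, mul_one] at h2
    rw [h0.1, h0.2, h1, h2, mul_zero, mul_zero]

end SeveralVariables

end WeylMDS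

end

theorem proposition2p2 {V : Type*} [Fintype V] [DecidableEq V] (Γ : SimpleGraph V)
    [DecidableRel Γ.Adj] (H : WeylMDS.Weights V) (C P : (V → ℕ) → Polynomial ℂ)
    (hax : WeylMDS.FourAxioms Γ H C P)
    (F : Type) [Field F] [Finite F] (q : ℕ) (hq : Nat.card F = q) (hq4 : q % 4 = 1)
    (p : Polynomial F) (hpm : p.Monic) (hp : Irreducible p) (d : ℕ) (hd : p.natDegree = d)
    (i : V) :
    -- the one-variable series `λ` and `λ_p`, for every choice of the other indices
    (∀ (a : V → ℕ) (A : ℕ), WeylMDS.nbrSum Γ i a = A →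
      ∀ l lp : PowerSeries ℂ, l = WeylMDS.slice (WeylMDS.globalCoeff H F) i a →
        lp = WeylMDS.slice (WeylMDS.localWeight H F p) i a →
      (Odd A →
        WeylMDS.OddFunctionalEquation q 1 A l ∧
        WeylMDS.OddFunctionalEquation q d A lp ∧
        (∀ k : ℤ, WeylMDS.coeffZ l k =
          (q : ℂ) ^ (k - ((A : ℤ) - 1) / 2) * WeylMDS.coeffZ l (A - 1 - k)) ∧
        (∀ k : ℤ, WeylMDS.coeffZ lp k =
          ((q : ℂ) ^ d) ^ (k - ((A : ℤ) - 1) / 2) * WeylMDS.coeffZ lp (A - 1 - k))) ∧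
      (Even A →
        WeylMDS.EvenFunctionalEquation q 1 A q l ∧
        WeylMDS.EvenFunctionalEquation q d A 1 lp ∧
        (∀ k : ℤ, WeylMDS.coeffZ l k - q * WeylMDS.coeffZ l (k - 1) =
          (q : ℂ) ^ (k - (A : ℤ) / 2) *
            (WeylMDS.coeffZ l (A - k) - q * WeylMDS.coeffZ l (A - k - 1))) ∧
        (∀ k : ℤ, WeylMDS.coeffZ lp k - WeylMDS.coeffZ lp (k - 1) =
          ((q : ℂ) ^ d) ^ (k - (A : ℤ) / 2) *
            (WeylMDS.coeffZ lp (A - k) - WeylMDS.coeffZ lp (A - k - 1))))) ∧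
    -- the functional equations of the series `Z` and `Z_p` under `σ_i`
    (∀ Zodd Zeven Zpodd Zpeven : WeylMDS.BiSeries V,
      Zodd = WeylMDS.toBiSeries 1 (WeylMDS.oddPart Γ i (WeylMDS.globalCoeff H F)) →
      Zeven = WeylMDS.toBiSeries 1 (WeylMDS.evenPart Γ i (WeylMDS.globalCoeff H F)) →
      Zpodd = WeylMDS.toBiSeries d (WeylMDS.oddPart Γ i (WeylMDS.localWeight H F p)) →
      Zpeven = WeylMDS.toBiSeries d (WeylMDS.evenPart Γ i (WeylMDS.localWeight H F p)) →
      WeylMDS.substSigma Γ q i Zodd =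
        WeylMDS.monomialMul ((√(q : ℝ) : ℝ) : ℂ) i 1 Zodd ∧
      WeylMDS.substSigma Γ q i Zeven -
          WeylMDS.monomialMul 1 i (-1) (WeylMDS.substSigma Γ q i Zeven) =
        Zeven - WeylMDS.monomialMul (q : ℂ) i 1 Zeven ∧
      WeylMDS.substSigma Γ q i Zpodd =
        WeylMDS.monomialMul (((√(q : ℝ) : ℝ) : ℂ) ^ d) i d Zpodd ∧
      WeylMDS.substSigma Γ q i Zpeven -
          WeylMDS.monomialMul (((q : ℂ) ^ d)⁻¹) i (-(d : ℤ)) (WeylMDS.substSigma Γ q i Zpeven) =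
        Zpeven - WeylMDS.monomialMul 1 i d Zpeven) := by
  subst hq hd
  have hq0 : Nat.card F ≠ 0 := by omega
  have hd0 : p.natDegree ≠ 0 := hp.natDegree_pos.ne'
  -- the index `a i` does not matter and may be taken to be `0`
  have hglob : ∀ a : V → ℕ, WeylMDS.SelfDual (((Nat.card F : ℕ) : ℂ) ^ 1) (WeylMDS.nbrSum Γ i a / 2)
      (WeylMDS.evenFactor (Nat.card F) (WeylMDS.nbrSum Γ i a) *
        WeylMDS.slice (WeylMDS.globalCoeff H F) i a) := by
    intro a
    have h := WeylMDS.selfDual_global hax (F := F) hq4 (i := i) (a := Function.update a i 0)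
      (by simp)
    rw [WeylMDS.nbrSum_update, WeylMDS.slice_update] at h
    rwa [pow_one]
  have hloc : ∀ a : V → ℕ, WeylMDS.SelfDual (((Nat.card F : ℕ) : ℂ) ^ p.natDegree)
      (WeylMDS.nbrSum Γ i a / 2) (WeylMDS.evenFactor 1 (WeylMDS.nbrSum Γ i a) *
        WeylMDS.slice (WeylMDS.localWeight H F p) i a) := by
    intro a
    have h := WeylMDS.localSelfDual hax (i := i) (a := Function.update a i 0) (by simp) F hq4 p
      hpm hp
    rwa [WeylMDS.nbrSum_update, WeylMDS.slice_update] at h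
  have hodd : ∀ (w : ℂ) (A : ℕ) (s : PowerSeries ℂ), Odd A → WeylMDS.evenFactor w A * s = s := by
    intro w A s hA
    rw [WeylMDS.evenFactor, if_neg (Nat.not_even_iff_odd.2 hA), one_mul]
  have heven : ∀ (w : ℂ) (A : ℕ), Even A →
      WeylMDS.evenFactor w A = 1 - PowerSeries.C w * PowerSeries.X := fun w A hA => if_pos hA
  refine ⟨?_, ?_⟩
  · rintro a A hA l lp rfl rfl
    have hg := hglob a
    have hl := hloc a
    rw [hA] at hg hl
    constructor
    · intro hAo
      rw [hodd _ _ _ hAo] at hg hl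
      obtain ⟨v, rfl⟩ := hAo
      rw [show (2 * v + 1) / 2 = v by omega] at hg hl
      have hv : ((2 * v + 1 : ℕ) : ℤ) - 1 = 2 * v := by push_cast; ring
      have hv2 : (2 * v : ℤ) / 2 = v := by omega
      refine ⟨hg.oddFunctionalEquation hq0, hl.oddFunctionalEquation hq0, fun k => ?_, fun k => ?_⟩
      · rw [hv, hv2, hg k, pow_one]
      · rw [hv, hv2, hl k]
    · intro hAe
      rw [heven _ _ hAe] at hg hl
      obtain ⟨v, rfl⟩ := hAe
      rw [← two_mul, Nat.mul_div_cancel_left v two_pos] at hg hl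
      rw [← two_mul]
      have hv : (((2 * v : ℕ) : ℤ)) = 2 * v := by push_cast; ring
      have hv2 : (2 * v : ℤ) / 2 = v := by omega
      refine ⟨hg.evenFunctionalEquation hq0, hl.evenFunctionalEquation hq0, fun k => ?_,
        fun k => ?_⟩
      · have h := hg k
        rw [WeylMDS.coeffZ_one_sub_mul, WeylMDS.coeffZ_one_sub_mul, pow_one] at h
        rw [hv, hv2, h]
      · have h := hl k
        rw [WeylMDS.coeffZ_one_sub_mul, WeylMDS.coeffZ_one_sub_mul, one_mul, one_mul] at h
        rw [hv, hv2, h]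
  · rintro Zodd Zeven Zpodd Zpeven rfl rfl rfl rfl
    refine ⟨?_, ?_, ?_, ?_⟩
    · have h := WeylMDS.substSigma_oddPart (Γ := Γ) (i := i) (d := 1) one_ne_zero hq0
        (u := WeylMDS.globalCoeff H F) fun a ha => by
          have := hglob a
          rwa [hodd _ _ _ ha] at this
      rwa [pow_one, Nat.cast_one] at h
    · have h := WeylMDS.substSigma_evenPart (Γ := Γ) (i := i) (d := 1) one_ne_zero hq0
        (w := Nat.card F) (u := WeylMDS.globalCoeff H F) fun a ha => by
          have := hglob a
          rwa [heven _ _ ha] at this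
      rwa [pow_one, Nat.cast_one, mul_inv_cancel₀ (by exact_mod_cast hq0)] at h
    · exact WeylMDS.substSigma_oddPart hd0 hq0 fun a ha => by
        have := hloc a
        rwa [hodd _ _ _ ha] at this
    · have h := WeylMDS.substSigma_evenPart (Γ := Γ) (i := i) hd0 hq0
        (w := 1) (u := WeylMDS.localWeight H F p) fun a ha => by
          have := hloc a
          rwa [heven _ _ ha] at this
      rwa [one_mul] at h
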